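/- **Theorem.** *Signal and observations.* Let $F:\mathbb R^d\to\mathbb R^d$ be differentiable and Lipschitz, $b>0$, and let $\mathcal K_h(x,\cdot)$ be the law of $u(h)$, where $du=F(u)\,dt+\sqrt{2b}\,dW$, $u(0)=x$, with $W$ a standard Brownian motion in $\mathbb R^d$. Observations are modelled by $y_j=Hu_j+\eta_j$ with $H\in\mathbb R^{m\times d}$ and i.i.d. $\eta_j\sim N(0,\Gamma)$, $\Gamma$ positive definite; put $g(u,y)=e^{-\frac12|\Gamma^{-1/2}(y-Hu)|^2}$. For a measure $\mu$ write $(\mathcal K_h^\top\mu)(A)=\int\mathcal K_h(u,A)\,\mu(du)$. Put $\lambda=0$ if $F$ is linear and $\lambda=1$ otherwise. Fix $r$ and $h_{\max}$. *Filters.* Let $0<h\le h_{\max}$, let $\rho_0=\rho_0^h$ be a probability measure and $y=(y_j)_{j\ge1}$ an observation sequence. The true filtering distribution is $\rho_{t_0}=\rho_0$, $\rho_{t_{j+1}}\propto g(\cdot,y_{j+1})\,\mathcal K_h^\top\rho_{t_j}$. For a matrix $C$ put $A_C=CH^\top(HCH^\top+\Gamma)^{-1}$, and for a probability measure $\mu$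 let $\mathcal U_{C}^{j}\mu$ be the law of $(I-A_CH)\hat v+A_C(y_j+\tilde\eta)$ with $\hat v\sim\mu$, $\tilde\eta\sim N(0,\Gamma)$ independent. The mean-field EnKF is $\pi_{t_0}=\rho_0$, $\pi_{t_{j+1}}=\mathcal U^{j+1}_{C}\mathcal K_h^\top\pi_{t_j}$ with $C=\mathrm{Cov}(\mathcal K_h^\top\pi_{t_j})$. The EnKF distribution $\hat\pi^N_{t_j}$ is the empirical measure of $N$ members: they start as independent draws from $\rho_0$; given the ensemble, $\hat v^{(n)}_{j+1}\sim\mathcal K_h(v^{(n)}_j,\cdot)$ and $\tilde\eta^{(n)}_{j+1}\sim N(0,\Gamma)$ are independent, and $v^{(n)}_{j+1}=(I-A_{\hat C}H)\hat v^{(n)}_{j+1}+A_{\hat C}(y_{j+1}+\tilde\eta^{(n)}_{j+1})$ with $\hat C$ the sample covariance (factor $1/N$) of the $\hat v^{(n)}_{j+1}$. *Distances.* For random measures, $d(\mu,\nu)=\sup_f\big(\mathbb E|\int f\,d\mu-\int f\,d\nu|^2\big)^{1/2}$ over $f$ with $\sup|f|+\mathrm{Lip}(f)\le1$, where $\mathbb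 E$ is the expectation over the ensemble. For deterministic measures $d_\infty$ and $d_{\infty,2}$ are the suprema of $|\int f\,d\mu-\int f\,d\nu|$ over measurable $f$ with $|f|\le1$ and with $|f(u)|\le1+|u|^2$ respectively. *Deterministic mean-field EnKF.* Let $\kappa_1,\kappa_2>0$ and $\kappa=\min\{\kappa_1,\kappa_2\}$. A run with $N$ degrees of freedom, a Fokker–Planck solver of order $\kappa_1$, a quadrature rule of order $\kappa_2$, error constant $a\ge0$ and domain-truncation bias $\beta\ge0$ (the case $\beta=0$ meaning that this bias is ignored) consists of probability measures $\pi^N_{t_j},\tilde\pi^N_{t_j}$ with finite second moments and matrices $C^N_j$ such that, with $e_i=aN^{-\kappa_i/d}+\beta$, for all $j\ge0$: $d_{\infty,2}(\pi^N_{t_0},\rho_0)\le e_1$ (initial discretization), $d_{\infty,2}(\tilde\pi^N_{t_{j+1}},\mathcal K_h^\top\pi^N_{t_j})\le e_1$ (forecast), every entry of $C^N_{j+1}-\mathrm{Cov}(\tilde\pi^N_{t_{j+1}})$ is at most $e_2$ in absolute value, and $d_{\infty,2}(\pi^N_{t_{j+1}},\mathcal U^{j+1}_{C^N_{j+1}}\tilde\pi^N_{t_{j+1}})\le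 e_2$ (update). *Assumptions*, with constants uniform over $0<h\le h_{\max}$: (a) all moments of $\rho_0^h$ are bounded and $\mathrm{Cov}(\rho^h_0)\ge\varepsilon I$ for some $\varepsilon>0$; (b) $d_\infty(\rho^h_0,G\rho^h_0)\le c\lambda h$, where $G\mu$ is the Gaussian with the mean and covariance of $\mu$ (so $\rho_0^h$ is Gaussian if $F$ is linear); (c) for every $j$ there is $c_j$ such that $d_\infty(\mathcal K_h^\top\pi_{t_j},\pi_{t_j})\le c_jh$ and $d_\infty(\mathcal K_h^\top\rho_{t_j},\rho_{t_j})\le c_jh$ for all observation sequences with $\sup_j|y_j|\le r$. *Conclusion.* For every $j$ there is a constant $C$ such that for all $0<h\le h_{\max}$, all observation sequences with $\sup_i|y_i|\le r$ and all $N\ge1$, $$d(\hat\pi^N_{t_j},\rho_{t_j})\le C\,(N^{-1/2}+\lambda h),$$ and, for all $a,\beta\ge0$ and every run of the deterministic mean-field EnKF as above, $$d(\pi^N_{t_j},\rho_{t_j})\le C\,(aN^{-\kappa/d}+\beta+\lambda h).$$ The constant $C$ does not depend on $h$, $N$, the observations, $a$, $\beta$ or the run. -/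

import Mathlib

open MeasureTheory ProbabilityTheory Matrix
open scoped ENNReal NNReal

noncomputable section

namespace MeanFieldEnKF

/-- Euclidean space `ℝⁿ`. -/
abbrev Euc (n : ℕ) : Type := EuclideanSpace ℝ (Fin n)

/-! ### Distances between measures -/

/-- The bounded Lipschitz unit ball: `|f|_∞ + Lip(f) ≤ 1`. -/
def IsBLUnit {n : ℕ} (f : Euc n → ℝ) : Prop :=
  ∃ s l : ℝ, 0 ≤ s ∧ 0 ≤ l ∧ s + l ≤ 1 ∧ (∀ u, |f u| ≤ s) ∧ ∀ u v, |f u - f v| ≤ l * ‖u - v‖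

/-- The metric `d(μ, ν) = sup_{|f|_L ≤ 1} (E |∫ f dμ - ∫ f dν|²)^{1/2}` between two random measures,
where `E` is the expectation under `P`. -/
def randDist {n : ℕ} {Ω : Type*} [MeasurableSpace Ω] (P : Measure Ω) (μ ν : Ω → Measure (Euc n)) :
    ℝ≥0∞ :=
  ⨆ (f : Euc n → ℝ) (_ : IsBLUnit f),
    (∫⁻ ω, ENNReal.ofReal (|∫ u, f u ∂(μ ω) - ∫ u, f u ∂(ν ω)| ^ 2) ∂P) ^ (1 / 2 : ℝ)

/-- The metric `d` between two non-random measures. -/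
def detDist {n : ℕ} (μ ν : Measure (Euc n)) : ℝ≥0∞ :=
  randDist (Measure.dirac ()) (fun _ : Unit => μ) (fun _ : Unit => ν)

/-- `sup |∫ f dμ - ∫ f dν|` over the measurable `f` with `|f| ≤ w`: a total variation distance with
weight `w`. -/
def supDist {n : ℕ} (w : Euc n → ℝ) (μ ν : Measure (Euc n)) : ℝ≥0∞ :=
  ⨆ (f : Euc n → ℝ) (_ : Measurable f) (_ : ∀ u, |f u| ≤ w u),
    ENNReal.ofReal |∫ u, f u ∂μ - ∫ u, f u ∂ν|

/-- The total variation distance `d_∞`, test functions `|f|_∞ ≤ 1`. -/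
def tvDist {n : ℕ} (μ ν : Measure (Euc n)) : ℝ≥0∞ := supDist (fun _ => 1) μ ν

/-- The total variation distance weighted by `1 + |u|²`. -/
def weightedTVDist {n : ℕ} (μ ν : Measure (Euc n)) : ℝ≥0∞ := supDist (fun u => 1 + ‖u‖ ^ 2) μ ν

/-! ### The signal -/

/-- `W` is a standard `n`-dimensional Brownian motion: its coordinates are independent
real Brownian motions. -/
structure IsBrownianEuc {n : ℕ} {Ω : Type*} [MeasurableSpace Ω] (W : ℝ≥0 → Ω → Euc n)
    (P : Measure Ω) : Prop where
  coord : ∀ i : Fin n, IsBrownianReal (fun t ω => W t ω i) P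
  indep : iIndepFun (fun (i : Fin n) (ω : Ω) (t : ℝ≥0) => W t ω i) P

/-- `K t x` is the law at time `t` of the solution of `du = F(u) dt + √(2b) dW`, `u(0) = x`. As the
noise is additive, a solution is a continuous process that solves the integral equation
path by path. -/
def IsLangevinKernel {n : ℕ} (F : Euc n → Euc n) (b : ℝ) (K : ℝ≥0 → Kernel (Euc n) (Euc n)) :
    Prop :=
  ∃ (Ω : Type) (_ : MeasurableSpace Ω) (P : Measure Ω) (W : ℝ≥0 → Ω → Euc n)
    (u : Euc n → ℝ≥0 → Ω → Euc n),
    IsProbabilityMeasure P ∧ IsBrownianEuc W P ∧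
    (∀ x t, Measurable (u x t)) ∧
    (∀ x, ∀ᵐ ω ∂P, Continuous (fun t => u x t ω) ∧
      ∀ t : ℝ≥0, u x t ω =
        x + (∫ s in (0 : ℝ)..t, F (u x s.toNNReal ω)) + Real.sqrt (2 * b) • W t ω) ∧
    ∀ t x, K t x = P.map (u x t)

/-- `λ = 0` for a linear drift, `λ = 1` for a nonlinear one. -/
def nonlin {n : ℕ} (F : Euc n → Euc n) : ℝ :=
  open Classical in if IsLinearMap ℝ F then 0 else 1

/-! ### Moments and the Gaussian projection -/

/-- The covariance matrix of a measure. -/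
def covMat {n : ℕ} (μ : Measure (Euc n)) : Matrix (Fin n) (Fin n) ℝ :=
  Matrix.of fun i k => covariance (fun u => u i) (fun u => u k) μ

/-- The Gaussian projection: the Gaussian with the mean and the covariance of `μ`. -/
def gaussProj {n : ℕ} (μ : Measure (Euc n)) : Measure (Euc n) :=
  multivariateGaussian (∫ u, u ∂μ) (covMat μ)

/-! ### The true filter -/

/-- The likelihood `g(u, y) = exp (-|y - H u|_Γ² / 2)`. -/
def likelihood {n m : ℕ} (H : Matrix (Fin m) (Fin n) ℝ) (Γ : Matrix (Fin m) (Fin m) ℝ)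
    (u : Euc n) (y : Euc m) : ℝ :=
  Real.exp (-(1 / 2) *
    ((y - toEuclideanLin H u).ofLp ⬝ᵥ Γ⁻¹ *ᵥ (y - toEuclideanLin H u).ofLp))

/-- The Bayes update `μ g(·, y) / ∫ g(·, y) dμ`. -/
def bayes {n m : ℕ} (H : Matrix (Fin m) (Fin n) ℝ) (Γ : Matrix (Fin m) (Fin m) ℝ)
    (y : Euc m) (μ : Measure (Euc n)) : Measure (Euc n) :=
  (∫⁻ u, ENNReal.ofReal (likelihood H Γ u y) ∂μ)⁻¹ •
    μ.withDensity (fun u => ENNReal.ofReal (likelihood H Γ u y))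

/-- The filtering distribution after `j` observations; `k` is the transition kernel over one
observation interval. -/
def trueFilter {n m : ℕ} (k : Kernel (Euc n) (Euc n)) (H : Matrix (Fin m) (Fin n) ℝ)
    (Γ : Matrix (Fin m) (Fin m) ℝ) (ρ₀ : Measure (Euc n)) (y : ℕ → Euc m) : ℕ → Measure (Euc n)
  | 0 => ρ₀
  | j + 1 => bayes H Γ (y (j + 1)) (k ∘ₘ trueFilter k H Γ ρ₀ y j)

/-! ### The mean-field ensemble Kalman filter -/

/-- The Kalman gain `C Hᵀ (H C Hᵀ + Γ)⁻¹`. -/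
def gain {n m : ℕ} (H : Matrix (Fin m) (Fin n) ℝ) (Γ : Matrix (Fin m) (Fin m) ℝ)
    (C : Matrix (Fin n) (Fin n) ℝ) : Matrix (Fin n) (Fin m) ℝ :=
  C * Hᵀ * (H * C * Hᵀ + Γ)⁻¹

/-- The analysis map `v̂ ↦ (I - A H) v̂ + A (y + η)` with gain `A`. -/
def analysis {n m : ℕ} (H : Matrix (Fin m) (Fin n) ℝ) (A : Matrix (Fin n) (Fin m) ℝ)
    (y η : Euc m) (v : Euc n) : Euc n :=
  v - toEuclideanLin A (toEuclideanLin H v) + toEuclideanLin A (y + η)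

/-- The perturbed-observation update with gain `gain C`: the law of
`(I - A H) v̂ + A (y + η)`, where `v̂ ∼ μ` and `η ∼ N(0, Γ)` are independent. -/
def linUpdate {n m : ℕ} (H : Matrix (Fin m) (Fin n) ℝ) (Γ : Matrix (Fin m) (Fin m) ℝ)
    (y : Euc m) (C : Matrix (Fin n) (Fin n) ℝ) (μ : Measure (Euc n)) : Measure (Euc n) :=
  (μ.prod (multivariateGaussian 0 Γ)).map (fun p => analysis H (gain H Γ C) y p.2 p.1)

/-- The mean-field EnKF distribution after `j` observations. -/
def mfEnKF {n m : ℕ} (k : Kernel (Euc n) (Euc n)) (H : Matrix (Fin m) (Fin n) ℝ)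
    (Γ : Matrix (Fin m) (Fin m) ℝ) (ρ₀ : Measure (Euc n)) (y : ℕ → Euc m) : ℕ → Measure (Euc n)
  | 0 => ρ₀
  | j + 1 =>
    linUpdate H Γ (y (j + 1)) (covMat (k ∘ₘ mfEnKF k H Γ ρ₀ y j)) (k ∘ₘ mfEnKF k H Γ ρ₀ y j)

/-! ### The finite ensemble -/

/-- The empirical measure of an ensemble. -/
def empirical {n N : ℕ} (v : Fin N → Euc n) : Measure (Euc n) :=
  (N : ℝ≥0∞)⁻¹ • ∑ i, Measure.dirac (v i)

/-- The joint law of the `N` members of the EnKF after `j` observations. The initial members are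
independent draws from `ρ₀`; given the ensemble, the forecasts `v̂ i ∼ k (v i)` and the perturbations
`η i ∼ N(0, Γ)` are independent; the gain is that of the sample covariance of the forecasts. -/
def enkfLaw {n m : ℕ} (k : Kernel (Euc n) (Euc n)) (H : Matrix (Fin m) (Fin n) ℝ)
    (Γ : Matrix (Fin m) (Fin m) ℝ) (ρ₀ : Measure (Euc n)) (y : ℕ → Euc m) (N : ℕ) :
    ℕ → Measure (Fin N → Euc n)
  | 0 => Measure.pi fun _ => ρ₀
  | j + 1 =>
    ((enkfLaw k H Γ ρ₀ y N j).bind fun v =>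
      (Measure.pi fun i => k (v i)).prod (Measure.pi fun _ : Fin N => multivariateGaussian 0 Γ)).map
      fun p i => analysis H (gain H Γ (covMat (empirical p.1))) (y (j + 1)) (p.2 i) (p.1 i)

/-! ### The deterministic mean-field EnKF -/

/-- `p 0, p 1, …` is a run of the deterministic mean-field EnKF, with Fokker-Planck solver error `e₁`
and quadrature error `e₂`: `phat (j + 1)` is the numerical forecast started from `p j`,
`Chat (j + 1)` is the numerical covariance of this forecast, and `p (j + 1)` is the numerical
perturbed-observation update, with the gain computed from `Chat (j + 1)`. -/
structure IsDMFEnKF {n m : ℕ} (k : Kernel (Euc n) (Euc n)) (H : Matrix (Fin m) (Fin n) ℝ)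
    (Γ : Matrix (Fin m) (Fin m) ℝ) (ρ₀ : Measure (Euc n)) (y : ℕ → Euc m) (e₁ e₂ : ℝ)
    (p phat : ℕ → Measure (Euc n)) (Chat : ℕ → Matrix (Fin n) (Fin n) ℝ) : Prop where
  prob : ∀ j, IsProbabilityMeasure (p j)
  prob_hat : ∀ j, IsProbabilityMeasure (phat j)
  moment : ∀ j, Integrable (fun u => ‖u‖ ^ 2) (p j)
  moment_hat : ∀ j, Integrable (fun u => ‖u‖ ^ 2) (phat j)
  init : weightedTVDist (p 0) ρ₀ ≤ ENNReal.ofReal e₁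
  forecast : ∀ j, weightedTVDist (phat (j + 1)) (k ∘ₘ p j) ≤ ENNReal.ofReal e₁
  cov : ∀ j i l, |Chat (j + 1) i l - covMat (phat (j + 1)) i l| ≤ e₂
  update : ∀ j, weightedTVDist (p (j + 1)) (linUpdate H Γ (y (j + 1)) (Chat (j + 1)) (phat (j + 1)))
    ≤ ENNReal.ofReal e₂

end MeanFieldEnKF

end

/-! The mean-field EnKF stands between the finite schemes and the true filter: both finite schemes
are compared with it, it is compared with the filter, and the triangle inequality combines the
bounds.

Finite schemes. Errors are measured on `PolyLip`, the functions of polynomial growth that are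
Lipschitz with a polynomial weight. This class is mapped to itself by the Langevin kernel and by the
analysis map averaged over the noise, and it contains the coordinates and their products. An error
on the class therefore controls the covariance, hence the gain (`gain_bounds`), and passes through
one forecast and one update with a constant factor. Induction over the observations gives
`exists_run_close` for the deterministic scheme. In the ensemble the common random gain couples the
members, so mean squares are truncated at one, which makes any bound on ensemble moments
unnecessary. Given the ensemble the forecasts are independent, and Chebyshev's inequality gives `1 /
N` (`forecast_close`). Replacing the sample gain by the mean-field gain costs as much as the
deviations of the sample moments; where these are not small, the truncated error is at most a
constant times them (`truncSq_update_le`). This gives `exists_ensemble_close`. Bounded test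
functions do not feel the truncation.

Mean-field EnKF and true filter. For a Gaussian forecast the residual is independent of the
innovation, so the Kalman update is the Bayes update (`bayes_eq_linUpdate`). A linear drift
preserves Gaussian laws, hence for `λ = 0` the two filters coincide (`trueFilter_eq_mfEnKF`). For a
nonlinear drift both are within `O(h)` of one reference, `staticFilter`, which has no dynamics,
starts from the Gaussian projection, and is Gaussian throughout. On the Bayes side this is stability
in total variation (`exists_trueFilter_close`). On the EnKF side total variation does not control
the covariance, which is followed separately (`exists_mfEnKF_close`): one forecast changes it by
`O(h)`, by the short-time estimate in `IsLangevinKernel.exists_regular`, and the analysis covariance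
depends on the forecast covariance alone. -/

noncomputable section

namespace MeanFieldEnKF

/-! ### Kalman gain: boundedness and stability. -/

section Gain

open scoped Matrix.Norms.L2Operator

lemma norm_toEuclideanLin_le {m n : ℕ} (A : Matrix (Fin m) (Fin n) ℝ) (x : Euc n) :
    ‖toEuclideanLin A x‖ ≤ ‖A‖ * ‖x‖ := A.l2_opNorm_mulVec x

lemma opNorm_le_of_forall {m n : ℕ} (A : Matrix (Fin m) (Fin n) ℝ) {c : ℝ} (hc : 0 ≤ c)
    (h : ∀ x : Euc n, ‖toEuclideanLin A x‖ ≤ c * ‖x‖) : ‖A‖ ≤ c :=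
  ContinuousLinearMap.opNorm_le_bound _ hc h

/-- Gain estimates use the operator norm, while covariance errors come entry by entry; expansion in
matrix units links the two. The summand `1` keeps `κ` positive, as it is divided by later. -/
lemma exists_norm_le_of_entries (m n : ℕ) :
    ∃ κ : ℝ, 0 < κ ∧ ∀ (A : Matrix (Fin m) (Fin n) ℝ) (δ : ℝ), 0 ≤ δ → (∀ i k, |A i k| ≤ δ) →
      ‖A‖ ≤ κ * δ := by
  refine ⟨(∑ i : Fin m, ∑ k : Fin n, ‖Matrix.single i k (1 : ℝ)‖) + 1, by positivity,
    fun A δ hδ h => ?_⟩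
  have hA : A = ∑ i, ∑ k, A i k • Matrix.single i k (1 : ℝ) := by
    conv_lhs => rw [Matrix.matrix_eq_sum_single A]
    simp
  calc ‖A‖ = ‖∑ i, ∑ k, A i k • Matrix.single i k (1 : ℝ)‖ := by rw [← hA]
    _ ≤ ∑ i, ∑ k, ‖A i k • Matrix.single i k (1 : ℝ)‖ :=
      (norm_sum_le _ _).trans (Finset.sum_le_sum fun i _ => norm_sum_le _ _)
    _ ≤ ∑ i, ∑ k, δ * ‖Matrix.single i k (1 : ℝ)‖ := by
      refine Finset.sum_le_sum fun i _ => Finset.sum_le_sum fun k _ => ?_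
      rw [norm_smul, Real.norm_eq_abs]
      exact mul_le_mul_of_nonneg_right (h i k) (norm_nonneg _)
    _ ≤ _ := by simp_rw [← Finset.mul_sum]; nlinarith

/-- Cauchy–Schwarz turns coercivity into `γ ‖x‖ ≤ ‖X x‖`, which gives injectivity and the bound on
the inverse. No symmetry is involved, so a numerical covariance may enter `X`. -/
lemma inv_of_coercive {m : ℕ} (X : Matrix (Fin m) (Fin m) ℝ) {γ : ℝ} (hγ : 0 < γ)
    (h : ∀ x : Euc m, γ * ‖x‖ ^ 2 ≤ inner ℝ x (toEuclideanLin X x)) :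
    IsUnit X.det ∧ ‖X⁻¹‖ ≤ 1 / γ := by
  have h1 : ∀ x : Euc m, γ * ‖x‖ ≤ ‖toEuclideanLin X x‖ := by
    intro x
    rcases eq_or_ne x 0 with rfl | hx
    · simp
    have hx' : 0 < ‖x‖ := norm_pos_iff.2 hx
    have := (h x).trans (real_inner_le_norm _ _)
    nlinarith
  have hinj : Function.Injective X.mulVec := by
    rw [← Matrix.coe_mulVecLin, ← LinearMap.ker_eq_bot, LinearMap.ker_eq_bot']
    intro v hv
    have := h1 (WithLp.toLp 2 v)
    have h0 : toEuclideanLin X (WithLp.toLp 2 v) = 0 := by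
      rw [Matrix.toLpLin_apply]
      simpa using hv
    rw [h0, norm_zero] at this
    have h3 : ‖(WithLp.toLp 2 v : Euc m)‖ = 0 := by
      nlinarith [norm_nonneg (WithLp.toLp 2 v : Euc m)]
    simpa using h3
  have hu : IsUnit X := Matrix.mulVec_injective_iff_isUnit.1 hinj
  have hd : IsUnit X.det := (Matrix.isUnit_iff_isUnit_det X).1 hu
  refine ⟨hd, opNorm_le_of_forall _ (by positivity) fun x => ?_⟩
  have h2 := h1 (toEuclideanLin X⁻¹ x)
  have h3 : toEuclideanLin X (toEuclideanLin X⁻¹ x) = x := by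
    simp [Matrix.toLpLin_apply, Matrix.mulVec_mulVec, Matrix.mul_nonsing_inv _ hd]
  rw [h3] at h2
  rw [one_div, ← div_eq_inv_mul, le_div_iff₀ hγ]
  linarith

lemma inner_toEuclideanLin_self {m : ℕ} (X : Matrix (Fin m) (Fin m) ℝ) (x : Euc m) :
    inner ℝ x (toEuclideanLin X x) = x.ofLp ⬝ᵥ X *ᵥ x.ofLp := by
  simp [Matrix.toLpLin_apply, EuclideanSpace.inner_eq_star_dotProduct, dotProduct_comm]

/-- The constant is the minimum of the quadratic form on the unit sphere; the sphere is empty only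
if every vector is zero. -/
lemma posDef_coercive {m : ℕ} {Γ : Matrix (Fin m) (Fin m) ℝ} (hΓ : Γ.PosDef) :
    ∃ γ : ℝ, 0 < γ ∧ ∀ x : Euc m, γ * ‖x‖ ^ 2 ≤ inner ℝ x (toEuclideanLin Γ x) := by
  have hcont : Continuous fun x : Euc m => (inner ℝ x (toEuclideanLin Γ x) : ℝ) := by
    have : Continuous (toEuclideanLin Γ : Euc m →ₗ[ℝ] Euc m) :=
      LinearMap.continuous_of_finiteDimensional _
    fun_prop
  have hpos : ∀ x : Euc m, x ≠ 0 → (0 : ℝ) < inner ℝ x (toEuclideanLin Γ x) := by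
    intro x hx
    rw [inner_toEuclideanLin_self]
    have := hΓ.dotProduct_mulVec_pos (x := x.ofLp) (by simpa using hx)
    simpa using this
  rcases Set.eq_empty_or_nonempty (Metric.sphere (0 : Euc m) 1) with he | hne
  · refine ⟨1, one_pos, fun x => ?_⟩
    have hx : x = 0 := by
      by_contra hx
      have : (‖x‖⁻¹ • x) ∈ Metric.sphere (0 : Euc m) 1 := by
        simp [norm_smul, norm_ne_zero_iff.2 hx]
      rw [he] at this
      exact this
    simp [hx]
  · obtain ⟨x₀, hx₀, hmin⟩ := (isCompact_sphere (0 : Euc m) 1).exists_isMinOn hne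
      hcont.continuousOn
    have hx₀' : x₀ ≠ 0 := by
      rintro rfl
      simp at hx₀
    refine ⟨_, hpos x₀ hx₀', fun x => ?_⟩
    rcases eq_or_ne x 0 with rfl | hx
    · simp
    have hmem : (‖x‖⁻¹ • x) ∈ Metric.sphere (0 : Euc m) 1 := by
      simp [norm_smul, norm_ne_zero_iff.2 hx]
    have := hmin hmem
    simp only [Set.mem_ofPred_eq, map_smul, inner_smul_left, inner_smul_right] at this
    have hn : 0 < ‖x‖ := norm_pos_iff.2 hx
    have h2 : inner ℝ x (toEuclideanLin Γ x) =
        ‖x‖ ^ 2 * ((starRingEnd ℝ) ‖x‖⁻¹ * (‖x‖⁻¹ * inner ℝ x (toEuclideanLin Γ x))) := by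
      simp; field_simp
    rw [h2]
    nlinarith [sq_nonneg ‖x‖]

/-- `C'` stands for a numerical or sample covariance and need not be symmetric or semidefinite.
Since `C` is semidefinite, `H C Hᵀ + Γ` inherits the coercivity of `Γ`; half of it survives a small
perturbation, and the resolvent identity gives the Lipschitz bound. -/
lemma gain_bounds {n m : ℕ} (H : Matrix (Fin m) (Fin n) ℝ) {Γ : Matrix (Fin m) (Fin m) ℝ}
    (hΓ : Γ.PosDef) (M : ℝ) :
    ∃ a ε : ℝ, 1 ≤ a ∧ 0 < ε ∧ ∀ C C' : Matrix (Fin n) (Fin n) ℝ, C.PosSemidef → ‖C‖ ≤ M →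
      ‖C' - C‖ ≤ ε → ‖gain H Γ C'‖ ≤ a ∧ ‖gain H Γ C' - gain H Γ C‖ ≤ a * ‖C' - C‖ := by
  obtain ⟨γ, hγ, hco⟩ := posDef_coercive hΓ
  have hM : M ≤ |M| := le_abs_self M
  set h := ‖H‖ with hh
  have hh0 : 0 ≤ h := norm_nonneg _
  have hHt : ‖Hᵀ‖ = h := by
    have := l2_opNorm_conjTranspose H
    simpa [conjTranspose_eq_transpose_of_trivial] using this
  -- The summands of `a` ensure `1 ≤ a`, bound the gain of `C'`, and bound its Lipschitz constant.
  -- The radius is such that `‖C'‖ ≤ |M| + 1` and `h² ε ≤ γ / 2`.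
  refine ⟨1 + (|M| + 1) * h * (2 / γ) + (h * (2 / γ) + |M| * h * ((2 / γ) * (h * h) * (1 / γ))),
    min 1 (γ / 2 / (h * h + 1)), ?_, by positivity, ?_⟩
  · have : 0 ≤ (|M| + 1) * h * (2 / γ) + (h * (2 / γ) + |M| * h * ((2 / γ) * (h * h) * (1 / γ))) := by
      positivity
    linarith
  intro C C' hC hCM hCC
  set X := H * C * Hᵀ + Γ with hX
  set X' := H * C' * Hᵀ + Γ with hX'
  have hXX : X' - X = H * (C' - C) * Hᵀ := by rw [hX, hX', Matrix.mul_sub, Matrix.sub_mul]; abel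
  have hXn : ‖X' - X‖ ≤ h * h * ‖C' - C‖ := by
    rw [hXX]
    calc _ ≤ ‖H * (C' - C)‖ * ‖Hᵀ‖ := l2_opNorm_mul _ _
      _ ≤ (‖H‖ * ‖C' - C‖) * ‖Hᵀ‖ := by gcongr; exact l2_opNorm_mul _ _
      _ = _ := by rw [hHt]; ring
  have hε1 : ‖C' - C‖ ≤ 1 := hCC.trans (min_le_left _ _)
  have hε2 : ‖X' - X‖ ≤ γ / 2 := by
    have h1 := hCC.trans (min_le_right _ _)
    rw [le_div_iff₀ (by positivity)] at h1
    nlinarith [norm_nonneg (C' - C)]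
  have hXco : ∀ x : Euc m, γ * ‖x‖ ^ 2 ≤ inner ℝ x (toEuclideanLin X x) := by
    intro x
    refine (hco x).trans ?_
    rw [inner_toEuclideanLin_self, inner_toEuclideanLin_self, hX, add_mulVec, dotProduct_add]
    have : 0 ≤ x.ofLp ⬝ᵥ (H * C * Hᵀ) *ᵥ x.ofLp := by
      have h2 := hC.mul_mul_conjTranspose_same H
      have h3 := h2.dotProduct_mulVec_nonneg x.ofLp
      simpa using h3
    linarith
  have hX'co : ∀ x : Euc m, γ / 2 * ‖x‖ ^ 2 ≤ inner ℝ x (toEuclideanLin X' x) := by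
    intro x
    have h1 : toEuclideanLin X' x = toEuclideanLin X x + toEuclideanLin (X' - X) x := by
      rw [← LinearMap.add_apply, ← map_add, add_sub_cancel]
    rw [h1, inner_add_right]
    have h2 : |inner ℝ x (toEuclideanLin (X' - X) x)| ≤ γ / 2 * ‖x‖ ^ 2 := by
      refine (abs_real_inner_le_norm _ _).trans ?_
      have := norm_toEuclideanLin_le (X' - X) x
      nlinarith [norm_nonneg x, mul_le_mul_of_nonneg_right hε2 (norm_nonneg x)]
    have := abs_le.1 h2
    linarith [hXco x]
  obtain ⟨hXu, hXi⟩ := inv_of_coercive X hγ hXco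
  obtain ⟨hX'u, hX'i⟩ := inv_of_coercive X' (half_pos hγ) hX'co
  have hX'i' : ‖X'⁻¹‖ ≤ 2 / γ := by convert hX'i using 1; field_simp
  have hC' : ‖C'‖ ≤ |M| + 1 := by
    have := norm_add_le (C' - C) C
    rw [sub_add_cancel] at this
    linarith
  have hg' : ‖gain H Γ C'‖ ≤ (|M| + 1) * h * (2 / γ) := by
    calc ‖gain H Γ C'‖ ≤ ‖C' * Hᵀ‖ * ‖X'⁻¹‖ := l2_opNorm_mul _ _
      _ ≤ (‖C'‖ * ‖Hᵀ‖) * ‖X'⁻¹‖ := by gcongr; exact l2_opNorm_mul _ _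
      _ ≤ _ := by rw [hHt]; gcongr
  have hdiff : gain H Γ C' - gain H Γ C
      = (C' - C) * Hᵀ * X'⁻¹ - C * Hᵀ * (X'⁻¹ * (X' - X) * X⁻¹) := by
    have h1 : X'⁻¹ * (X' - X) * X⁻¹ = X⁻¹ - X'⁻¹ := by
      rw [mul_sub, sub_mul, nonsing_inv_mul _ hX'u, one_mul, Matrix.mul_assoc,
        mul_nonsing_inv _ hXu, mul_one]
    rw [h1]
    simp only [gain, ← hX, ← hX', Matrix.sub_mul, Matrix.mul_sub]
    abel
  have hd : ‖gain H Γ C' - gain H Γ C‖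
      ≤ (h * (2 / γ) + |M| * h * ((2 / γ) * (h * h) * (1 / γ))) * ‖C' - C‖ := by
    rw [hdiff]
    refine (norm_sub_le _ _).trans ?_
    have e1 : ‖(C' - C) * Hᵀ * X'⁻¹‖ ≤ (‖C' - C‖ * h) * (2 / γ) := by
      calc _ ≤ ‖(C' - C) * Hᵀ‖ * ‖X'⁻¹‖ := l2_opNorm_mul _ _
        _ ≤ (‖C' - C‖ * ‖Hᵀ‖) * ‖X'⁻¹‖ := by gcongr; exact l2_opNorm_mul _ _
        _ ≤ _ := by rw [hHt]; gcongr
    have e2 : ‖X'⁻¹ * (X' - X) * X⁻¹‖ ≤ (2 / γ) * (h * h * ‖C' - C‖) * (1 / γ) := by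
      calc _ ≤ ‖X'⁻¹ * (X' - X)‖ * ‖X⁻¹‖ := l2_opNorm_mul _ _
        _ ≤ (‖X'⁻¹‖ * ‖X' - X‖) * ‖X⁻¹‖ := by gcongr; exact l2_opNorm_mul _ _
        _ ≤ _ := by gcongr
    have e3 : ‖C * Hᵀ * (X'⁻¹ * (X' - X) * X⁻¹)‖
        ≤ (|M| * h) * ((2 / γ) * (h * h * ‖C' - C‖) * (1 / γ)) := by
      calc _ ≤ ‖C * Hᵀ‖ * ‖X'⁻¹ * (X' - X) * X⁻¹‖ := l2_opNorm_mul _ _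
        _ ≤ (‖C‖ * ‖Hᵀ‖) * ‖X'⁻¹ * (X' - X) * X⁻¹‖ := by gcongr; exact l2_opNorm_mul _ _
        _ ≤ _ := by rw [hHt]; gcongr; exact hCM.trans hM
    linarith
  have p1 : 0 ≤ (|M| + 1) * h * (2 / γ) := by positivity
  have p2 : 0 ≤ h * (2 / γ) + |M| * h * ((2 / γ) * (h * h) * (1 / γ)) := by positivity
  refine ⟨by linarith, hd.trans ?_⟩
  exact mul_le_mul_of_nonneg_right (by linarith) (norm_nonneg _)

end Gain

/-! ### Test functions of polynomial growth. -/

/-- Locally Lipschitz functions with polynomial growth. -/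
def PolyLip {n : ℕ} (q : ℕ) (c : ℝ) (f : Euc n → ℝ) : Prop :=
  (∀ u, |f u| ≤ c * (1 + ‖u‖) ^ (q + 1)) ∧
    ∀ u v, |f u - f v| ≤ c * (1 + ‖u‖ + ‖v‖) ^ q * ‖u - v‖

/-- `∫ (1 + |u|)ᵖ dμ ≤ M`, with integrability. -/
def MomentLE {n : ℕ} (p : ℕ) (M : ℝ) (μ : Measure (Euc n)) : Prop :=
  Integrable (fun u => (1 + ‖u‖) ^ p) μ ∧ ∫ u, (1 + ‖u‖) ^ p ∂μ ≤ M

/-- Functions of the forecast and of the observation noise, `PolyLip` in the forecast with a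
constant that grows polynomially in the noise. -/
def PolyLipNoise {n m : ℕ} (q : ℕ) (c : ℝ) (φ : Euc n → Euc m → ℝ) : Prop :=
  Measurable (Function.uncurry φ) ∧ ∀ η, PolyLip q (c * (1 + ‖η‖) ^ (q + 1)) (fun v => φ v η)

/-- A Markov kernel that preserves moments and the classes `PolyLip`, with constants `B`. -/
structure RegularKernel {n : ℕ} (k : Kernel (Euc n) (Euc n)) (B : ℕ → ℝ) : Prop where
  markov : IsMarkovKernel k
  moment : ∀ q x, MomentLE q (B q * (1 + ‖x‖) ^ q) (k x)
  lip : ∀ q c f, PolyLip q c f → ∀ x x',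
    |∫ v, f v ∂(k x) - ∫ v, f v ∂(k x')| ≤ c * B q * (1 + ‖x‖ + ‖x'‖) ^ q * ‖x - x'‖

section PolyLipBasic

variable {n m : ℕ} {q : ℕ} {c : ℝ} {f : Euc n → ℝ}

lemma PolyLip.nonneg (h : PolyLip q c f) : 0 ≤ c := by
  have := h.1 0
  simp only [norm_zero, add_zero, one_pow, mul_one] at this
  exact (abs_nonneg _).trans this

lemma PolyLip.continuous (h : PolyLip q c f) : Continuous f := by
  refine continuous_iff_continuousAt.2 fun x => ?_
  rw [ContinuousAt, tendsto_iff_dist_tendsto_zero]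
  have h1 : Filter.Tendsto (fun u => c * (1 + ‖u‖ + ‖x‖) ^ q * ‖u - x‖) (nhds x) (nhds 0) := by
    have : Continuous fun u => c * (1 + ‖u‖ + ‖x‖) ^ q * ‖u - x‖ := by fun_prop
    simpa using this.tendsto x
  exact squeeze_zero (fun _ => dist_nonneg) (fun u => by rw [Real.dist_eq]; exact h.2 u x) h1

lemma PolyLip.mono (h : PolyLip q c f) {q' : ℕ} (hq : q ≤ q') : PolyLip q' c f := by
  have hc := h.nonneg
  refine ⟨fun u => (h.1 u).trans ?_, fun u v => (h.2 u v).trans ?_⟩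
  · gcongr
    linarith [norm_nonneg u]
  · gcongr
    linarith [norm_nonneg u, norm_nonneg v]

lemma PolyLip.mono_const (h : PolyLip q c f) {c' : ℝ} (hc : c ≤ c') : PolyLip q c' f := by
  refine ⟨fun u => (h.1 u).trans ?_, fun u v => (h.2 u v).trans ?_⟩ <;> gcongr

lemma PolyLip.const_mul (h : PolyLip q c f) (a : ℝ) : PolyLip q (|a| * c) (fun u => a * f u) := by
  refine ⟨fun u => ?_, fun u v => ?_⟩
  · rw [abs_mul, mul_assoc]
    gcongr
    exact h.1 u
  · rw [← mul_sub, abs_mul, mul_assoc, mul_assoc, ← mul_assoc c]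
    gcongr
    exact h.2 u v

/-- Test-function bounds for `PolyLip q 1` scale to `PolyLip q c`. -/
lemma PolyLip.normalize (h : PolyLip q c f) :
    PolyLip q 1 (fun u => (c + 1)⁻¹ * f u) := by
  have hc := h.nonneg
  refine (h.const_mul (c + 1)⁻¹).mono_const ?_
  rw [abs_of_nonneg (by positivity), inv_mul_le_iff₀ (by positivity)]
  linarith

lemma one_le_one_add_norm {E : Type*} [NormedAddCommGroup E] (u : E) : 1 ≤ 1 + ‖u‖ := by
  linarith [norm_nonneg u]

lemma abs_coord_le (u : Euc n) (i : Fin n) : |u i| ≤ ‖u‖ := by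
  simpa using PiLp.norm_apply_le u i

lemma polyLip_coord (i : Fin n) : PolyLip 0 1 (fun u : Euc n => u i) := by
  refine ⟨fun u => ?_, fun u v => ?_⟩
  · have := abs_coord_le u i
    simp only [zero_add, pow_one, one_mul]
    linarith
  · simpa using abs_coord_le (u - v) i

lemma polyLip_coord_mul (i k : Fin n) : PolyLip 1 1 (fun u : Euc n => u i * u k) := by
  refine ⟨fun u => ?_, fun u v => ?_⟩
  · rw [abs_mul]
    have h1 := abs_coord_le u i
    have h2 := abs_coord_le u k
    have h3 := mul_le_mul h1 h2 (abs_nonneg _) (norm_nonneg u)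
    have h4 := norm_nonneg u
    calc |u i| * |u k| ≤ ‖u‖ * ‖u‖ := h3
      _ ≤ _ := by ring_nf; nlinarith
  · have h1 := abs_coord_le u i
    have h2 := abs_coord_le v k
    have h3 := abs_coord_le (u - v) i
    have h4 := abs_coord_le (u - v) k
    simp only [PiLp.sub_apply] at h3 h4
    have e : u i * u k - v i * v k = u i * (u k - v k) + (u i - v i) * v k := by ring
    rw [e]
    refine (abs_add_le _ _).trans ?_
    rw [abs_mul, abs_mul]
    have a1 := mul_le_mul h1 h4 (abs_nonneg _) (norm_nonneg u)
    have a2 := mul_le_mul h3 h2 (abs_nonneg _) (norm_nonneg _)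
    nlinarith [norm_nonneg (u - v)]

/-- For `a = 1 + ‖u‖` and `b = 1 + ‖v‖` the base `a + b - 1` is `1 + ‖u‖ + ‖v‖`, the weight in
`PolyLip`. -/
lemma abs_pow_sub_pow_le {a b : ℝ} (ha : 1 ≤ a) (hb : 1 ≤ b) (p : ℕ) :
    |a ^ (p + 1) - b ^ (p + 1)| ≤ (p + 1) * (a + b - 1) ^ p * |a - b| := by
  induction p with
  | zero => simp
  | succ p ih =>
    have e : a ^ (p + 1 + 1) - b ^ (p + 1 + 1)
        = a * (a ^ (p + 1) - b ^ (p + 1)) + (a - b) * b ^ (p + 1) := by ring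
    rw [e]
    refine (abs_add_le _ _).trans ?_
    rw [abs_mul, abs_mul, abs_of_nonneg (by linarith : 0 ≤ a),
      abs_of_nonneg (by positivity : 0 ≤ b ^ (p + 1))]
    have h1 : a * |a ^ (p + 1) - b ^ (p + 1)|
        ≤ (a + b - 1) * ((p + 1) * (a + b - 1) ^ p * |a - b|) := by
      have : 0 ≤ a + b - 1 := by linarith
      gcongr
      linarith
    have h2 : |a - b| * b ^ (p + 1) ≤ |a - b| * (a + b - 1) ^ (p + 1) := by
      gcongr
      linarith
    push_cast
    calc _ ≤ _ := add_le_add h1 h2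
      _ = _ := by ring

lemma polyLip_pow (p : ℕ) : PolyLip p (p + 1) (fun u : Euc n => (1 + ‖u‖) ^ (p + 1)) := by
  refine ⟨fun u => ?_, fun u v => ?_⟩
  · have h1 := one_le_one_add_norm u
    rw [abs_of_nonneg (by positivity)]
    have : 0 ≤ (1 + ‖u‖) ^ (p + 1) := by positivity
    nlinarith [(Nat.cast_nonneg p : (0 : ℝ) ≤ p)]
  · refine (abs_pow_sub_pow_le (one_le_one_add_norm u) (one_le_one_add_norm v) p).trans ?_
    have e : 1 + ‖u‖ + (1 + ‖v‖) - 1 = 1 + ‖u‖ + ‖v‖ := by ring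
    rw [e, add_sub_add_left_eq_sub]
    gcongr
    exact abs_norm_sub_norm_le u v

lemma PolyLipNoise.mono {φ : Euc n → Euc m → ℝ} (h : PolyLipNoise q c φ) :
    0 ≤ c := by
  have := (h.2 0).nonneg
  simpa using this

lemma PolyLipNoise.abs_le {φ : Euc n → Euc m → ℝ} (h : PolyLipNoise q c φ) (v : Euc n) (η : Euc m) :
    |φ v η| ≤ c * ((1 + ‖v‖) * (1 + ‖η‖)) ^ (q + 1) := by
  refine ((h.2 η).1 v).trans (le_of_eq ?_)
  rw [mul_pow]; ring

/-- This weight measures the effect of a gain error on one member, so its ensemble average has to be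
controlled as well. -/
lemma polyLipNoise_pow (p : ℕ) :
    PolyLipNoise p (p + 1) (fun (v : Euc n) (η : Euc m) => ((1 + ‖v‖) * (1 + ‖η‖)) ^ (p + 1)) := by
  refine ⟨Continuous.measurable (by simp only [Function.uncurry_def]; fun_prop), fun η => ?_⟩
  have h := (polyLip_pow (n := n) p).const_mul ((1 + ‖η‖) ^ (p + 1))
  rw [abs_of_nonneg (by positivity), mul_comm] at h
  convert h using 2
  simp only [mul_pow, mul_comm]

lemma PolyLip.noise (h : PolyLip q c f) : PolyLipNoise q c (fun (v : Euc n) (_ : Euc m) => f v) := by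
  refine ⟨h.continuous.measurable.comp measurable_fst, fun η => h.mono_const ?_⟩
  have := one_le_pow₀ (one_le_one_add_norm η) (n := q + 1)
  nlinarith [h.nonneg]

lemma PolyLip.sq (h : PolyLip q c f) : ∀ u, f u ^ 2 ≤ c ^ 2 * (1 + ‖u‖) ^ (2 * q + 2) := by
  intro u
  rw [← sq_abs]
  calc |f u| ^ 2 ≤ (c * (1 + ‖u‖) ^ (q + 1)) ^ 2 := by
        gcongr
        exact h.1 u
    _ = _ := by ring

end PolyLipBasic

/-! ### Moments, and stability of the test class under kernels and noise averages. -/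

section Moments

variable {n m : ℕ} {μ : Measure (Euc n)} {q p : ℕ} {c M : ℝ} {f : Euc n → ℝ}

lemma MomentLE.nonneg (h : MomentLE p M μ) : 0 ≤ M :=
  (integral_nonneg fun u => by positivity).trans h.2

lemma MomentLE.one_le [IsProbabilityMeasure μ] (h : MomentLE p M μ) : 1 ≤ M := by
  refine le_trans ?_ h.2
  calc (1 : ℝ) = ∫ _, (1 : ℝ) ∂μ := by simp
    _ ≤ _ := integral_mono (integrable_const _) h.1 fun u => one_le_pow₀ (one_le_one_add_norm u)

lemma MomentLE.integrable (h : MomentLE p M μ) (hf : AEStronglyMeasurable f μ)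
    (hb : ∀ u, |f u| ≤ c * (1 + ‖u‖) ^ p) : Integrable f μ :=
  (h.1.const_mul c).mono' hf (Filter.Eventually.of_forall hb)

lemma MomentLE.abs_integral_le (h : MomentLE p M μ) (hc : 0 ≤ c)
    (hb : ∀ u, |f u| ≤ c * (1 + ‖u‖) ^ p) : |∫ u, f u ∂μ| ≤ c * M := by
  refine (abs_integral_le_integral_abs).trans ?_
  calc ∫ u, |f u| ∂μ ≤ ∫ u, c * (1 + ‖u‖) ^ p ∂μ :=
        integral_mono_of_nonneg (Filter.Eventually.of_forall fun _ => abs_nonneg _)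
          (h.1.const_mul c) (Filter.Eventually.of_forall hb)
    _ = c * ∫ u, (1 + ‖u‖) ^ p ∂μ := integral_const_mul _ _
    _ ≤ c * M := by gcongr; exact h.2

lemma MomentLE.mono_const (h : MomentLE p M μ) {M' : ℝ} (hM : M ≤ M') : MomentLE p M' μ :=
  ⟨h.1, h.2.trans hM⟩

lemma PolyLip.integrable (hf : PolyLip q c f) (h : MomentLE (q + 1) M μ) : Integrable f μ :=
  h.integrable hf.continuous.aestronglyMeasurable hf.1

lemma PolyLip.abs_integral_le (hf : PolyLip q c f) (h : MomentLE (q + 1) M μ) :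
    |∫ u, f u ∂μ| ≤ c * M := h.abs_integral_le hf.nonneg hf.1

lemma RegularKernel.one_le {k : Kernel (Euc n) (Euc n)} {B : ℕ → ℝ} (hk : RegularKernel k B)
    (q : ℕ) : 1 ≤ B q := by
  have := hk.markov
  simpa using (hk.moment q 0).one_le

/-- The forecast acts on test functions without raising the order `q`, which is what makes the
induction over observations possible. The growth bound costs `B (q + 1)`, the Lipschitz bound `B q`.
-/
lemma RegularKernel.polyLip {k : Kernel (Euc n) (Euc n)} {B : ℕ → ℝ} (hk : RegularKernel k B)
    (hf : PolyLip q c f) : PolyLip q (c * (B q + B (q + 1))) (fun x => ∫ v, f v ∂(k x)) := by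
  have hc := hf.nonneg
  have h1 := hk.one_le q
  have h2 := hk.one_le (q + 1)
  refine ⟨fun x => (hf.abs_integral_le (hk.moment (q + 1) x)).trans ?_,
    fun x x' => (hk.lip q c f hf x x').trans ?_⟩
  · rw [mul_assoc]
    gcongr
    linarith
  · gcongr
    linarith

lemma integral_kernel_comp [SFinite μ] {k : Kernel (Euc n) (Euc n)} [IsSFiniteKernel k]
    (hf : Integrable f (k ∘ₘ μ)) : ∫ v, f v ∂(k ∘ₘ μ) = ∫ x, ∫ v, f v ∂(k x) ∂μ := by
  rw [Measure.comp_eq_comp_const_apply] at hf ⊢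
  simpa using Kernel.integral_comp hf

lemma RegularKernel.comp_moment [IsProbabilityMeasure μ] {k : Kernel (Euc n) (Euc n)} {B : ℕ → ℝ}
    (hk : RegularKernel k B) (h : MomentLE p M μ) : MomentLE p (B p * M) (k ∘ₘ μ) := by
  have := hk.markov
  have hB := hk.one_le p
  have hmeas : Continuous fun u : Euc n => (1 + ‖u‖) ^ p := by fun_prop
  have hint : Integrable (fun u : Euc n => (1 + ‖u‖) ^ p) (k ∘ₘ μ) := by
    rw [Measure.integrable_comp_iff hmeas.aestronglyMeasurable]
    refine ⟨Filter.Eventually.of_forall fun x => (hk.moment p x).1, ?_⟩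
    refine (h.1.const_mul (B p)).mono' ?_ (Filter.Eventually.of_forall fun x => ?_)
    · exact (hmeas.norm.stronglyMeasurable.integral_kernel (κ := k)).aestronglyMeasurable
    · rw [Real.norm_of_nonneg (integral_nonneg fun _ => norm_nonneg _)]
      refine le_trans (le_of_eq ?_) (hk.moment p x).2
      refine integral_congr_ae (Filter.Eventually.of_forall fun u => ?_)
      exact Real.norm_of_nonneg (by positivity)
  refine ⟨hint, ?_⟩
  rw [integral_kernel_comp hint]
  calc ∫ x, ∫ v, (1 + ‖v‖) ^ p ∂(k x) ∂μ ≤ ∫ x, B p * (1 + ‖x‖) ^ p ∂μ :=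
        integral_mono_of_nonneg (Filter.Eventually.of_forall fun x =>
            integral_nonneg fun v => by positivity) (h.1.const_mul _)
          (Filter.Eventually.of_forall fun x => (hk.moment p x).2)
    _ = B p * ∫ x, (1 + ‖x‖) ^ p ∂μ := integral_const_mul _ _
    _ ≤ _ := by gcongr; exact h.2

lemma RegularKernel.integral_comp [IsProbabilityMeasure μ] {k : Kernel (Euc n) (Euc n)} {B : ℕ → ℝ}
    (hk : RegularKernel k B) (h : MomentLE (q + 1) M μ) (hf : PolyLip q c f) :
    ∫ v, f v ∂(k ∘ₘ μ) = ∫ x, ∫ v, f v ∂(k x) ∂μ := by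
  have := hk.markov
  exact integral_kernel_comp (hf.integrable (hk.comp_moment h))

/-- With this kernel the moment bounds of the mean-field EnKF cover the filter without dynamics. -/
lemma regularKernel_id : RegularKernel (Kernel.id : Kernel (Euc n) (Euc n)) (fun _ => 1) where
  markov := inferInstance
  moment q x := by
    have hc : Continuous fun u : Euc n => (1 + ‖u‖) ^ q := by fun_prop
    refine ⟨?_, ?_⟩
    · rw [Kernel.id_apply]
      exact integrable_dirac (by simp)
    · rw [Kernel.id_apply, integral_dirac]
      simp
  lip q c f hf x x' := by
    rw [Kernel.id_apply, Kernel.id_apply, integral_dirac, integral_dirac, mul_one]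
    exact hf.2 x x'

/-- The noise has moments of all orders. -/
lemma momentLE_gaussian (S : Matrix (Fin m) (Fin m) ℝ) (p : ℕ) :
    MomentLE p (∫ η, (1 + ‖η‖) ^ p ∂(multivariateGaussian (0 : Euc m) S))
      (multivariateGaussian (0 : Euc m) S) := by
  refine ⟨?_, le_rfl⟩
  have h0 : MemLp (fun η : Euc m => ‖η‖) p (multivariateGaussian (0 : Euc m) S) :=
    (IsGaussian.memLp_id (multivariateGaussian (0 : Euc m) S) p (by simp)).norm
  have h1 : MemLp (fun η : Euc m => 1 + ‖η‖) p (multivariateGaussian (0 : Euc m) S) :=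
    (memLp_const (1 : ℝ)).add h0
  have h2 := h1.integrable_norm_pow'
  refine h2.congr (Filter.Eventually.of_forall fun η => ?_)
  simp only
  rw [Real.norm_of_nonneg (by positivity)]

lemma PolyLipNoise.integrable_right {γ : Measure (Euc m)} {φ : Euc n → Euc m → ℝ}
    (hφ : PolyLipNoise q c φ) {Mγ : ℝ} (hγ : MomentLE (q + 1) Mγ γ) (v : Euc n) :
    Integrable (fun η => φ v η) γ := by
  refine hγ.integrable (c := c * (1 + ‖v‖) ^ (q + 1)) ?_ fun η => (hφ.abs_le v η).trans ?_
  · exact (hφ.1.comp measurable_prodMk_left).aestronglyMeasurable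
  · rw [mul_pow, mul_assoc]

/-- Averaging over the noise returns to `PolyLip` with the same order, at the price of one noise
moment. -/
lemma PolyLipNoise.polyLip {γ : Measure (Euc m)} {φ : Euc n → Euc m → ℝ}
    (hφ : PolyLipNoise q c φ) {Mγ : ℝ} (hγ : MomentLE (q + 1) Mγ γ) :
    PolyLip q (c * Mγ) (fun v => ∫ η, φ v η ∂γ) := by
  have hc := hφ.mono
  refine ⟨fun v => ?_, fun v v' => ?_⟩
  · refine (hγ.abs_integral_le (c := c * (1 + ‖v‖) ^ (q + 1)) (by positivity)
      fun η => (hφ.abs_le v η).trans ?_).trans (le_of_eq (by ring))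
    rw [mul_pow, mul_assoc]
  · rw [← integral_sub (hφ.integrable_right hγ v) (hφ.integrable_right hγ v')]
    refine (hγ.abs_integral_le (c := c * (1 + ‖v‖ + ‖v'‖) ^ q * ‖v - v'‖) (by positivity)
      fun η => ((hφ.2 η).2 v v').trans (le_of_eq (by ring))).trans (le_of_eq (by ring))

lemma PolyLipNoise.integrable_prod [SFinite μ] {γ : Measure (Euc m)} [SFinite γ]
    {φ : Euc n → Euc m → ℝ}
    (hφ : PolyLipNoise q c φ) {Mγ : ℝ} (hγ : MomentLE (q + 1) Mγ γ) (h : MomentLE (q + 1) M μ) :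
    Integrable (fun p : Euc n × Euc m => φ p.1 p.2) (μ.prod γ) := by
  refine ((h.1.mul_prod hγ.1).const_mul c).mono' hφ.1.aestronglyMeasurable
    (Filter.Eventually.of_forall fun p => (hφ.abs_le p.1 p.2).trans (le_of_eq ?_))
  rw [mul_pow]

lemma PolyLipNoise.integral_prod [SFinite μ] {γ : Measure (Euc m)} [SFinite γ]
    {φ : Euc n → Euc m → ℝ}
    (hφ : PolyLipNoise q c φ) {Mγ : ℝ} (hγ : MomentLE (q + 1) Mγ γ) (h : MomentLE (q + 1) M μ) :
    ∫ p, φ p.1 p.2 ∂(μ.prod γ) = ∫ v, ∫ η, φ v η ∂γ ∂μ :=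
  MeasureTheory.integral_prod _ (hφ.integrable_prod hγ h)

end Moments

/-! ### Growth and regularity of the analysis map. -/

section Analysis

open scoped Matrix.Norms.L2Operator

variable {n m : ℕ} {q : ℕ} {c : ℝ} {f : Euc n → ℝ}

/-- A growth constant for the analysis map with `‖A‖ ≤ a` and `‖y‖ ≤ r`. -/
def analysisConst {n m : ℕ} (H : Matrix (Fin m) (Fin n) ℝ) (a r : ℝ) : ℝ :=
  2 + a + r + ‖H‖ + a * ‖H‖ + a * r

lemma one_le_analysisConst (H : Matrix (Fin m) (Fin n) ℝ) {a r : ℝ} (ha : 0 ≤ a) (hr : 0 ≤ r) :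
    1 ≤ analysisConst H a r := by
  have : 0 ≤ a + r + ‖H‖ + a * ‖H‖ + a * r := by positivity
  rw [analysisConst]
  linarith

lemma measurable_analysis (H : Matrix (Fin m) (Fin n) ℝ) (A : Matrix (Fin n) (Fin m) ℝ)
    (y : Euc m) : Measurable (fun p : Euc n × Euc m => analysis H A y p.2 p.1) := by
  have h1 : Continuous (toEuclideanLin A : Euc m →ₗ[ℝ] Euc n) :=
    LinearMap.continuous_of_finiteDimensional _
  have h2 : Continuous (toEuclideanLin H : Euc n →ₗ[ℝ] Euc m) :=
    LinearMap.continuous_of_finiteDimensional _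
  unfold analysis
  fun_prop

variable {H : Matrix (Fin m) (Fin n) ℝ} {A A' : Matrix (Fin n) (Fin m) ℝ} {y : Euc m} {a r : ℝ}

/-- The bound is a product in `v` and `η`, so that its powers integrate factor by factor against a
product measure. -/
lemma one_add_norm_analysis_le (hA : ‖A‖ ≤ a) (hy : ‖y‖ ≤ r) (v : Euc n) (η : Euc m) :
    1 + ‖analysis H A y η v‖ ≤ analysisConst H a r * ((1 + ‖v‖) * (1 + ‖η‖)) := by
  have ha : 0 ≤ a := (norm_nonneg _).trans hA
  have hr : 0 ≤ r := (norm_nonneg _).trans hy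
  have h1 : ‖toEuclideanLin A (toEuclideanLin H v)‖ ≤ a * (‖H‖ * ‖v‖) :=
    (norm_toEuclideanLin_le A _).trans (by gcongr; exact norm_toEuclideanLin_le H v)
  have h2 : ‖toEuclideanLin A (y + η)‖ ≤ a * (r + ‖η‖) :=
    (norm_toEuclideanLin_le A _).trans (by gcongr; exact (norm_add_le _ _).trans (by gcongr))
  have h3 : ‖analysis H A y η v‖ ≤ ‖v‖ + a * (‖H‖ * ‖v‖) + a * (r + ‖η‖) := by
    refine (norm_add_le _ _).trans (add_le_add ((norm_sub_le _ _).trans ?_) h2)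
    gcongr
  have hv := norm_nonneg v
  have hη := norm_nonneg η
  have hH := norm_nonneg H
  -- The difference between the claimed bound and the one from the triangle inequality.
  have : 0 ≤ 1 + (a + r) + (1 + a + r + ‖H‖ + a * r) * ‖v‖ + ‖H‖ + a * ‖H‖
      + (2 + r + ‖H‖ + a * ‖H‖ + a * r) * ‖η‖ + analysisConst H a r * (‖v‖ * ‖η‖) := by
    have := one_le_analysisConst H ha hr
    positivity
  rw [analysisConst] at *
  linarith

lemma analysis_sub_le (hA : ‖A‖ ≤ a) (hr : 0 ≤ r) (v v' : Euc n) (η : Euc m) :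
    ‖analysis H A y η v - analysis H A y η v'‖ ≤ analysisConst H a r * ‖v - v'‖ := by
  have ha : 0 ≤ a := (norm_nonneg _).trans hA
  have e : analysis H A y η v - analysis H A y η v'
      = (v - v') - toEuclideanLin A (toEuclideanLin H (v - v')) := by
    simp only [analysis, map_sub]; abel
  rw [e]
  have h1 : ‖toEuclideanLin A (toEuclideanLin H (v - v'))‖ ≤ a * (‖H‖ * ‖v - v'‖) :=
    (norm_toEuclideanLin_le A _).trans (by gcongr; exact norm_toEuclideanLin_le H _)
  refine (norm_sub_le _ _).trans ?_
  have : 0 ≤ (1 + a + r + ‖H‖ + a * r) * ‖v - v'‖ := by positivity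
  rw [analysisConst]
  linarith

/-- The two analyses differ by `A' - A` applied to the perturbed innovation `y + η - H v`. -/
lemma analysis_gain_sub_le (ha : 0 ≤ a) (hy : ‖y‖ ≤ r) (v : Euc n) (η : Euc m) :
    ‖analysis H A' y η v - analysis H A y η v‖
      ≤ analysisConst H a r * ‖A' - A‖ * ((1 + ‖v‖) * (1 + ‖η‖)) := by
  have hr : 0 ≤ r := (norm_nonneg _).trans hy
  have e : analysis H A' y η v - analysis H A y η v
      = toEuclideanLin (A' - A) (y + η - toEuclideanLin H v) := by
    simp only [analysis, map_sub, LinearMap.sub_apply, map_add]; abel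
  rw [e]
  refine (norm_toEuclideanLin_le _ _).trans ?_
  have h1 : ‖y + η - toEuclideanLin H v‖ ≤ r + ‖η‖ + ‖H‖ * ‖v‖ :=
    (norm_sub_le _ _).trans (add_le_add ((norm_add_le _ _).trans (by gcongr))
      (norm_toEuclideanLin_le H v))
  rw [mul_comm (analysisConst H a r), mul_assoc]
  gcongr
  refine h1.trans ?_
  have hv := norm_nonneg v
  have hη := norm_nonneg η
  have hH := norm_nonneg H
  have : 0 ≤ 2 + a + ‖H‖ + a * ‖H‖ + a * r + (2 + a + r + a * ‖H‖ + a * r) * ‖v‖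
      + (1 + a + r + ‖H‖ + a * ‖H‖ + a * r) * ‖η‖ + analysisConst H a r * (‖v‖ * ‖η‖) := by
    have := one_le_analysisConst H ha hr
    positivity
  rw [analysisConst] at *
  linarith

/-- The factor `2` absorbs the two norms in the Lipschitz weight. -/
lemma PolyLip.analysis (hf : PolyLip q c f) (hA : ‖A‖ ≤ a) (hy : ‖y‖ ≤ r) :
    PolyLipNoise q (c * (2 * analysisConst H a r) ^ (q + 1))
      (fun v η => f (analysis H A y η v)) := by
  have ha : 0 ≤ a := (norm_nonneg _).trans hA
  have hr : 0 ≤ r := (norm_nonneg _).trans hy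
  have hb := one_le_analysisConst H ha hr
  have hc := hf.nonneg
  set b := analysisConst H a r
  refine ⟨hf.continuous.measurable.comp (measurable_analysis H A y), fun η => ⟨fun v => ?_,
    fun v v' => ?_⟩⟩
  · refine (hf.1 _).trans ?_
    rw [mul_assoc, mul_assoc, ← mul_pow, ← mul_pow]
    gcongr
    refine (one_add_norm_analysis_le hA hy v η).trans ?_
    have : 0 ≤ b * ((1 + ‖v‖) * (1 + ‖η‖)) := by positivity
    change b * _ ≤ _
    linarith
  · refine (hf.2 _ _).trans ?_
    have h1 := one_add_norm_analysis_le (H := H) hA hy v η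
    have h2 := one_add_norm_analysis_le (H := H) hA hy v' η
    have h3 : 1 + ‖MeanFieldEnKF.analysis H A y η v‖ + ‖MeanFieldEnKF.analysis H A y η v'‖
        ≤ 2 * b * ((1 + ‖η‖) * (1 + ‖v‖ + ‖v'‖)) := by
      have : 0 ≤ b * (1 + ‖η‖) * (‖v‖ + ‖v'‖) := by positivity
      change _ ≤ b * _ at h1
      change _ ≤ b * _ at h2
      linarith
    have h4 := analysis_sub_le (H := H) (y := y) hA hr v v' η
    calc _ ≤ c * (2 * b * ((1 + ‖η‖) * (1 + ‖v‖ + ‖v'‖))) ^ q * (b * ‖v - v'‖) := by gcongr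
      _ = c * ((2 * b) ^ q * b) * (1 + ‖η‖) ^ q * (1 + ‖v‖ + ‖v'‖) ^ q * ‖v - v'‖ := by
        rw [mul_pow (2 * b), mul_pow (1 + ‖η‖)]; ring
      _ ≤ _ := by
        gcongr
        · rw [pow_succ]; gcongr; linarith
        · exact one_le_one_add_norm η
        · exact Nat.le_succ q

lemma PolyLip.analysis_gain_sub (hf : PolyLip q c f) (hA : ‖A‖ ≤ a) (hA' : ‖A'‖ ≤ a)
    (hy : ‖y‖ ≤ r) (v : Euc n) (η : Euc m) :
    |f (MeanFieldEnKF.analysis H A' y η v) - f (MeanFieldEnKF.analysis H A y η v)|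
      ≤ c * (2 * analysisConst H a r) ^ (q + 1) * ‖A' - A‖
        * ((1 + ‖v‖) * (1 + ‖η‖)) ^ (q + 1) := by
  have ha : 0 ≤ a := (norm_nonneg _).trans hA
  have hr : 0 ≤ r := (norm_nonneg _).trans hy
  have hb := one_le_analysisConst H ha hr
  have hc := hf.nonneg
  have h1 := one_add_norm_analysis_le (H := H) hA hy v η
  have h2 := one_add_norm_analysis_le (H := H) hA' hy v η
  have h3 := analysis_gain_sub_le (H := H) (A := A) (A' := A') ha hy v η
  set b := analysisConst H a r
  set W := (1 + ‖v‖) * (1 + ‖η‖)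
  have hW : 0 ≤ W := by positivity
  calc _ ≤ _ := hf.2 _ _
    _ ≤ c * (2 * b * W) ^ q * (b * ‖A' - A‖ * W) := by
      gcongr
      linarith
    _ = c * ((2 * b) ^ q * b) * ‖A' - A‖ * W ^ (q + 1) := by rw [mul_pow]; ring
    _ ≤ _ := by
      gcongr
      rw [pow_succ]; gcongr; linarith

end Analysis

/-! ### Covariance matrices. -/

section Covariance

open scoped Matrix.Norms.L2Operator

variable {n m : ℕ} {μ ν : Measure (Euc n)} {M : ℝ}

lemma MomentLE.memLp_coord [IsProbabilityMeasure μ] (h : MomentLE 2 M μ) (i : Fin n) :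
    MemLp (fun u : Euc n => u i) 2 μ := by
  have hm : AEStronglyMeasurable (fun u : Euc n => u i) μ :=
    (polyLip_coord i).continuous.aestronglyMeasurable
  rw [memLp_two_iff_integrable_sq hm]
  refine h.integrable (c := 1) (hm.pow 2) fun u => ?_
  simpa [sq] using (polyLip_coord_mul i i).1 u

lemma covMat_apply [IsProbabilityMeasure μ] (h : MomentLE 2 M μ) (i k : Fin n) :
    covMat μ i k = ∫ u, u i * u k ∂μ - (∫ u, u i ∂μ) * ∫ u, u k ∂μ := by
  simp only [covMat, Matrix.of_apply]
  rw [covariance_eq_sub (h.memLp_coord i) (h.memLp_coord k)]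
  rfl

/-- The quadratic form at `x` is the variance of the linear functional with coefficients `x`. -/
lemma covMat_posSemidef [IsProbabilityMeasure μ] (h : MomentLE 2 M μ) :
    (covMat μ).PosSemidef := by
  refine PosSemidef.of_dotProduct_mulVec_nonneg ?_ fun x => ?_
  · ext i k
    simp [covMat, covariance_comm]
  · have h1 : star x ⬝ᵥ (covMat μ *ᵥ x) = Var[fun u : Euc n => ∑ i, x i * u i; μ] := by
      rw [← covariance_self, covariance_fun_sum_fun_sum (fun i => (h.memLp_coord i).const_mul (x i))
        (fun i => (h.memLp_coord i).const_mul (x i))]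
      · simp only [dotProduct, mulVec, star_trivial, Finset.mul_sum, covMat, Matrix.of_apply]
        refine Finset.sum_congr rfl fun i _ => Finset.sum_congr rfl fun k _ => ?_
        rw [covariance_const_mul_left, covariance_const_mul_right]
        ring
      · exact (Finset.measurable_fun_sum _ fun i _ => by fun_prop).aemeasurable
    rw [h1]
    exact variance_nonneg _ _

/-- Only the moment bound of `ν` enters the estimate. That of `μ`, often an ensemble or a numerical
measure, just has to be finite. -/
lemma covMat_sub_le [IsProbabilityMeasure μ] [IsProbabilityMeasure ν] {M' : ℝ}
    (hμ : MomentLE 2 M' μ) (hν : MomentLE 2 M ν) {δ : ℝ}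
    (h1 : ∀ i, |∫ u, u i ∂μ - ∫ u, u i ∂ν| ≤ δ)
    (h2 : ∀ i k, |∫ u, u i * u k ∂μ - ∫ u, u i * u k ∂ν| ≤ δ) (i k : Fin n) :
    |covMat μ i k - covMat ν i k| ≤ δ * (1 + 2 * M + δ) := by
  rw [covMat_apply hμ, covMat_apply hν]
  have hM : ∀ i, |∫ u, u i ∂ν| ≤ M := fun i => by
    simpa using ((polyLip_coord i).mono (Nat.zero_le 1)).abs_integral_le hν
  -- The product of means is expanded around the means under `ν`; the quadratic term produces the
  -- last `δ` of the bound.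
  have e : (∫ u, u i * u k ∂μ - (∫ u, u i ∂μ) * ∫ u, u k ∂μ)
      - (∫ u, u i * u k ∂ν - (∫ u, u i ∂ν) * ∫ u, u k ∂ν)
      = (∫ u, u i * u k ∂μ - ∫ u, u i * u k ∂ν)
        - ((∫ u, u i ∂μ - ∫ u, u i ∂ν) * (∫ u, u k ∂μ - ∫ u, u k ∂ν)
          + (∫ u, u i ∂μ - ∫ u, u i ∂ν) * ∫ u, u k ∂ν
          + (∫ u, u i ∂ν) * (∫ u, u k ∂μ - ∫ u, u k ∂ν)) := by ring
  rw [e]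
  have hδ : 0 ≤ δ := (abs_nonneg _).trans (h1 i)
  have hM0 : 0 ≤ M := hν.nonneg
  refine (abs_sub _ _).trans ?_
  have a1 := abs_add_le ((∫ u, u i ∂μ - ∫ u, u i ∂ν) * (∫ u, u k ∂μ - ∫ u, u k ∂ν)
          + (∫ u, u i ∂μ - ∫ u, u i ∂ν) * ∫ u, u k ∂ν)
          ((∫ u, u i ∂ν) * (∫ u, u k ∂μ - ∫ u, u k ∂ν))
  have a2 := abs_add_le ((∫ u, u i ∂μ - ∫ u, u i ∂ν) * (∫ u, u k ∂μ - ∫ u, u k ∂ν))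
          ((∫ u, u i ∂μ - ∫ u, u i ∂ν) * ∫ u, u k ∂ν)
  simp only [abs_mul] at a1 a2
  have b1 := mul_le_mul (h1 i) (h1 k) (abs_nonneg _) hδ
  have b2 := mul_le_mul (h1 i) (hM k) (abs_nonneg _) hδ
  have b3 := mul_le_mul (hM i) (h1 k) (abs_nonneg _) hM0
  linarith [h2 i k]

lemma exists_norm_covMat_le (n : ℕ) (M : ℝ) : ∃ M' : ℝ, ∀ μ : Measure (Euc n),
    IsProbabilityMeasure μ → MomentLE 2 M μ → ‖covMat μ‖ ≤ M' := by
  obtain ⟨κ, -, h⟩ := exists_norm_le_of_entries n n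
  refine ⟨κ * (M + M * M), fun μ hμ hM => h _ _ ?_ fun i k => ?_⟩
  · have := hM.nonneg
    positivity
  · rw [covMat_apply hM]
    have hc : ∀ i, |∫ u, u i ∂μ| ≤ M := fun i => by
      simpa using ((polyLip_coord i).mono (Nat.zero_le 1)).abs_integral_le hM
    have h2 := (polyLip_coord_mul i k).abs_integral_le hM
    refine (abs_sub _ _).trans ?_
    rw [abs_mul]
    have := mul_le_mul (hc i) (hc k) (abs_nonneg _) hM.nonneg
    linarith

end Covariance

/-! ### Uniform bounds for the mean-field EnKF. -/

section MeanField

open scoped Matrix.Norms.L2Operator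

variable {n m : ℕ}

/-- The data of a filtering problem, with constants: a regular kernel, an initial
distribution with moment bounds, bounded observations. -/
structure FilterData {n m : ℕ} (B M₀ : ℕ → ℝ) (r : ℝ) (k : Kernel (Euc n) (Euc n))
    (ρ₀ : Measure (Euc n)) (y : ℕ → Euc m) : Prop where
  reg : RegularKernel k B
  prob : IsProbabilityMeasure ρ₀
  moment : ∀ p, MomentLE p (M₀ p) ρ₀
  obs : ∀ i, ‖y i‖ ≤ r

lemma isProbabilityMeasure_linUpdate (H : Matrix (Fin m) (Fin n) ℝ) (Γ : Matrix (Fin m) (Fin m) ℝ)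
    (y : Euc m) (C : Matrix (Fin n) (Fin n) ℝ) (μ : Measure (Euc n)) [IsProbabilityMeasure μ] :
    IsProbabilityMeasure (linUpdate H Γ y C μ) :=
  Measure.isProbabilityMeasure_map (measurable_analysis H _ y).aemeasurable

lemma integral_linUpdate (H : Matrix (Fin m) (Fin n) ℝ) (Γ : Matrix (Fin m) (Fin m) ℝ)
    (y : Euc m) (C : Matrix (Fin n) (Fin n) ℝ) (μ : Measure (Euc n)) {f : Euc n → ℝ}
    (hf : Measurable f) :
    ∫ u, f u ∂(linUpdate H Γ y C μ)
      = ∫ p, f (analysis H (gain H Γ C) y p.2 p.1) ∂(μ.prod (multivariateGaussian 0 Γ)) :=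
  integral_map (measurable_analysis H _ y).aemeasurable hf.aestronglyMeasurable

/-- The noise moments. -/
def noiseMoment {m : ℕ} (Γ : Matrix (Fin m) (Fin m) ℝ) (p : ℕ) : ℝ :=
  ∫ η, (1 + ‖η‖) ^ p ∂(multivariateGaussian (0 : Euc m) Γ)

lemma momentLE_noise (Γ : Matrix (Fin m) (Fin m) ℝ) (p : ℕ) :
    MomentLE p (noiseMoment Γ p) (multivariateGaussian (0 : Euc m) Γ) := momentLE_gaussian Γ p

lemma one_le_noiseMoment (Γ : Matrix (Fin m) (Fin m) ℝ) (p : ℕ) : 1 ≤ noiseMoment Γ p :=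
  (momentLE_noise Γ p).one_le

/-- With a fixed gain the update is dual to the averaged analysis map, so a forecast error is passed
on as the error of another test function of the class. -/
lemma PolyLip.integral_linUpdate {q : ℕ} {c : ℝ} {f : Euc n → ℝ} (hf : PolyLip q c f)
    (H : Matrix (Fin m) (Fin n) ℝ) (Γ : Matrix (Fin m) (Fin m) ℝ) (y : Euc m)
    (C : Matrix (Fin n) (Fin n) ℝ) {μ : Measure (Euc n)} [IsProbabilityMeasure μ] {M : ℝ}
    (hμ : MomentLE (q + 1) M μ) :
    ∫ u, f u ∂(linUpdate H Γ y C μ)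
      = ∫ v, ∫ η, f (MeanFieldEnKF.analysis H (gain H Γ C) y η v) ∂(multivariateGaussian 0 Γ) ∂μ := by
  rw [MeanFieldEnKF.integral_linUpdate H Γ y C μ hf.continuous.measurable]
  exact (hf.analysis le_rfl le_rfl).integral_prod (momentLE_noise Γ _) hμ

lemma linUpdate_moment {H : Matrix (Fin m) (Fin n) ℝ} {Γ : Matrix (Fin m) (Fin m) ℝ}
    {y : Euc m} {C : Matrix (Fin n) (Fin n) ℝ} {μ : Measure (Euc n)} [IsProbabilityMeasure μ]
    {p : ℕ} {M a r : ℝ} (hμ : MomentLE p M μ) (ha : ‖gain H Γ C‖ ≤ a) (hy : ‖y‖ ≤ r) :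
    MomentLE p (analysisConst H a r ^ p * (M * noiseMoment Γ p)) (linUpdate H Γ y C μ) := by
  have ha0 : 0 ≤ a := (norm_nonneg _).trans ha
  have hr0 : 0 ≤ r := (norm_nonneg _).trans hy
  have hb := one_le_analysisConst H ha0 hr0
  have hm : Measurable fun u : Euc n => (1 + ‖u‖) ^ p := by fun_prop
  have hma := measurable_analysis H (gain H Γ C) y
  have hbound : ∀ q : Euc n × Euc m, (1 + ‖analysis H (gain H Γ C) y q.2 q.1‖) ^ p
      ≤ analysisConst H a r ^ p * ((1 + ‖q.1‖) ^ p * (1 + ‖q.2‖) ^ p) := fun q => by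
    rw [← mul_pow, ← mul_pow]
    gcongr
    exact one_add_norm_analysis_le ha hy _ _
  have hint : Integrable (fun q : Euc n × Euc m =>
      analysisConst H a r ^ p * ((1 + ‖q.1‖) ^ p * (1 + ‖q.2‖) ^ p))
      (μ.prod (multivariateGaussian 0 Γ)) :=
    (hμ.1.mul_prod (momentLE_noise Γ p).1).const_mul _
  have hint' : Integrable (fun q : Euc n × Euc m =>
      (1 + ‖analysis H (gain H Γ C) y q.2 q.1‖) ^ p) (μ.prod (multivariateGaussian 0 Γ)) := by
    refine hint.mono' (hm.comp hma).aestronglyMeasurable (Filter.Eventually.of_forall fun q => ?_)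
    rw [Real.norm_of_nonneg (by positivity)]
    exact hbound q
  refine ⟨(integrable_map_measure hm.aestronglyMeasurable hma.aemeasurable).2 hint', ?_⟩
  rw [integral_linUpdate H Γ y C μ hm]
  refine (integral_mono hint' hint hbound).trans ?_
  rw [integral_const_mul, integral_prod_mul (fun v : Euc n => (1 + ‖v‖) ^ p)
    (fun η : Euc m => (1 + ‖η‖) ^ p)]
  have h1 := one_le_noiseMoment Γ p
  have h2 := hμ.2
  change _ * (_ * noiseMoment Γ p) ≤ _
  gcongr

lemma mfEnKF_prob {B M₀ : ℕ → ℝ} {r : ℝ} {k : Kernel (Euc n) (Euc n)} {ρ₀ : Measure (Euc n)}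
    {y : ℕ → Euc m} (hd : FilterData B M₀ r k ρ₀ y) (H : Matrix (Fin m) (Fin n) ℝ)
    (Γ : Matrix (Fin m) (Fin m) ℝ) (j : ℕ) :
    IsProbabilityMeasure (mfEnKF k H Γ ρ₀ y j) := by
  have := hd.reg.markov
  induction j with
  | zero => exact hd.prob
  | succ j ih => exact isProbabilityMeasure_linUpdate _ _ _ _ _

/-- The mean-field EnKF has moments of all orders, uniformly over the data; its gain is bounded and
stable under perturbations of the covariance. -/
lemma exists_mfEnKF_bounds (H : Matrix (Fin m) (Fin n) ℝ) {Γ : Matrix (Fin m) (Fin m) ℝ}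
    (hΓ : Γ.PosDef) (B M₀ : ℕ → ℝ) (r : ℝ) (j : ℕ) :
    ∃ (M : ℕ → ℝ) (a ε : ℝ), 1 ≤ a ∧ 0 < ε ∧
      ∀ (k : Kernel (Euc n) (Euc n)) (ρ₀ : Measure (Euc n)) (y : ℕ → Euc m),
        FilterData B M₀ r k ρ₀ y →
        (∀ p, MomentLE p (M p) (mfEnKF k H Γ ρ₀ y j)) ∧
        ∀ C' : Matrix (Fin n) (Fin n) ℝ, ‖C' - covMat (k ∘ₘ mfEnKF k H Γ ρ₀ y j)‖ ≤ ε →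
          ‖gain H Γ C'‖ ≤ a ∧ ‖gain H Γ C' - gain H Γ (covMat (k ∘ₘ mfEnKF k H Γ ρ₀ y j))‖
            ≤ a * ‖C' - covMat (k ∘ₘ mfEnKF k H Γ ρ₀ y j)‖ := by
  -- Moments of `μ` bound the forecast covariance, hence the gain. This single step serves both the
  -- induction on moments and the final statement.
  have key : ∀ M : ℕ → ℝ, ∃ a ε : ℝ, 1 ≤ a ∧ 0 < ε ∧
      ∀ (k : Kernel (Euc n) (Euc n)) (μ : Measure (Euc n)), RegularKernel k B →
        IsProbabilityMeasure μ → (∀ p, MomentLE p (M p) μ) →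
        ∀ C' : Matrix (Fin n) (Fin n) ℝ, ‖C' - covMat (k ∘ₘ μ)‖ ≤ ε →
          ‖gain H Γ C'‖ ≤ a ∧ ‖gain H Γ C' - gain H Γ (covMat (k ∘ₘ μ))‖
            ≤ a * ‖C' - covMat (k ∘ₘ μ)‖ := by
    intro M
    obtain ⟨M', hM'⟩ := exists_norm_covMat_le n (B 2 * M 2)
    obtain ⟨a, ε, ha, hε, hg⟩ := gain_bounds H hΓ M'
    refine ⟨a, ε, ha, hε, fun k μ hk hμ hm C' hC' => ?_⟩
    have := hk.markov
    have h2 := hk.comp_moment (hm 2)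
    exact hg _ C' (covMat_posSemidef h2) (hM' _ inferInstance h2) hC'
  suffices h : ∃ M : ℕ → ℝ, ∀ (k : Kernel (Euc n) (Euc n)) (ρ₀ : Measure (Euc n))
      (y : ℕ → Euc m), FilterData B M₀ r k ρ₀ y →
        ∀ p, MomentLE p (M p) (mfEnKF k H Γ ρ₀ y j) by
    obtain ⟨M, hM⟩ := h
    obtain ⟨a, ε, ha, hε, hg⟩ := key M
    exact ⟨M, a, ε, ha, hε, fun k ρ₀ y hd =>
      ⟨hM k ρ₀ y hd, hg k _ hd.reg (mfEnKF_prob hd H Γ j) (hM k ρ₀ y hd)⟩⟩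
  induction j with
  | zero => exact ⟨M₀, fun k ρ₀ y hd => hd.moment⟩
  | succ j ih =>
    obtain ⟨M, hM⟩ := ih
    obtain ⟨a, ε, ha, hε, hg⟩ := key M
    refine ⟨fun p => analysisConst H a r ^ p * (B p * M p * noiseMoment Γ p),
      fun k ρ₀ y hd p => ?_⟩
    have := hd.reg.markov
    have := mfEnKF_prob hd H Γ j
    refine linUpdate_moment (hd.reg.comp_moment (hM k ρ₀ y hd p)) ?_ (hd.obs _)
    -- The gain bound at zero perturbation.
    exact (hg k _ hd.reg this (hM k ρ₀ y hd) _ (by simpa using hε.le)).1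

end MeanField

/-! ### Deterministic mean-field EnKF against the exact mean-field EnKF. -/

section DeterministicRun

open scoped Matrix.Norms.L2Operator

variable {n m : ℕ} {q : ℕ} {c : ℝ} {f : Euc n → ℝ}

lemma integral_linUpdate_gain_sub_le (hf : PolyLip q c f) {H : Matrix (Fin m) (Fin n) ℝ}
    {Γ : Matrix (Fin m) (Fin m) ℝ} {y : Euc m} {C C' : Matrix (Fin n) (Fin n) ℝ}
    {μ : Measure (Euc n)} [IsProbabilityMeasure μ] {M a r : ℝ} (hμ : MomentLE (q + 1) M μ)
    (hC : ‖gain H Γ C‖ ≤ a) (hC' : ‖gain H Γ C'‖ ≤ a) (hy : ‖y‖ ≤ r) :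
    |∫ u, f u ∂(linUpdate H Γ y C' μ) - ∫ u, f u ∂(linUpdate H Γ y C μ)|
      ≤ c * (2 * analysisConst H a r) ^ (q + 1) * ‖gain H Γ C' - gain H Γ C‖
        * (M * noiseMoment Γ (q + 1)) := by
  have hfm := hf.continuous.measurable
  have hγ := momentLE_noise Γ (q + 1)
  have hc := hf.nonneg
  have hb := one_le_analysisConst H ((norm_nonneg _).trans hC) ((norm_nonneg _).trans hy)
  rw [integral_linUpdate H Γ y C' μ hfm, integral_linUpdate H Γ y C μ hfm,
    ← integral_sub ((hf.analysis hC' hy).integrable_prod hγ hμ)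
      ((hf.analysis hC hy).integrable_prod hγ hμ)]
  refine abs_integral_le_integral_abs.trans ?_
  refine (integral_mono_of_nonneg (Filter.Eventually.of_forall fun _ => abs_nonneg _)
    ((hμ.1.mul_prod hγ.1).const_mul _)
    (Filter.Eventually.of_forall fun p => (hf.analysis_gain_sub hC hC' hy p.1 p.2).trans
      (le_of_eq (by rw [mul_pow (1 + ‖p.1‖)])))).trans ?_
  rw [integral_const_mul, integral_prod_mul (fun v : Euc n => (1 + ‖v‖) ^ (q + 1))
    (fun η : Euc m => (1 + ‖η‖) ^ (q + 1))]
  have h1 := one_le_noiseMoment Γ (q + 1)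
  have h2 := hμ.2
  change _ * (_ * noiseMoment Γ (q + 1)) ≤ _
  gcongr

lemma abs_sub_le_of_supDist {w : Euc n → ℝ} {μ ν : Measure (Euc n)} {e : ℝ} (he : 0 ≤ e)
    (h : supDist w μ ν ≤ ENNReal.ofReal e) (hf : Measurable f) (hb : ∀ u, |f u| ≤ w u) :
    |∫ u, f u ∂μ - ∫ u, f u ∂ν| ≤ e := by
  have h1 : ENNReal.ofReal |∫ u, f u ∂μ - ∫ u, f u ∂ν| ≤ ENNReal.ofReal e := by
    refine le_trans (le_iSup_of_le f (le_iSup_of_le hf ?_)) h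
    exact le_iSup (fun _ : ∀ u, |f u| ≤ w u => ENNReal.ofReal |∫ u, f u ∂μ - ∫ u, f u ∂ν|) hb
  exact (ENNReal.ofReal_le_ofReal_iff he).1 h1

/-- From `(1 + t)² ≤ 2 (1 + t²)`: after division by `2 c` a test function of quadratic growth is
admissible for the weight. This gives access to covariances. -/
lemma abs_sub_le_of_weightedTVDist {μ ν : Measure (Euc n)} {e : ℝ} (he : 0 ≤ e)
    (h : weightedTVDist μ ν ≤ ENNReal.ofReal e) (hf : PolyLip 1 c f) :
    |∫ u, f u ∂μ - ∫ u, f u ∂ν| ≤ 2 * c * e := by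
  rcases hf.nonneg.eq_or_lt with hc | hc
  · have h0 : ∀ u, f u = 0 := fun u => by
      have := hf.1 u
      rw [← hc, zero_mul] at this
      exact abs_nonpos_iff.1 this
    simp [h0, ← hc]
  · have h1 := abs_sub_le_of_supDist (f := fun u => (2 * c)⁻¹ * f u) he h
      (hf.continuous.measurable.const_mul _) fun u => by
        rw [abs_mul, abs_of_nonneg (by positivity), inv_mul_le_iff₀ (by positivity)]
        refine (hf.1 u).trans ?_
        have : 0 ≤ c * (1 - ‖u‖) ^ 2 := by positivity
        ring_nf at this ⊢
        linarith
    rw [integral_const_mul, integral_const_mul, ← mul_sub, abs_mul, abs_of_nonneg (by positivity),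
      inv_mul_le_iff₀ (by positivity)] at h1
    exact h1

lemma exists_momentLE_two {μ : Measure (Euc n)} [IsProbabilityMeasure μ]
    (h : Integrable (fun u => ‖u‖ ^ 2) μ) : ∃ M, MomentLE 2 M μ := by
  refine ⟨_, ?_, le_rfl⟩
  refine ((h.const_mul 2).add (integrable_const 2)).mono'
    (Continuous.aestronglyMeasurable (by fun_prop)) (Filter.Eventually.of_forall fun u => ?_)
  rw [Real.norm_of_nonneg (by positivity), Pi.add_apply]
  nlinarith [sq_nonneg (1 - ‖u‖)]

/-- The deterministic mean-field EnKF is close to the mean-field EnKF, for small errors. -/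
lemma exists_run_close (H : Matrix (Fin m) (Fin n) ℝ) {Γ : Matrix (Fin m) (Fin m) ℝ}
    (hΓ : Γ.PosDef) (B M₀ : ℕ → ℝ) (r : ℝ) (j : ℕ) :
    ∃ C e₀ : ℝ, 0 ≤ C ∧ 0 < e₀ ∧ ∀ (k : Kernel (Euc n) (Euc n)) (ρ₀ : Measure (Euc n))
      (y : ℕ → Euc m), FilterData B M₀ r k ρ₀ y → ∀ e e₁ e₂ : ℝ, 0 ≤ e → e ≤ e₀ →
      e₁ ≤ e → e₂ ≤ e → ∀ (p phat : ℕ → Measure (Euc n)) (Chat : ℕ → Matrix (Fin n) (Fin n) ℝ),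
      IsDMFEnKF k H Γ ρ₀ y e₁ e₂ p phat Chat → ∀ (c : ℝ) (f : Euc n → ℝ), PolyLip 1 c f →
        |∫ u, f u ∂(p j) - ∫ u, f u ∂(mfEnKF k H Γ ρ₀ y j)| ≤ c * (C * e) := by
  induction j with
  | zero =>
    refine ⟨2, 1, by norm_num, one_pos, fun k ρ₀ y hd e e₁ e₂ he _ h1 _ p phat Chat hrun c f hf =>
      ?_⟩
    have := abs_sub_le_of_weightedTVDist he (hrun.init.trans (ENNReal.ofReal_le_ofReal h1)) hf
    rw [mfEnKF]
    linarith
  | succ j ih =>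
    obtain ⟨C, e₀, hC, he₀, ih⟩ := ih
    obtain ⟨M, a, ε, ha, hε, hM⟩ := exists_mfEnKF_bounds H hΓ B M₀ r j
    obtain ⟨κ, hκ, hκE⟩ := exists_norm_le_of_entries n n
    -- `C₁ e` will bound the forecast error and `C₂ e` the entries of the covariance error. Absolute
    -- values surround constants whose sign is known only once the data are given.
    set Mh := B 2 * M 2 with hMh
    set C₁ := 2 + |B 1 + B 2| * C with hC₁
    have hC₁0 : 0 ≤ C₁ := by positivity
    set C₂ := 1 + C₁ * (1 + 2 * |Mh| + C₁) with hC₂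
    have hC₂0 : 0 < C₂ := by positivity
    set b := analysisConst H a r
    -- Three sources: the error of the numerical update, the forecast error pushed through the
    -- update, and the gain error. The threshold on `e` allows the induction hypothesis, gives `e² ≤
    -- e`, and keeps the covariance within the radius of the gain bound.
    refine ⟨2 + (2 * |b|) ^ 2 * noiseMoment Γ 2 * C₁
      + (2 * |b|) ^ 2 * (a * (κ * C₂)) * (|Mh| * noiseMoment Γ 2), min (min e₀ 1) (ε / (κ * C₂)),
      ?_, by positivity, ?_⟩
    · have := one_le_noiseMoment Γ 2
      positivity
    intro k ρ₀ y hd e e₁ e₂ he hee h1 h2 p phat Chat hrun c f hf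
    have := hd.reg.markov
    have := mfEnKF_prob hd H Γ j
    have := hrun.prob
    have := hrun.prob_hat
    obtain ⟨hmom, hgain⟩ := hM k ρ₀ y hd
    have hr : 0 ≤ r := (norm_nonneg _).trans (hd.obs 0)
    have hb : 1 ≤ b := one_le_analysisConst H (by linarith) hr
    have hb' : |b| = b := abs_of_nonneg (by linarith)
    have he0 : e ≤ e₀ := hee.trans ((min_le_left _ _).trans (min_le_left _ _))
    have he1 : e ≤ 1 := hee.trans ((min_le_left _ _).trans (min_le_right _ _))
    have heε : e ≤ ε / (κ * C₂) := hee.trans (min_le_right _ _)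
    set π := mfEnKF k H Γ ρ₀ y j with hπ
    have hmomh : MomentLE 2 Mh (k ∘ₘ π) := hd.reg.comp_moment (hmom 2)
    have hMh0 : |Mh| = Mh := abs_of_nonneg hmomh.nonneg
    have hBB : |B 1 + B 2| = B 1 + B 2 :=
      abs_of_nonneg (by linarith [hd.reg.one_le 1, hd.reg.one_le 2])
    -- the forecast
    have S1 : ∀ (c : ℝ) (g : Euc n → ℝ), PolyLip 1 c g →
        |∫ u, g u ∂(phat (j + 1)) - ∫ u, g u ∂(k ∘ₘ π)| ≤ c * (C₁ * e) := by
      intro c g hg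
      obtain ⟨M', hM'⟩ := exists_momentLE_two (hrun.moment j)
      have t1 := abs_sub_le_of_weightedTVDist he
        ((hrun.forecast j).trans (ENNReal.ofReal_le_ofReal h1)) hg
      -- The kernel is moved onto the test function, where the induction hypothesis applies.
      have t2 := ih k ρ₀ y hd e e₁ e₂ he he0 h1 h2 p phat Chat hrun _ _ (hd.reg.polyLip hg)
      rw [← hd.reg.integral_comp hM' hg, ← hd.reg.integral_comp (hmom 2) hg] at t2
      have t3 := abs_sub_le (∫ u, g u ∂(phat (j + 1))) (∫ u, g u ∂(k ∘ₘ p j))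
        (∫ u, g u ∂(k ∘ₘ π))
      rw [hC₁, hBB]
      linarith
    -- the covariance
    have hcov : ∀ i l, |Chat (j + 1) i l - covMat (k ∘ₘ π) i l| ≤ C₂ * e := by
      intro i l
      obtain ⟨M', hM'⟩ := exists_momentLE_two (hrun.moment_hat (j + 1))
      have t1 := (hrun.cov j i l).trans h2
      have t2 := covMat_sub_le hM' hmomh (δ := C₁ * e)
        (fun i => by simpa using S1 1 _ ((polyLip_coord i).mono (Nat.zero_le 1)))
        (fun i l => by simpa using S1 1 _ (polyLip_coord_mul i l)) i l
      have t3 := abs_sub_le (Chat (j + 1) i l) (covMat (phat (j + 1)) i l) (covMat (k ∘ₘ π) i l)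
      have t4 : C₁ * e * (1 + 2 * Mh + C₁ * e) ≤ C₁ * e * (1 + 2 * Mh + C₁) := by
        have : C₁ * e ≤ C₁ := mul_le_of_le_one_right hC₁0 he1
        gcongr
      rw [hC₂, hMh0]
      linarith
    have hcovn : ‖Chat (j + 1) - covMat (k ∘ₘ π)‖ ≤ κ * (C₂ * e) :=
      hκE _ _ (by positivity) fun i l => by simpa using hcov i l
    have hcovε : ‖Chat (j + 1) - covMat (k ∘ₘ π)‖ ≤ ε := by
      refine hcovn.trans ?_
      rw [le_div_iff₀ (by positivity)] at heε
      linarith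
    obtain ⟨hga, hgd⟩ := hgain _ hcovε
    obtain ⟨hga0, -⟩ := hgain (covMat (k ∘ₘ π)) (by simpa using hε.le)
    -- the update
    have T3 := abs_sub_le_of_weightedTVDist he
      ((hrun.update j).trans (ENNReal.ofReal_le_ofReal h2)) hf
    have T4 : |∫ u, f u ∂(linUpdate H Γ (y (j + 1)) (Chat (j + 1)) (phat (j + 1)))
        - ∫ u, f u ∂(linUpdate H Γ (y (j + 1)) (Chat (j + 1)) (k ∘ₘ π))|
        ≤ c * (2 * b) ^ 2 * noiseMoment Γ 2 * (C₁ * e) := by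
      obtain ⟨M', hM'⟩ := exists_momentLE_two (hrun.moment_hat (j + 1))
      rw [hf.integral_linUpdate H Γ _ _ hM', hf.integral_linUpdate H Γ _ _ hmomh]
      exact S1 _ _ ((hf.analysis hga (hd.obs (j + 1))).polyLip (momentLE_noise Γ 2))
    have T5 := integral_linUpdate_gain_sub_le hf hmomh hga0 hga (hd.obs (j + 1))
    have T5' : c * (2 * b) ^ 2 * ‖gain H Γ (Chat (j + 1)) - gain H Γ (covMat (k ∘ₘ π))‖
        * (Mh * noiseMoment Γ 2)
        ≤ c * (2 * b) ^ 2 * (a * (κ * (C₂ * e))) * (Mh * noiseMoment Γ 2) := by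
      have := one_le_noiseMoment Γ 2
      have := hf.nonneg
      have := hmomh.nonneg
      gcongr
      exact hgd.trans (by gcongr)
    have T6 := abs_sub_le (∫ u, f u ∂(p (j + 1)))
      (∫ u, f u ∂(linUpdate H Γ (y (j + 1)) (Chat (j + 1)) (phat (j + 1))))
      (∫ u, f u ∂(linUpdate H Γ (y (j + 1)) (covMat (k ∘ₘ π)) (k ∘ₘ π)))
    have T7 := abs_sub_le
      (∫ u, f u ∂(linUpdate H Γ (y (j + 1)) (Chat (j + 1)) (phat (j + 1))))
      (∫ u, f u ∂(linUpdate H Γ (y (j + 1)) (Chat (j + 1)) (k ∘ₘ π)))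
      (∫ u, f u ∂(linUpdate H Γ (y (j + 1)) (covMat (k ∘ₘ π)) (k ∘ₘ π)))
    rw [mfEnKF, ← hπ, hb', hMh0]
    calc _ ≤ 2 * c * e + (c * (2 * b) ^ 2 * noiseMoment Γ 2 * (C₁ * e)
          + c * (2 * b) ^ 2 * (a * (κ * (C₂ * e))) * (Mh * noiseMoment Γ 2)) := by
          refine T6.trans (add_le_add T3 (T7.trans (add_le_add T4 (T5.trans T5'))))
      _ = _ := by ring

end DeterministicRun

/-! ### Truncated squares. -/

section Truncation

/-- The square truncated at `1`. -/
def truncSq (x : ℝ) : ℝ := min 1 (x ^ 2)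

lemma truncSq_nonneg (x : ℝ) : 0 ≤ truncSq x := le_min zero_le_one (sq_nonneg x)

lemma truncSq_le_one (x : ℝ) : truncSq x ≤ 1 := min_le_left _ _

lemma truncSq_le_sq (x : ℝ) : truncSq x ≤ x ^ 2 := min_le_right _ _

lemma measurable_truncSq : Measurable truncSq := by
  unfold truncSq; fun_prop

/-- Truncation keeps the inequalities of the square that are used, this one and `truncSq_mul_le`,
and makes errors integrable without any moment bound on the ensemble. -/
lemma truncSq_add_le (x y : ℝ) : truncSq (x + y) ≤ 2 * truncSq x + 2 * truncSq y := by
  unfold truncSq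
  rcases le_total 1 (x ^ 2) with hx | hx <;> rcases le_total 1 (y ^ 2) with hy | hy <;>
    simp only [min_eq_left, min_eq_right, hx, hy] <;>
    first
    | exact (min_le_left _ _).trans (by nlinarith)
    | exact (min_le_right _ _).trans (by nlinarith [sq_nonneg (x - y)])

lemma truncSq_mul_le (a x : ℝ) (ha : 1 ≤ a) : truncSq (a * x) ≤ a ^ 2 * truncSq x := by
  unfold truncSq
  rcases le_total 1 (x ^ 2) with hx | hx
  · rw [min_eq_left hx]
    exact (min_le_left _ _).trans (by nlinarith)
  · rw [min_eq_right hx]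
    exact (min_le_right _ _).trans (by rw [mul_pow])

/-- Below the level one nothing is cut off, so a small truncated deviation is a small deviation. -/
lemma sq_le_of_truncSq_le {x s : ℝ} (h : truncSq x ≤ s) (hs : s < 1) : x ^ 2 ≤ s := by
  rcases min_le_iff.1 h with h1 | h1
  · linarith
  · exact h1

lemma lintegral_ofReal_sum_le {X ι : Type*} [MeasurableSpace X] {Q : Measure X} (s : Finset ι)
    {F : ι → X → ℝ} {δ : ι → ℝ} (hF : ∀ i x, 0 ≤ F i x) (hm : ∀ i, Measurable (F i))
    (hδ : ∀ i, 0 ≤ δ i) (h : ∀ i, ∫⁻ x, ENNReal.ofReal (F i x) ∂Q ≤ ENNReal.ofReal (δ i)) :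
    ∫⁻ x, ENNReal.ofReal (∑ i ∈ s, F i x) ∂Q ≤ ENNReal.ofReal (∑ i ∈ s, δ i) := by
  rw [ENNReal.ofReal_sum_of_nonneg fun i _ => hδ i]
  simp_rw [ENNReal.ofReal_sum_of_nonneg fun i _ => hF i _]
  rw [lintegral_finsetSum _ fun i _ => (hm i).ennreal_ofReal]
  exact Finset.sum_le_sum fun i _ => h i

lemma lintegral_ofReal_add_le {X : Type*} [MeasurableSpace X] {Q : Measure X}
    {F G : X → ℝ} {δ ε : ℝ} (hF : ∀ x, 0 ≤ F x) (hG : ∀ x, 0 ≤ G x) (hm : Measurable F)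
    (hδ : 0 ≤ δ) (hε : 0 ≤ ε) (h : ∫⁻ x, ENNReal.ofReal (F x) ∂Q ≤ ENNReal.ofReal δ)
    (h' : ∫⁻ x, ENNReal.ofReal (G x) ∂Q ≤ ENNReal.ofReal ε) :
    ∫⁻ x, ENNReal.ofReal (F x + G x) ∂Q ≤ ENNReal.ofReal (δ + ε) := by
  rw [ENNReal.ofReal_add hδ hε]
  simp_rw [ENNReal.ofReal_add (hF _) (hG _)]
  rw [lintegral_add_left hm.ennreal_ofReal]
  exact add_le_add h h'

lemma lintegral_ofReal_mul_le {X : Type*} [MeasurableSpace X] {Q : Measure X}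
    {F : X → ℝ} {δ a : ℝ} (ha : 0 ≤ a) (hm : Measurable F)
    (h : ∫⁻ x, ENNReal.ofReal (F x) ∂Q ≤ ENNReal.ofReal δ) :
    ∫⁻ x, ENNReal.ofReal (a * F x) ∂Q ≤ ENNReal.ofReal (a * δ) := by
  simp_rw [ENNReal.ofReal_mul ha]
  rw [lintegral_const_mul _ hm.ennreal_ofReal]
  gcongr

end Truncation

/-! ### Ensemble averages and Chebyshev's inequality. -/

section Averages

variable {X : Type*}

/-- The average of `g` over an ensemble. -/
def avg {N : ℕ} (g : X → ℝ) (p : Fin N → X) : ℝ := (N : ℝ)⁻¹ * ∑ i, g (p i)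

lemma avg_const_mul {N : ℕ} (a : ℝ) (g : X → ℝ) (p : Fin N → X) :
    avg (fun x => a * g x) p = a * avg g p := by
  simp only [avg, ← Finset.mul_sum]; ring

lemma abs_avg_sub_avg_le {N : ℕ} {Y : Type*} {g : X → ℝ} {h : Y → ℝ} {w : Y → ℝ} {p : Fin N → X}
    {p' : Fin N → Y} (hb : ∀ i, |g (p i) - h (p' i)| ≤ w (p' i)) :
    |avg g p - avg h p'| ≤ avg w p' := by
  rw [avg, avg, avg, ← mul_sub, ← Finset.sum_sub_distrib, abs_mul, abs_of_nonneg (by positivity)]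
  gcongr
  exact (Finset.abs_sum_le_sum_abs _ _).trans (Finset.sum_le_sum fun i _ => hb i)

lemma measurable_avg [MeasurableSpace X] {N : ℕ} {g : X → ℝ} (hg : Measurable g) :
    Measurable (fun p : Fin N → X => avg g p) := by
  unfold avg
  exact (Finset.measurable_fun_sum _ fun i _ => hg.comp (measurable_pi_apply i)).const_mul _

lemma integral_empirical {n N : ℕ} (f : Euc n → ℝ) (v : Fin N → Euc n) :
    ∫ u, f u ∂(empirical v) = avg f v := by
  rw [empirical, integral_smul_measure, integral_finsetSum_measure]
  · simp [avg]
  · intro i _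
    exact integrable_dirac (by simp)

lemma isProbabilityMeasure_empirical {n N : ℕ} (hN : 0 < N) (v : Fin N → Euc n) :
    IsProbabilityMeasure (empirical v) := by
  constructor
  simp only [empirical, Measure.smul_apply, Measure.coe_finsetSum, Finset.sum_apply, measure_univ,
    Finset.sum_const, Finset.card_univ, Fintype.card_fin, nsmul_eq_mul, mul_one, smul_eq_mul]
  exact ENNReal.inv_mul_cancel (by exact_mod_cast hN.ne') (by simp)

lemma exists_momentLE_empirical {n N : ℕ} (hN : 0 < N) (v : Fin N → Euc n) (p : ℕ) :
    ∃ M, MomentLE p M (empirical v) := by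
  refine ⟨_, ?_, le_rfl⟩
  refine Integrable.smul_measure ?_ (by simp [hN.ne'])
  exact integrable_finsetSum_measure.2 fun i _ => integrable_dirac (by simp)

/-- Chebyshev's inequality for the average of independent, not necessarily identically distributed
terms. -/
lemma lintegral_avg_sub_sq_le [MeasurableSpace X] {N : ℕ} (ν : Fin N → Measure X)
    [∀ i, IsProbabilityMeasure (ν i)] {g : X → ℝ} (hg : ∀ i, MemLp g 2 (ν i))
    {w : ℝ} (hw : (N : ℝ)⁻¹ * ∑ i, ∫ x, g x ^ 2 ∂(ν i) ≤ w) :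
    ∫⁻ p, ENNReal.ofReal ((avg g p - (N : ℝ)⁻¹ * ∑ i, ∫ x, g x ∂(ν i)) ^ 2) ∂(Measure.pi ν)
      ≤ ENNReal.ofReal (w / N) := by
  have hi : ∀ i, MemLp (fun p : Fin N → X => g (p i)) 2 (Measure.pi ν) := fun i =>
    (hg i).comp_measurePreserving (measurePreserving_eval ν i)
  have hs : MemLp (∑ i, fun p : Fin N → X => g (p i)) 2 (Measure.pi ν) :=
    memLp_finsetSum' _ fun i _ => hi i
  have hint : (Measure.pi ν)[∑ i, fun p : Fin N → X => g (p i)] = ∑ i, ∫ x, g x ∂(ν i) := by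
    simp_rw [Finset.sum_apply]
    rw [integral_finsetSum _ fun i _ => (hi i).integrable one_le_two]
    refine Finset.sum_congr rfl fun i _ => ?_
    have hmp := measurePreserving_eval ν i
    conv_rhs => rw [← hmp.map_eq]
    refine (integral_map hmp.measurable.aemeasurable ?_).symm
    rw [hmp.map_eq]
    exact (hg i).aestronglyMeasurable
  have hvar : Var[∑ i, fun p : Fin N → X => g (p i); Measure.pi ν] ≤ N * w := by
    rw [variance_sum_pi hg]
    calc ∑ i, Var[g; ν i] ≤ ∑ i, ∫ x, g x ^ 2 ∂(ν i) :=
          Finset.sum_le_sum fun i _ => by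
            simpa using variance_le_expectation_sq (hg i).aestronglyMeasurable
      _ ≤ N * w := by
        rcases Nat.eq_zero_or_pos N with rfl | hN
        · simp
        · have : (0 : ℝ) < N := by exact_mod_cast hN
          rwa [inv_mul_le_iff₀ this] at hw
  have e : ∀ p : Fin N → X, (avg g p - (N : ℝ)⁻¹ * ∑ i, ∫ x, g x ∂(ν i)) ^ 2
      = ((N : ℝ)⁻¹) ^ 2 * ((∑ i, fun p : Fin N → X => g (p i)) p
        - (Measure.pi ν)[∑ i, fun p : Fin N → X => g (p i)]) ^ 2 := by
    intro p
    rw [hint, avg, Finset.sum_apply]; ring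
  simp_rw [e, ENNReal.ofReal_mul (sq_nonneg _)]
  rw [lintegral_const_mul' _ _ ENNReal.ofReal_ne_top, ← evariance_eq_lintegral_ofReal,
    ← ofReal_variance hs, ← ENNReal.ofReal_mul (sq_nonneg _)]
  refine ENNReal.ofReal_le_ofReal ?_
  rcases Nat.eq_zero_or_pos N with rfl | hN
  · simp
  · have : (0 : ℝ) < N := by exact_mod_cast hN
    calc _ ≤ ((N : ℝ)⁻¹) ^ 2 * (N * w) := by gcongr
      _ = w / N := by field_simp

end Averages

/-! ### The ensemble forecast. -/

section EnsembleForecast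

variable {n m N : ℕ}

/-- The joint law of the forecasts and of the perturbations of an ensemble. -/
def forecastLaw {n m : ℕ} (k : Kernel (Euc n) (Euc n)) (Γ : Matrix (Fin m) (Fin m) ℝ) (N : ℕ)
    (P : Measure (Fin N → Euc n)) : Measure ((Fin N → Euc n) × (Fin N → Euc m)) :=
  P.bind fun v =>
    (Measure.pi fun i => k (v i)).prod (Measure.pi fun _ : Fin N => multivariateGaussian 0 Γ)

/-- The pairs of a forecast ensemble and an ensemble of perturbations. -/
def zipPairs {n m N : ℕ} (p : (Fin N → Euc n) × (Fin N → Euc m)) : Fin N → Euc n × Euc m :=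
  fun i => (p.1 i, p.2 i)

lemma measurable_zipPairs : Measurable (zipPairs : (Fin N → Euc n) × (Fin N → Euc m) → _) := by
  unfold zipPairs; fun_prop

/-- After regrouping, forecast and perturbation of each member form independent pairs, and
Chebyshev's inequality applies to functions of both. -/
lemma map_zipPairs_prod_pi (μ : Fin N → Measure (Euc n)) (ν : Fin N → Measure (Euc m))
    [∀ i, IsProbabilityMeasure (μ i)] [∀ i, IsProbabilityMeasure (ν i)] :
    ((Measure.pi μ).prod (Measure.pi ν)).map zipPairs = Measure.pi fun i => (μ i).prod (ν i) := by
  have h := measurePreserving_arrowProdEquivProdArrow (Euc n) (Euc m) (Fin N) μ ν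
  rw [← h.map_eq, Measure.map_map measurable_zipPairs h.measurable]
  convert Measure.map_id
  rfl

lemma forecastLaw_univ_le (k : Kernel (Euc n) (Euc n)) [IsMarkovKernel k]
    (Γ : Matrix (Fin m) (Fin m) ℝ) {P : Measure (Fin N → Euc n)} (hP : P Set.univ ≤ 1) :
    forecastLaw k Γ N P Set.univ ≤ 1 := by
  rw [← lintegral_one, forecastLaw]
  refine (Measure.lintegral_bind_le _ _ _).trans ?_
  simpa using hP

/-- An upper bound is all that is needed, and `Measure.lintegral_bind_le` gives it without
measurability of the conditional law in `v`. -/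
lemma lintegral_forecastLaw_le (k : Kernel (Euc n) (Euc n)) [IsMarkovKernel k]
    (Γ : Matrix (Fin m) (Fin m) ℝ) (P : Measure (Fin N → Euc n))
    {F : (Fin N → Euc n × Euc m) → ℝ≥0∞} (hF : Measurable F) :
    ∫⁻ p, F (zipPairs p) ∂(forecastLaw k Γ N P)
      ≤ ∫⁻ v, ∫⁻ p, F p ∂(Measure.pi fun i => (k (v i)).prod (multivariateGaussian 0 Γ)) ∂P := by
  refine (Measure.lintegral_bind_le _ _ _).trans (lintegral_mono fun v => le_of_eq ?_)
  rw [← map_zipPairs_prod_pi (fun i => k (v i)) (fun _ => multivariateGaussian 0 Γ),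
    lintegral_map hF measurable_zipPairs]

/-- The second moment of one term given its starting point `x`; it bounds the variance in
Chebyshev's inequality. -/
lemma PolyLipNoise.integral_sq_le {q : ℕ} {c : ℝ} {φ : Euc n → Euc m → ℝ}
    (hφ : PolyLipNoise q c φ) {k : Kernel (Euc n) (Euc n)} {B : ℕ → ℝ} (hk : RegularKernel k B)
    (Γ : Matrix (Fin m) (Fin m) ℝ) (x : Euc n) :
    MemLp (fun p : Euc n × Euc m => φ p.1 p.2) 2 ((k x).prod (multivariateGaussian 0 Γ)) ∧
    ∫ p, φ p.1 p.2 ^ 2 ∂((k x).prod (multivariateGaussian (0 : Euc m) Γ))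
      ≤ c ^ 2 * (B (2 * q + 2) * noiseMoment Γ (2 * q + 2)) * (1 + ‖x‖) ^ (2 * q + 2) := by
  have := hk.markov
  have hc := hφ.mono
  have hb : ∀ p : Euc n × Euc m, φ p.1 p.2 ^ 2
      ≤ c ^ 2 * ((1 + ‖p.1‖) ^ (2 * q + 2) * (1 + ‖p.2‖) ^ (2 * q + 2)) := fun p => by
    rw [← sq_abs]
    calc |φ p.1 p.2| ^ 2 ≤ (c * ((1 + ‖p.1‖) * (1 + ‖p.2‖)) ^ (q + 1)) ^ 2 := by
          gcongr
          exact hφ.abs_le _ _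
      _ = _ := by rw [mul_pow (1 + ‖p.1‖)]; ring
  have hm := hk.moment (2 * q + 2) x
  have hγ := momentLE_noise Γ (2 * q + 2)
  have hi := (hm.1.mul_prod hγ.1).const_mul (c ^ 2)
  have hsm : AEStronglyMeasurable (fun p : Euc n × Euc m => φ p.1 p.2)
    ((k x).prod (multivariateGaussian 0 Γ)) := hφ.1.aestronglyMeasurable
  refine ⟨(memLp_two_iff_integrable_sq hsm).2 (hi.mono' (hsm.pow 2)
    (Filter.Eventually.of_forall fun p => ?_)), ?_⟩
  · simpa using hb p
  · refine (integral_mono_of_nonneg (Filter.Eventually.of_forall fun _ => sq_nonneg _) hi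
      (Filter.Eventually.of_forall hb)).trans ?_
    rw [integral_const_mul, integral_prod_mul (fun v : Euc n => (1 + ‖v‖) ^ (2 * q + 2))
      (fun η : Euc m => (1 + ‖η‖) ^ (2 * q + 2))]
    have h1 := one_le_noiseMoment Γ (2 * q + 2)
    have h2 := hm.2
    change _ * (_ * noiseMoment Γ (2 * q + 2)) ≤ _
    calc _ ≤ c ^ 2 * (B (2 * q + 2) * (1 + ‖x‖) ^ (2 * q + 2) * noiseMoment Γ (2 * q + 2)) := by
          gcongr
      _ = _ := by ring

lemma integral_prod_kernel {q : ℕ} {c : ℝ} {φ : Euc n → Euc m → ℝ}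
    (hφ : PolyLipNoise q c φ) {k : Kernel (Euc n) (Euc n)} {B : ℕ → ℝ} (hk : RegularKernel k B)
    (Γ : Matrix (Fin m) (Fin m) ℝ) (x : Euc n) :
    ∫ p, φ p.1 p.2 ∂((k x).prod (multivariateGaussian (0 : Euc m) Γ))
      = ∫ v, ∫ η, φ v η ∂(multivariateGaussian 0 Γ) ∂(k x) := by
  have := hk.markov
  exact hφ.integral_prod (momentLE_noise Γ _) (hk.moment _ x)

/-- Averages over the ensemble are close to averages against `π`, in truncated mean square. -/
def EnsembleClose {n N : ℕ} (P : Measure (Fin N → Euc n)) (π : Measure (Euc n)) (D : ℕ → ℝ) : Prop :=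
  P Set.univ ≤ 1 ∧ ∀ (q : ℕ) (f : Euc n → ℝ), PolyLip q 1 f →
    ∫⁻ v, ENNReal.ofReal (truncSq (avg f v - ∫ u, f u ∂π)) ∂P ≤ ENNReal.ofReal (D q / N)

lemma EnsembleClose.apply {P : Measure (Fin N → Euc n)} {π : Measure (Euc n)} {D : ℕ → ℝ}
    (h : EnsembleClose P π D) {q : ℕ} {c : ℝ} {f : Euc n → ℝ} (hf : PolyLip q c f) :
    ∫⁻ v, ENNReal.ofReal (truncSq (avg f v - ∫ u, f u ∂π)) ∂P
      ≤ ENNReal.ofReal ((c + 1) ^ 2 * (D q / N)) := by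
  have hc := hf.nonneg
  -- Scaling by `c + 1` instead of `c` covers `c = 0` and gives the factor `≥ 1` that
  -- `truncSq_mul_le` asks for.
  have e : ∀ v : Fin N → Euc n, avg f v - ∫ u, f u ∂π
      = (c + 1) * (avg (fun u => (c + 1)⁻¹ * f u) v - ∫ u, (c + 1)⁻¹ * f u ∂π) := by
    intro v
    rw [avg_const_mul, integral_const_mul]
    field_simp
  calc _ ≤ ∫⁻ v, ENNReal.ofReal ((c + 1) ^ 2 * truncSq
        (avg (fun u => (c + 1)⁻¹ * f u) v - ∫ u, (c + 1)⁻¹ * f u ∂π)) ∂P :=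
        lintegral_mono fun v => ENNReal.ofReal_le_ofReal
          (by rw [e v]; exact truncSq_mul_le _ _ (by linarith))
    _ ≤ _ := by
        refine lintegral_ofReal_mul_le (by positivity) (measurable_truncSq.comp
          ((measurable_avg ?_).sub_const _)) (h.2 q _ hf.normalize)
        exact hf.continuous.measurable.const_mul _

/-- The error splits into the fluctuation around the conditional mean given the ensemble, handled by
Chebyshev's inequality, and the error of that conditional mean, which is an ensemble average of the
`PolyLip` function `Φ`. The conditional variance is bounded by another ensemble average, of the
weight `w` of degree `2q + 2`. The hypothesis is thus also used at order `2q + 1`, which is why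
`EnsembleClose` carries all orders at once. -/
lemma forecast_close {q : ℕ} {c : ℝ} {φ : Euc n → Euc m → ℝ} (hφ : PolyLipNoise q c φ)
    {k : Kernel (Euc n) (Euc n)} {B : ℕ → ℝ} (hk : RegularKernel k B)
    (Γ : Matrix (Fin m) (Fin m) ℝ) {P : Measure (Fin N → Euc n)} {π : Measure (Euc n)}
    [IsProbabilityMeasure π] {D M : ℕ → ℝ} (hD : ∀ q, 0 ≤ D q) (hP : EnsembleClose P π D)
    (hM : ∀ p, MomentLE p (M p) π) :
    ∫⁻ p, ENNReal.ofReal (truncSq (avg (fun x : Euc n × Euc m => φ x.1 x.2) (zipPairs p)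
        - ∫ x, φ x.1 x.2 ∂((k ∘ₘ π).prod (multivariateGaussian 0 Γ)))) ∂(forecastLaw k Γ N P)
      ≤ ENNReal.ofReal ((2 * (c ^ 2 * (B (2 * q + 2) * noiseMoment Γ (2 * q + 2))
            * (M (2 * q + 2) + 1) + (2 * q + 3) ^ 2 * D (2 * q + 1))
          + 2 * ((c * noiseMoment Γ (q + 1) * (B q + B (q + 1)) + 1) ^ 2 * D q)) / N) := by
  have := hk.markov
  set K := c ^ 2 * (B (2 * q + 2) * noiseMoment Γ (2 * q + 2)) with hK
  have hK0 : 0 ≤ K := by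
    have := one_le_noiseMoment Γ (2 * q + 2)
    have := hk.one_le (2 * q + 2)
    positivity
  set w : Euc n → ℝ := fun u => (1 + ‖u‖) ^ (2 * q + 2) with hw
  have hwp : PolyLip (2 * q + 1) ((2 * q + 1 : ℕ) + 1) w := polyLip_pow (2 * q + 1)
  set Φ : Euc n → ℝ := fun x => ∫ v, ∫ η, φ v η ∂(multivariateGaussian 0 Γ) ∂(k x) with hΦ
  have hg := hφ.polyLip (momentLE_noise Γ (q + 1))
  have hΦp : PolyLip q (c * noiseMoment Γ (q + 1) * (B q + B (q + 1))) Φ := hk.polyLip hg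
  have hπΦ : ∫ x, φ x.1 x.2 ∂((k ∘ₘ π).prod (multivariateGaussian 0 Γ)) = ∫ x, Φ x ∂π := by
    rw [hφ.integral_prod (momentLE_noise Γ (q + 1)) (hk.comp_moment (hM (q + 1))),
      hk.integral_comp (hM (q + 1)) hg]
  rw [hπΦ]
  have hφm : Measurable fun x : Euc n × Euc m => φ x.1 x.2 := hφ.1
  have hwm := hM (2 * q + 2)
  have hM0 := hwm.nonneg
  have hN0 : (0 : ℝ) ≤ N := Nat.cast_nonneg N
  -- conditional on the ensemble
  have h1 : ∀ v : Fin N → Euc n, ∫⁻ p, ENNReal.ofReal (truncSq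
      (avg (fun x : Euc n × Euc m => φ x.1 x.2) p - ∫ x, Φ x ∂π))
        ∂(Measure.pi fun i => (k (v i)).prod (multivariateGaussian 0 Γ))
      ≤ ENNReal.ofReal (2 * (K * (M (2 * q + 2) + 1) / N + truncSq (avg w v - ∫ u, w u ∂π))
        + 2 * truncSq (avg Φ v - ∫ x, Φ x ∂π)) := by
    intro v
    set Q := Measure.pi fun i => (k (v i)).prod (multivariateGaussian (0 : Euc m) Γ) with hQ
    have hmean : (N : ℝ)⁻¹ * ∑ i, ∫ x, φ x.1 x.2 ∂((k (v i)).prod (multivariateGaussian 0 Γ))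
        = avg Φ v := by
      simp_rw [integral_prod_kernel hφ hk Γ]
      rfl
    have hcheb := lintegral_avg_sub_sq_le (N := N)
      (fun i => (k (v i)).prod (multivariateGaussian (0 : Euc m) Γ))
      (g := fun x => φ x.1 x.2) (fun i => (hφ.integral_sq_le hk Γ (v i)).1) (w := K * avg w v) (by
        rw [← avg_const_mul, avg]
        gcongr with i
        exact (hφ.integral_sq_le hk Γ (v i)).2)
    rw [hmean] at hcheb
    have hA : ∫⁻ p, ENNReal.ofReal (truncSq
        (avg (fun x : Euc n × Euc m => φ x.1 x.2) p - avg Φ v)) ∂Q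
        ≤ ENNReal.ofReal (K * (M (2 * q + 2) + 1) / N + truncSq (avg w v - ∫ u, w u ∂π)) := by
      -- Either the average of `w` is bounded and Chebyshev's inequality gives `1 / N`, or `w`
      -- deviates from its mean by at least one; its truncated deviation then equals one and
      -- dominates the left side.
      by_cases hgood : avg w v ≤ M (2 * q + 2) + 1
      · refine (lintegral_mono fun p => ENNReal.ofReal_le_ofReal (truncSq_le_sq _)).trans
          (hcheb.trans (ENNReal.ofReal_le_ofReal ?_))
        have : K * avg w v / N ≤ K * (M (2 * q + 2) + 1) / N := by gcongr
        linarith [truncSq_nonneg (avg w v - ∫ u, w u ∂π)]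
      · push Not at hgood
        have h2 : 1 ≤ avg w v - ∫ u, w u ∂π := by
          have : ∫ u, w u ∂π ≤ M (2 * q + 2) := hwm.2
          linarith
        have h3 : truncSq (avg w v - ∫ u, w u ∂π) = 1 := by
          rw [truncSq, min_eq_left]
          nlinarith
        calc _ ≤ ∫⁻ _, 1 ∂Q := lintegral_mono fun p => by
              simpa using truncSq_le_one _
          _ = 1 := by simp [hQ]
          _ ≤ _ := by
            rw [h3, ← ENNReal.ofReal_one]
            refine ENNReal.ofReal_le_ofReal ?_
            have : 0 ≤ K * (M (2 * q + 2) + 1) / N := by positivity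
            linarith
    have hm1 : Measurable fun p : Fin N → Euc n × Euc m =>
        truncSq (avg (fun x : Euc n × Euc m => φ x.1 x.2) p - avg Φ v) :=
      measurable_truncSq.comp ((measurable_avg hφm).sub_const _)
    refine (lintegral_mono fun p => ENNReal.ofReal_le_ofReal (?_ :
      _ ≤ 2 * truncSq (avg (fun x : Euc n × Euc m => φ x.1 x.2) p - avg Φ v)
        + 2 * truncSq (avg Φ v - ∫ x, Φ x ∂π))).trans ?_
    · rw [← sub_add_sub_cancel _ (avg Φ v)]
      exact truncSq_add_le _ _
    · refine lintegral_ofReal_add_le (fun p => ?_) (fun p => ?_) (hm1.const_mul _) ?_ ?_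
        (lintegral_ofReal_mul_le zero_le_two hm1 hA) (le_of_eq (by simp [hQ]))
      · have := truncSq_nonneg (avg (fun x : Euc n × Euc m => φ x.1 x.2) p - avg Φ v)
        positivity
      · have := truncSq_nonneg (avg Φ v - ∫ x, Φ x ∂π)
        positivity
      · have := truncSq_nonneg (avg w v - ∫ u, w u ∂π)
        positivity
      · have := truncSq_nonneg (avg Φ v - ∫ x, Φ x ∂π)
        positivity
  have hm2 : ∀ (g : Euc n → ℝ), Continuous g → Measurable fun v : Fin N → Euc n =>
      truncSq (avg g v - ∫ u, g u ∂π) := fun g hg =>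
    measurable_truncSq.comp ((measurable_avg hg.measurable).sub_const _)
  refine (lintegral_forecastLaw_le k Γ P (F := fun p => ENNReal.ofReal (truncSq
      (avg (fun x : Euc n × Euc m => φ x.1 x.2) p - ∫ x, Φ x ∂π)))
    (measurable_truncSq.comp ((measurable_avg hφm).sub_const _)).ennreal_ofReal).trans ?_
  refine (lintegral_mono h1).trans ?_
  have hconst : ∫⁻ _, ENNReal.ofReal (K * (M (2 * q + 2) + 1) / N) ∂P
      ≤ ENNReal.ofReal (K * (M (2 * q + 2) + 1) / N) := by
    rw [lintegral_const]
    exact mul_le_of_le_one_right' hP.1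
  have hconst0 : 0 ≤ K * (M (2 * q + 2) + 1) / N := by positivity
  -- The `PolyLip` constant of `w` is `2q + 2`, and `EnsembleClose.apply` adds one.
  have hwD : ∫⁻ v, ENNReal.ofReal (truncSq (avg w v - ∫ u, w u ∂π)) ∂P
      ≤ ENNReal.ofReal ((2 * q + 3) ^ 2 * (D (2 * q + 1) / N)) := by
    convert hP.apply hwp using 4
    push_cast; ring
  have hΦD := hP.apply hΦp
  have := hD q
  have := hD (2 * q + 1)
  refine (lintegral_ofReal_add_le (fun v => ?_) (fun v => ?_) ?_ ?_ ?_
    (lintegral_ofReal_mul_le zero_le_two ?_ (lintegral_ofReal_add_le (fun _ => hconst0)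
      (fun v => truncSq_nonneg _) measurable_const hconst0 ?_ hconst hwD))
    (lintegral_ofReal_mul_le zero_le_two (hm2 Φ hΦp.continuous) hΦD)).trans (le_of_eq ?_)
  · have := truncSq_nonneg (avg w v - ∫ u, w u ∂π)
    positivity
  · have := truncSq_nonneg (avg Φ v - ∫ x, Φ x ∂π)
    positivity
  · exact ((hm2 w hwp.continuous).const_add _).const_mul _
  · positivity
  · positivity
  · exact (hm2 w hwp.continuous).const_add _
  · positivity
  · congr 1
    ring

end EnsembleForecast

/-! ### The ensemble update and propagation of chaos. -/

section EnsembleUpdate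

open scoped Matrix.Norms.L2Operator

variable {n m N : ℕ}

/-- The deviation of the average of `φ` over an ensemble of pairs. -/
def deviation {n m N : ℕ} (Γ : Matrix (Fin m) (Fin m) ℝ) (ν : Measure (Euc n))
    (φ : Euc n → Euc m → ℝ) (p : (Fin N → Euc n) × (Fin N → Euc m)) : ℝ :=
  avg (fun x : Euc n × Euc m => φ x.1 x.2) (zipPairs p)
    - ∫ x, φ x.1 x.2 ∂(ν.prod (multivariateGaussian 0 Γ))

lemma measurable_deviation {Γ : Matrix (Fin m) (Fin m) ℝ} {ν : Measure (Euc n)}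
    {φ : Euc n → Euc m → ℝ} (hφ : Measurable (Function.uncurry φ)) :
    Measurable (deviation (N := N) Γ ν φ) :=
  ((measurable_avg (g := fun x : Euc n × Euc m => φ x.1 x.2) hφ).comp
    measurable_zipPairs).sub_const _

/-- The total truncated deviation of the quantities that control the update. -/
def updateError {n m N : ℕ} (q : ℕ) (Γ : Matrix (Fin m) (Fin m) ℝ) (ν : Measure (Euc n))
    (p : (Fin N → Euc n) × (Fin N → Euc m)) : ℝ :=
  ∑ i, truncSq (deviation Γ ν (fun v _ => v i) p)
    + (∑ i, ∑ l, truncSq (deviation Γ ν (fun v _ => v i * v l) p)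
      + truncSq (deviation Γ ν (fun v η => ((1 + ‖v‖) * (1 + ‖η‖)) ^ (q + 1)) p))

lemma updateError_nonneg (q : ℕ) (Γ : Matrix (Fin m) (Fin m) ℝ) (ν : Measure (Euc n))
    (p : (Fin N → Euc n) × (Fin N → Euc m)) : 0 ≤ updateError q Γ ν p :=
  add_nonneg (Finset.sum_nonneg fun _ _ => truncSq_nonneg _)
    (add_nonneg (Finset.sum_nonneg fun _ _ => Finset.sum_nonneg fun _ _ => truncSq_nonneg _)
      (truncSq_nonneg _))

lemma deviation_fst (Γ : Matrix (Fin m) (Fin m) ℝ) (ν : Measure (Euc n)) [SFinite ν]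
    (g : Euc n → ℝ) (p : (Fin N → Euc n) × (Fin N → Euc m)) :
    deviation Γ ν (fun v _ => g v) p = avg g p.1 - ∫ u, g u ∂ν := by
  rw [deviation, integral_fun_fst]
  simp [avg, zipPairs]

/-- On every realization the updated ensemble is controlled by truncated deviations. -/
lemma truncSq_update_le {H : Matrix (Fin m) (Fin n) ℝ} {Γ : Matrix (Fin m) (Fin m) ℝ}
    {q : ℕ} {f : Euc n → ℝ} (hf : PolyLip q 1 f) {ν : Measure (Euc n)} [IsProbabilityMeasure ν]
    {M₂ Mq a r ε κ : ℝ} (h2 : MomentLE 2 M₂ ν) (hq : MomentLE (q + 1) Mq ν) (ha : 1 ≤ a)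
    (hκ : 0 < κ) (hε : 0 < ε)
    (hκE : ∀ (A : Matrix (Fin n) (Fin n) ℝ) (δ : ℝ), 0 ≤ δ → (∀ i k, |A i k| ≤ δ) → ‖A‖ ≤ κ * δ)
    (hg : ∀ C' : Matrix (Fin n) (Fin n) ℝ, ‖C' - covMat ν‖ ≤ ε →
      ‖gain H Γ C'‖ ≤ a ∧ ‖gain H Γ C' - gain H Γ (covMat ν)‖ ≤ a * ‖C' - covMat ν‖)
    {y : Euc m} (hy : ‖y‖ ≤ r) (hN : 0 < N) (p : (Fin N → Euc n) × (Fin N → Euc m)) :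
    truncSq (avg f (fun i => analysis H (gain H Γ (covMat (empirical p.1))) y (p.2 i) (p.1 i))
        - ∫ u, f u ∂(linUpdate H Γ y (covMat ν) ν))
      ≤ 2 * (((((2 * analysisConst H a r) ^ (q + 1) * (a * (κ * (2 + 2 * M₂)))
            * (1 + Mq * noiseMoment Γ (q + 1))) ^ 2
          + ((min 1 (ε / (κ * (2 + 2 * M₂)))) ^ 2)⁻¹)) * updateError q Γ ν p)
        + 2 * truncSq (deviation Γ ν (fun v η => f (analysis H (gain H Γ (covMat ν)) y η v)) p) := by
  have hM₂ : 1 ≤ M₂ := h2.one_le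
  have hMq : 1 ≤ Mq := hq.one_le
  have hr : 0 ≤ r := (norm_nonneg _).trans hy
  have hb : 1 ≤ analysisConst H a r := one_le_analysisConst H (by linarith) hr
  have hnm := one_le_noiseMoment Γ (q + 1)
  set b := analysisConst H a r
  set K := (2 * b) ^ (q + 1) * (a * (κ * (2 + 2 * M₂))) * (1 + Mq * noiseMoment Γ (q + 1))
  set ε₁ := min 1 (ε / (κ * (2 + 2 * M₂))) with hε₁
  have hε₁0 : 0 < ε₁ := by positivity
  set s := updateError q Γ ν p with hs
  have hs0 : 0 ≤ s := updateError_nonneg q Γ ν p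
  have hga0 := (hg (covMat ν) (by simpa using hε.le)).1
  set Ĉ := covMat (empirical p.1)
  have hlin : ∫ u, f u ∂(linUpdate H Γ y (covMat ν) ν)
      = ∫ x, f (analysis H (gain H Γ (covMat ν)) y x.2 x.1)
        ∂(ν.prod (multivariateGaussian 0 Γ)) :=
    integral_linUpdate H Γ y _ ν hf.continuous.measurable
  -- `f₀` uses the mean-field gain, so each term of its average depends on one pair only; `v'` is
  -- the true update with the common sample gain.
  set f₀ : Euc n × Euc m → ℝ := fun x => f (analysis H (gain H Γ (covMat ν)) y x.2 x.1)
  set v' : Fin N → Euc n := fun i => analysis H (gain H Γ Ĉ) y (p.2 i) (p.1 i)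
  have hfirst : truncSq (avg f v' - avg f₀ (zipPairs p)) ≤ (K ^ 2 + (ε₁ ^ 2)⁻¹) * s := by
    -- If the total deviation is large, the truncated error is at most `1 ≤ s / ε₁²`.
    by_cases hbig : ε₁ ^ 2 ≤ s
    · refine (truncSq_le_one _).trans ?_
      have h1 : 1 ≤ (ε₁ ^ 2)⁻¹ * s := by
        rw [inv_mul_eq_div, one_le_div (by positivity)]
        exact hbig
      have : 0 ≤ K ^ 2 * s := by positivity
      linarith
    · push Not at hbig
      have hs1 : s < 1 := hbig.trans_le (pow_le_one₀ hε₁0.le (min_le_left _ _))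
      -- Otherwise each deviation is at most `√s`, small enough for the sample covariance to lie
      -- within the radius of the gain bound, and the error is at most `K √s`.
      set δ := Real.sqrt s with hδ
      have hδ0 : 0 ≤ δ := Real.sqrt_nonneg _
      have hδs : δ ^ 2 = s := Real.sq_sqrt hs0
      have hδε : δ ≤ ε₁ := by
        rw [hδ, Real.sqrt_le_left hε₁0.le]
        exact hbig.le
      have hδ1 : δ ≤ 1 := hδε.trans (min_le_left _ _)
      have hdev : ∀ x : ℝ, truncSq x ≤ s → |x| ≤ δ := fun x hx =>
        Real.abs_le_sqrt (sq_le_of_truncSq_le hx hs1)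
      have p1 : 0 ≤ ∑ i, truncSq (deviation Γ ν (fun v _ => v i) p) :=
        Finset.sum_nonneg fun _ _ => truncSq_nonneg _
      have p2 : 0 ≤ ∑ i, ∑ l, truncSq (deviation Γ ν (fun v _ => v i * v l) p) :=
        Finset.sum_nonneg fun _ _ => Finset.sum_nonneg fun _ _ => truncSq_nonneg _
      have p3 := truncSq_nonneg
        (deviation Γ ν (fun v η => ((1 + ‖v‖) * (1 + ‖η‖)) ^ (q + 1)) p)
      have hse : s = ∑ i, truncSq (deviation Γ ν (fun v _ => v i) p)
        + (∑ i, ∑ l, truncSq (deviation Γ ν (fun v _ => v i * v l) p)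
          + truncSq (deviation Γ ν (fun v η => ((1 + ‖v‖) * (1 + ‖η‖)) ^ (q + 1)) p)) := rfl
      have d1 : ∀ i, |∫ u, u i ∂(empirical p.1) - ∫ u, u i ∂ν| ≤ δ := fun i => by
        rw [integral_empirical, ← deviation_fst Γ ν (fun u => u i) p]
        refine hdev _ ?_
        have := Finset.single_le_sum
          (f := fun i => truncSq (deviation Γ ν (fun v _ => v i) p))
          (fun _ _ => truncSq_nonneg _) (Finset.mem_univ i)
        linarith
      have d2 : ∀ i l, |∫ u, u i * u l ∂(empirical p.1) - ∫ u, u i * u l ∂ν| ≤ δ :=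
        fun i l => by
        rw [integral_empirical, ← deviation_fst Γ ν (fun u => u i * u l) p]
        refine hdev _ ?_
        have t1 := Finset.single_le_sum
          (f := fun i => ∑ l, truncSq (deviation Γ ν (fun v _ => v i * v l) p))
          (fun _ _ => Finset.sum_nonneg fun _ _ => truncSq_nonneg _) (Finset.mem_univ i)
        have t2 := Finset.single_le_sum
          (f := fun l => truncSq (deviation Γ ν (fun v _ => v i * v l) p))
          (fun _ _ => truncSq_nonneg _) (Finset.mem_univ l)
        simp only at t1 t2
        linarith
      -- The deviation of this weight is part of `updateError` precisely to bound its average here.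
      have d3 : avg (fun x : Euc n × Euc m => ((1 + ‖x.1‖) * (1 + ‖x.2‖)) ^ (q + 1)) (zipPairs p)
          ≤ 1 + Mq * noiseMoment Γ (q + 1) := by
        have t1 := (abs_le.1 (hdev
          (deviation Γ ν (fun v η => ((1 + ‖v‖) * (1 + ‖η‖)) ^ (q + 1)) p) (by linarith))).2
        have t2 : ∫ x, ((1 + ‖x.1‖) * (1 + ‖x.2‖)) ^ (q + 1)
            ∂(ν.prod (multivariateGaussian (0 : Euc m) Γ)) ≤ Mq * noiseMoment Γ (q + 1) := by
          simp_rw [mul_pow]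
          rw [integral_prod_mul (fun v : Euc n => (1 + ‖v‖) ^ (q + 1))
            (fun η : Euc m => (1 + ‖η‖) ^ (q + 1))]
          have := hq.2
          change _ * noiseMoment Γ (q + 1) ≤ _
          gcongr
        rw [deviation] at t1
        linarith
      have hprob := isProbabilityMeasure_empirical hN p.1
      obtain ⟨M', hM'⟩ := exists_momentLE_empirical hN p.1 2
      have hC : ‖Ĉ - covMat ν‖ ≤ κ * ((2 + 2 * M₂) * δ) := by
        refine hκE _ _ (by positivity) fun i l => ?_
        refine (covMat_sub_le hM' h2 d1 d2 i l).trans ?_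
        calc δ * (1 + 2 * M₂ + δ) ≤ δ * (1 + 2 * M₂ + 1) := by gcongr
          _ = _ := by ring
      have hCε : ‖Ĉ - covMat ν‖ ≤ ε := by
        refine hC.trans ?_
        have := hδε.trans (min_le_right _ _)
        rw [le_div_iff₀ (by positivity)] at this
        linarith
      obtain ⟨hga, hgd⟩ := hg Ĉ hCε
      have hdiff : |avg f v' - avg f₀ (zipPairs p)| ≤ K * δ := by
        refine (abs_avg_sub_avg_le (w := fun x : Euc n × Euc m => (2 * b) ^ (q + 1)
          * (a * (κ * ((2 + 2 * M₂) * δ))) * ((1 + ‖x.1‖) * (1 + ‖x.2‖)) ^ (q + 1))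
          fun i => ?_).trans ?_
        · have := hf.analysis_gain_sub (H := H) hga0 hga hy (p.1 i) (p.2 i)
          rw [one_mul] at this
          refine this.trans ?_
          simp only [zipPairs]
          gcongr
          exact hgd.trans (by gcongr)
        · rw [avg_const_mul]
          calc _ ≤ (2 * b) ^ (q + 1) * (a * (κ * ((2 + 2 * M₂) * δ)))
                * (1 + Mq * noiseMoment Γ (q + 1)) := by gcongr
            _ = K * δ := by simp only [K]; ring
      calc truncSq (avg f v' - avg f₀ (zipPairs p)) ≤ (avg f v' - avg f₀ (zipPairs p)) ^ 2 :=
            truncSq_le_sq _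
        _ = |avg f v' - avg f₀ (zipPairs p)| ^ 2 := (sq_abs _).symm
        _ ≤ (K * δ) ^ 2 := by gcongr
        _ = K ^ 2 * s := by rw [mul_pow, hδs]
        _ ≤ _ := by
          have : 0 ≤ (ε₁ ^ 2)⁻¹ * s := by positivity
          linarith
  have hdec : avg f v' - ∫ u, f u ∂(linUpdate H Γ y (covMat ν) ν)
      = (avg f v' - avg f₀ (zipPairs p))
        + deviation Γ ν (fun v η => f (analysis H (gain H Γ (covMat ν)) y η v)) p := by
    rw [hlin, deviation]; ring
  rw [hdec]
  refine (truncSq_add_le _ _).trans ?_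
  gcongr

/-- Propagation of chaos for the EnKF, in truncated mean square. -/
lemma exists_ensemble_close (H : Matrix (Fin m) (Fin n) ℝ) {Γ : Matrix (Fin m) (Fin m) ℝ}
    (hΓ : Γ.PosDef) (B M₀ : ℕ → ℝ) (r : ℝ) (j : ℕ) :
    ∃ D : ℕ → ℝ, (∀ q, 0 ≤ D q) ∧ ∀ (k : Kernel (Euc n) (Euc n)) (ρ₀ : Measure (Euc n))
      (y : ℕ → Euc m), FilterData B M₀ r k ρ₀ y → ∀ N : ℕ, 0 < N →
        EnsembleClose (enkfLaw k H Γ ρ₀ y N j) (mfEnKF k H Γ ρ₀ y j) D := by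
  induction j with
  | zero =>
    refine ⟨fun q => |M₀ (2 * q + 2)|, fun q => abs_nonneg _, fun k ρ₀ y hd N hN => ?_⟩
    have := hd.prob
    have hN' : (0 : ℝ) < N := by exact_mod_cast hN
    refine ⟨by simp [enkfLaw], fun q f hf => ?_⟩
    have hm := hd.moment (2 * q + 2)
    have hsq : ∀ u, |f u ^ 2| ≤ 1 * (1 + ‖u‖) ^ (2 * q + 2) := fun u => by
      rw [abs_of_nonneg (sq_nonneg _)]
      simpa using hf.sq u
    have hfm : AEStronglyMeasurable f ρ₀ := hf.continuous.aestronglyMeasurable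
    have hL : MemLp f 2 ρ₀ :=
      (memLp_two_iff_integrable_sq hfm).2 (hm.integrable (hfm.pow 2) hsq)
    have h := lintegral_avg_sub_sq_le (N := N) (fun _ => ρ₀) (fun _ => hL)
      (w := |M₀ (2 * q + 2)|) (by
        have h1 := hm.abs_integral_le zero_le_one hsq
        rw [one_mul] at h1
        simp only [Finset.sum_const, Finset.card_univ, Fintype.card_fin, nsmul_eq_mul]
        rw [inv_mul_cancel_left₀ hN'.ne']
        exact (le_abs_self _).trans (h1.trans (le_abs_self _)))
    have e : (N : ℝ)⁻¹ * ∑ _i : Fin N, ∫ x, f x ∂ρ₀ = ∫ x, f x ∂ρ₀ := by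
      simp only [Finset.sum_const, Finset.card_univ, Fintype.card_fin, nsmul_eq_mul]
      rw [inv_mul_cancel_left₀ hN'.ne']
    rw [e] at h
    exact (lintegral_mono fun v => ENNReal.ofReal_le_ofReal (truncSq_le_sq _)).trans h
  | succ j ih =>
    obtain ⟨D, hD, ih⟩ := ih
    obtain ⟨M, a, ε, ha, hε, hM⟩ := exists_mfEnKF_bounds H hΓ B M₀ r j
    obtain ⟨κ, hκ, hκE⟩ := exists_norm_le_of_entries n n
    -- the deviation constants of the forecast step
    set E : ℕ → ℝ → ℝ := fun q c =>
      |2 * (c ^ 2 * (B (2 * q + 2) * noiseMoment Γ (2 * q + 2))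
            * (M (2 * q + 2) + 1) + (2 * q + 3) ^ 2 * D (2 * q + 1))
          + 2 * ((c * noiseMoment Γ (q + 1) * (B q + B (q + 1)) + 1) ^ 2 * D q)| with hE
    have hE0 : ∀ q c, 0 ≤ E q c := fun q c => abs_nonneg _
    -- The constant of `truncSq_update_le` with each deviation replaced by its bound: `E 0 1` for
    -- coordinates, `E 1 1` for products, `E q (q + 1)` for the weight, and the last term for `f`
    -- after the mean-field analysis.
    refine ⟨fun q => 2 * (((((2 * analysisConst H a r) ^ (q + 1) * (a * (κ * (2 + 2 * (B 2 * M 2))))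
            * (1 + B (q + 1) * M (q + 1) * noiseMoment Γ (q + 1))) ^ 2
          + ((min 1 (ε / (κ * (2 + 2 * (B 2 * M 2))))) ^ 2)⁻¹)) *
            (∑ _i : Fin n, E 0 1 + (∑ _i : Fin n, ∑ _l : Fin n, E 1 1 + E q (q + 1))))
        + 2 * E q ((2 * analysisConst H a r) ^ (q + 1)), fun q => ?_, fun k ρ₀ y hd N hN => ?_⟩
    · have : 0 ≤ ∑ _i : Fin n, E 0 1 := Finset.sum_nonneg fun _ _ => hE0 _ _
      have : 0 ≤ ∑ _i : Fin n, ∑ _l : Fin n, E 1 1 :=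
        Finset.sum_nonneg fun _ _ => Finset.sum_nonneg fun _ _ => hE0 _ _
      have := hE0 q (q + 1)
      have := hE0 q ((2 * analysisConst H a r) ^ (q + 1))
      positivity
    have := hd.reg.markov
    have := mfEnKF_prob hd H Γ j
    have hN' : (0 : ℝ) < N := by exact_mod_cast hN
    obtain ⟨hmom, hgain⟩ := hM k ρ₀ y hd
    have hP := ih k ρ₀ y hd N hN
    set π := mfEnKF k H Γ ρ₀ y j with hπ
    set P := enkfLaw k H Γ ρ₀ y N j with hPdef
    set Q := forecastLaw k Γ N P with hQ
    have hdev : ∀ (q : ℕ) (c : ℝ) (φ : Euc n → Euc m → ℝ), PolyLipNoise q c φ →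
        ∫⁻ p, ENNReal.ofReal (truncSq (deviation Γ (k ∘ₘ π) φ p)) ∂Q
          ≤ ENNReal.ofReal (E q c / N) := fun q c φ hφ => by
      refine (forecast_close hφ hd.reg Γ hD hP hmom).trans (ENNReal.ofReal_le_ofReal ?_)
      gcongr
      exact le_abs_self _
    have hstep : enkfLaw k H Γ ρ₀ y N (j + 1) = Q.map fun p i =>
        analysis H (gain H Γ (covMat (empirical p.1))) (y (j + 1)) (p.2 i) (p.1 i) := rfl
    constructor
    · rw [hstep, ← lintegral_one]
      -- This inequality needs no measurability of the update map; only upper bounds matter.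
      refine (lintegral_map_le _ _).trans ?_
      rw [lintegral_one]
      exact forecastLaw_univ_le k Γ hP.1
    intro q f hf
    have hr : 0 ≤ r := (norm_nonneg _).trans (hd.obs 0)
    rw [hstep, mfEnKF, ← hπ]
    refine (lintegral_map_le _ _).trans ?_
    refine (lintegral_mono fun p => ENNReal.ofReal_le_ofReal (truncSq_update_le hf
      (hd.reg.comp_moment (hmom 2)) (hd.reg.comp_moment (hmom (q + 1))) ha hκ hε hκE hgain
      (hd.obs (j + 1)) hN p)).trans ?_
    have mt : ∀ (q : ℕ) (c : ℝ) (φ : Euc n → Euc m → ℝ), PolyLipNoise q c φ →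
        Measurable fun p : (Fin N → Euc n) × (Fin N → Euc m) =>
          truncSq (deviation Γ (k ∘ₘ π) φ p) := fun q c φ hφ =>
      measurable_truncSq.comp (measurable_deviation hφ.1)
    have n1 : ∀ i, PolyLipNoise 0 1 (fun (v : Euc n) (_ : Euc m) => v i) :=
      fun i => (polyLip_coord i).noise
    have n2 : ∀ i l, PolyLipNoise 1 1 (fun (v : Euc n) (_ : Euc m) => v i * v l) :=
      fun i l => (polyLip_coord_mul i l).noise
    have n3 := polyLipNoise_pow (n := n) (m := m) q
    have n4 := hf.analysis (H := H) (hgain (covMat (k ∘ₘ π)) (by simpa using hε.le)).1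
      (hd.obs (j + 1))
    have s1 := lintegral_ofReal_sum_le (Q := Q) Finset.univ (fun i p => truncSq_nonneg _)
      (fun i => mt _ _ _ (n1 i)) (fun _ => div_nonneg (hE0 _ _) hN'.le)
      (fun i => hdev _ _ _ (n1 i))
    have s2' := fun i => lintegral_ofReal_sum_le (Q := Q) Finset.univ (fun l p => truncSq_nonneg _)
      (fun l => mt _ _ _ (n2 i l)) (fun _ => div_nonneg (hE0 _ _) hN'.le)
      (fun l => hdev _ _ _ (n2 i l))
    have s2 := lintegral_ofReal_sum_le (Q := Q) Finset.univ
      (fun i p => Finset.sum_nonneg fun _ _ => truncSq_nonneg _)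
      (fun i => Finset.measurable_fun_sum _ fun l _ => mt _ _ _ (n2 i l))
      (fun _ => Finset.sum_nonneg fun _ _ => div_nonneg (hE0 _ _) hN'.le) s2'
    have s3 := hdev _ _ _ n3
    have s4 := hdev _ _ _ n4
    rw [one_mul] at s4
    have p1 : 0 ≤ ∑ _i : Fin n, E 0 1 / N := Finset.sum_nonneg fun _ _ => div_nonneg (hE0 _ _) hN'.le
    have p2 : 0 ≤ ∑ _i : Fin n, ∑ _l : Fin n, E 1 1 / N :=
      Finset.sum_nonneg fun _ _ => Finset.sum_nonneg fun _ _ => div_nonneg (hE0 _ _) hN'.le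
    have p3 : 0 ≤ E q (q + 1) / N := div_nonneg (hE0 _ _) hN'.le
    have m2 := Finset.measurable_fun_sum Finset.univ fun (i : Fin n) _ =>
      Finset.measurable_fun_sum Finset.univ fun (l : Fin n) _ => mt _ _ _ (n2 i l)
    have s5 := lintegral_ofReal_add_le
      (fun p => Finset.sum_nonneg fun _ _ => Finset.sum_nonneg fun _ _ => truncSq_nonneg _)
      (fun p => truncSq_nonneg _) m2 p2 p3 s2 s3
    have m1 := Finset.measurable_fun_sum Finset.univ fun (i : Fin n) _ => mt _ _ _ (n1 i)
    have s6 := lintegral_ofReal_add_le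
      (fun p => Finset.sum_nonneg fun _ _ => truncSq_nonneg _)
      (fun p => add_nonneg (Finset.sum_nonneg fun _ _ => Finset.sum_nonneg fun _ _ =>
        truncSq_nonneg _) (truncSq_nonneg _)) m1 p1 (add_nonneg p2 p3) s1 s5
    have m6 : Measurable fun p : (Fin N → Euc n) × (Fin N → Euc m) =>
        updateError q Γ (k ∘ₘ π) p := m1.add (m2.add (mt _ _ _ n3))
    have s7 := lintegral_ofReal_mul_le zero_le_two (m6.const_mul _)
      (lintegral_ofReal_mul_le (a := (((2 * analysisConst H a r) ^ (q + 1)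
          * (a * (κ * (2 + 2 * (B 2 * M 2))))
            * (1 + B (q + 1) * M (q + 1) * noiseMoment Γ (q + 1))) ^ 2
          + ((min 1 (ε / (κ * (2 + 2 * (B 2 * M 2))))) ^ 2)⁻¹)) (by positivity) m6 s6)
    have s8 := lintegral_ofReal_mul_le zero_le_two (mt _ _ _ n4) s4
    refine (lintegral_ofReal_add_le (fun p => ?_) (fun p => ?_) ((m6.const_mul _).const_mul _) ?_ ?_
      s7 s8).trans (le_of_eq ?_)
    · have := updateError_nonneg q Γ (k ∘ₘ π) p
      positivity
    · have := truncSq_nonneg (deviation Γ (k ∘ₘ π)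
        (fun v η => f (analysis H (gain H Γ (covMat (k ∘ₘ π))) (y (j + 1)) η v)) p)
      positivity
    · positivity
    · have := hE0 q ((2 * analysisConst H a r) ^ (q + 1))
      positivity
    · congr 1
      simp only [← Finset.sum_div]
      ring

end EnsembleUpdate

/-! ### Cross-covariances of random vectors. -/

section CrossCov

variable {Ω : Type*} [MeasurableSpace Ω] {P : Measure Ω} {a b c : ℕ}

/-- The cross-covariance matrix of two random vectors. -/
def crossCov (P : Measure Ω) (X : Ω → Euc a) (Y : Ω → Euc b) : Matrix (Fin a) (Fin b) ℝ :=
  Matrix.of fun i k => covariance (fun ω => X ω i) (fun ω => Y ω k) P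

lemma memLp_coord {X : Ω → Euc a} {p : ℝ≥0∞} (hX : MemLp X p P) (i : Fin a) :
    MemLp (fun ω => X ω i) p P :=
  (EuclideanSpace.proj i : Euc a →L[ℝ] ℝ).comp_memLp' hX

lemma memLp_toEuclideanLin {X : Ω → Euc a} {p : ℝ≥0∞} (hX : MemLp X p P)
    (A : Matrix (Fin b) (Fin a) ℝ) : MemLp (fun ω => toEuclideanLin A (X ω)) p P :=
  (LinearMap.toContinuousLinearMap (toEuclideanLin A)).comp_memLp' hX

lemma crossCov_transpose (P : Measure Ω) (X : Ω → Euc a) (Y : Ω → Euc b) :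
    (crossCov P X Y)ᵀ = crossCov P Y X := by
  ext i k
  simp [crossCov, covariance_comm]

lemma crossCov_linear_left [IsFiniteMeasure P] {X : Ω → Euc a} {Y : Ω → Euc b} (hX : MemLp X 2 P)
    (hY : MemLp Y 2 P) (A : Matrix (Fin c) (Fin a) ℝ) :
    crossCov P (fun ω => toEuclideanLin A (X ω)) Y = A * crossCov P X Y := by
  ext i k
  simp only [crossCov, of_apply, mul_apply, toLpLin_apply, mulVec, dotProduct]
  rw [covariance_fun_sum_left (fun l => (memLp_coord hX l).const_mul _) (memLp_coord hY k)]
  simp only [covariance_const_mul_left]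

lemma crossCov_linear_right [IsFiniteMeasure P] {X : Ω → Euc a} {Y : Ω → Euc b} (hX : MemLp X 2 P)
    (hY : MemLp Y 2 P) (A : Matrix (Fin c) (Fin b) ℝ) :
    crossCov P X (fun ω => toEuclideanLin A (Y ω)) = crossCov P X Y * Aᵀ := by
  rw [← crossCov_transpose, crossCov_linear_left hY hX, transpose_mul, crossCov_transpose]

lemma crossCov_add_left [IsFiniteMeasure P] {X X' : Ω → Euc a} {Y : Ω → Euc b} (hX : MemLp X 2 P)
    (hX' : MemLp X' 2 P) (hY : MemLp Y 2 P) :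
    crossCov P (fun ω => X ω + X' ω) Y = crossCov P X Y + crossCov P X' Y := by
  ext i k
  exact covariance_add_left (memLp_coord hX i) (memLp_coord hX' i) (memLp_coord hY k)

lemma crossCov_sub_left [IsFiniteMeasure P] {X X' : Ω → Euc a} {Y : Ω → Euc b} (hX : MemLp X 2 P)
    (hX' : MemLp X' 2 P) (hY : MemLp Y 2 P) :
    crossCov P (fun ω => X ω - X' ω) Y = crossCov P X Y - crossCov P X' Y := by
  ext i k
  exact covariance_sub_left (memLp_coord hX i) (memLp_coord hX' i) (memLp_coord hY k)

lemma crossCov_sub_right [IsFiniteMeasure P] {X : Ω → Euc a} {Y Y' : Ω → Euc b} (hX : MemLp X 2 P)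
    (hY : MemLp Y 2 P) (hY' : MemLp Y' 2 P) :
    crossCov P X (fun ω => Y ω - Y' ω) = crossCov P X Y - crossCov P X Y' := by
  rw [← crossCov_transpose, crossCov_sub_left hY hY' hX, transpose_sub, crossCov_transpose,
    crossCov_transpose]

lemma crossCov_add_right [IsFiniteMeasure P] {X : Ω → Euc a} {Y Y' : Ω → Euc b} (hX : MemLp X 2 P)
    (hY : MemLp Y 2 P) (hY' : MemLp Y' 2 P) :
    crossCov P X (fun ω => Y ω + Y' ω) = crossCov P X Y + crossCov P X Y' := by
  rw [← crossCov_transpose, crossCov_add_left hY hY' hX, transpose_add, crossCov_transpose,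
    crossCov_transpose]

lemma crossCov_add_const [IsProbabilityMeasure P] {X : Ω → Euc a} {Y : Ω → Euc b}
    (hX : MemLp X 2 P) (hY : MemLp Y 2 P) (x : Euc a) (y : Euc b) :
    crossCov P (fun ω => X ω + x) (fun ω => Y ω + y) = crossCov P X Y := by
  ext i k
  simp only [crossCov, of_apply, PiLp.add_apply]
  rw [covariance_add_const_left ((memLp_coord hX i).integrable (by norm_num)),
    covariance_add_const_right ((memLp_coord hY k).integrable (by norm_num))]

lemma covMat_map {X : Ω → Euc a} (hX : AEMeasurable X P) : covMat (P.map X) = crossCov P X X := by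
  ext i k
  exact covariance_map_fun (Continuous.aestronglyMeasurable (by fun_prop))
    (Continuous.aestronglyMeasurable (by fun_prop)) hX

end CrossCov

section Product

variable {a b : ℕ} {μ : Measure (Euc a)} {ν : Measure (Euc b)}

lemma memLp_fst [IsProbabilityMeasure ν] (hμ : MemLp id 2 μ) : MemLp (fun p : Euc a × Euc b => p.1) 2 (μ.prod ν) :=
  hμ.comp_fst ν

lemma memLp_snd [IsProbabilityMeasure μ] [SFinite ν] (hν : MemLp id 2 ν) : MemLp (fun p : Euc a × Euc b => p.2) 2 (μ.prod ν) :=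
  hν.comp_snd μ

lemma crossCov_fst_snd [IsProbabilityMeasure μ] [IsProbabilityMeasure ν] (hμ : MemLp id 2 μ) (hν : MemLp id 2 ν) :
    crossCov (μ.prod ν) (fun p => p.1) (fun p => p.2) = 0 := by
  ext i k
  exact covariance_fst_snd_prod (memLp_coord hμ i) (memLp_coord hν k)

lemma crossCov_fst_fst [IsProbabilityMeasure ν] : crossCov (μ.prod ν) (fun p => p.1) (fun p => p.1) = covMat μ := by
  rw [← covMat_map measurable_fst.aemeasurable, Measure.map_fst_prod]
  simp

lemma crossCov_snd_snd [IsProbabilityMeasure μ] [SFinite ν] : crossCov (μ.prod ν) (fun p => p.2) (fun p => p.2) = covMat ν := by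
  rw [← covMat_map measurable_snd.aemeasurable, Measure.map_snd_prod]
  simp

end Product

lemma covMat_multivariateGaussian {n : ℕ} (x : Euc n) {S : Matrix (Fin n) (Fin n) ℝ}
    (hS : S.PosSemidef) : covMat (multivariateGaussian x S) = S := by
  ext i k
  exact covariance_eval_multivariateGaussian hS i k

/-! ### Innovation and residual. -/

section Innovation

variable {n m : ℕ}

/-- The update is affine in the independent pair of forecast and perturbation, so the cross terms
vanish. -/
lemma covMat_linUpdate (H : Matrix (Fin m) (Fin n) ℝ) {Γ : Matrix (Fin m) (Fin m) ℝ}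
    (hΓ : Γ.PosDef) (y : Euc m) (C : Matrix (Fin n) (Fin n) ℝ) (μ : Measure (Euc n))
    [IsProbabilityMeasure μ] (hμ : MemLp id 2 μ) :
    covMat (linUpdate H Γ y C μ) =
      (1 - gain H Γ C * H) * covMat μ * (1 - gain H Γ C * H)ᵀ
        + gain H Γ C * Γ * (gain H Γ C)ᵀ := by
  set A := gain H Γ C
  have hν : MemLp id 2 (multivariateGaussian (0 : Euc m) Γ) := IsGaussian.memLp_id _ 2 (by simp)
  have h1 := memLp_fst (ν := multivariateGaussian (0 : Euc m) Γ) hμ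
  have h2 := memLp_snd (μ := μ) hν
  have h3 := memLp_toEuclideanLin h1 (1 - A * H)
  have h4 := memLp_toEuclideanLin h2 A
  have e : (fun p : Euc n × Euc m => analysis H A y p.2 p.1) = fun p =>
      (toEuclideanLin (1 - A * H) p.1 + toEuclideanLin A p.2) + toEuclideanLin A y := by
    funext p
    simp only [analysis, map_add, map_sub, LinearMap.sub_apply]
    rw [show toEuclideanLin (A * H) p.1 = toEuclideanLin A (toEuclideanLin H p.1) by
      simp [toLpLin_apply], show toEuclideanLin (1 : Matrix (Fin n) (Fin n) ℝ) p.1 = p.1 by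
      simp]
    abel
  have h5 : MemLp (fun p : Euc n × Euc m =>
      toEuclideanLin (1 - A * H) p.1 + toEuclideanLin A p.2) 2
      (μ.prod (multivariateGaussian (0 : Euc m) Γ)) := h3.add h4
  rw [linUpdate, covMat_map (measurable_analysis H A y).aemeasurable, e,
    crossCov_add_const h5 h5, crossCov_add_left h3 h4 h5, crossCov_add_right h3 h3 h4,
    crossCov_add_right h4 h3 h4, crossCov_linear_left h1 h3, crossCov_linear_left h1 h4,
    crossCov_linear_left h2 h3, crossCov_linear_left h2 h4, crossCov_linear_right h1 h1,
    crossCov_linear_right h1 h2, crossCov_linear_right h2 h1, crossCov_linear_right h2 h2,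
    crossCov_fst_fst, crossCov_snd_snd, crossCov_fst_snd hμ hν,
    ← crossCov_transpose _ (fun p : Euc n × Euc m => p.1), crossCov_fst_snd hμ hν,
    covMat_multivariateGaussian _ hΓ.posSemidef]
  simp [Matrix.mul_assoc]

/-- These normal equations make the residual `v - A (H v - η)` uncorrelated with the innovation `H v
- η`. -/
lemma innovation_orthogonal (H : Matrix (Fin m) (Fin n) ℝ) {Γ : Matrix (Fin m) (Fin m) ℝ}
    (hΓ : Γ.PosDef) {C : Matrix (Fin n) (Fin n) ℝ} (hC : C.PosSemidef) :
    gain H Γ C * (H * C * Hᵀ + Γ) = C * Hᵀ := by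
  have h : (H * C * Hᵀ + Γ).PosDef := by
    have := hC.mul_mul_conjTranspose_same H
    rw [conjTranspose_eq_transpose_of_trivial] at this
    exact PosDef.posSemidef_add this hΓ
  rw [gain, Matrix.mul_assoc, nonsing_inv_mul _ ((isUnit_iff_isUnit_det _).1 h.isUnit),
    Matrix.mul_one]

/-- Gaussian forecast: the innovation `H v - η` is independent of the residual. -/
lemma indepFun_innovation (H : Matrix (Fin m) (Fin n) ℝ) {Γ : Matrix (Fin m) (Fin m) ℝ}
    (hΓ : Γ.PosDef) (μ : Measure (Euc n)) [IsGaussian μ] (hC : (covMat μ).PosSemidef) :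
    IndepFun (fun p : Euc n × Euc m => p.1 - toEuclideanLin (gain H Γ (covMat μ))
        (toEuclideanLin H p.1 - p.2))
      (fun p => toEuclideanLin H p.1 - p.2) (μ.prod (multivariateGaussian 0 Γ)) := by
  set A := gain H Γ (covMat μ)
  set ν := multivariateGaussian (0 : Euc m) Γ
  have hμ : MemLp id 2 μ := IsGaussian.memLp_id _ 2 (by simp)
  have hν : MemLp id 2 ν := IsGaussian.memLp_id _ 2 (by simp)
  have h1 := memLp_fst (ν := ν) hμ
  have h2 := memLp_snd (μ := μ) hν
  have h3 : MemLp (fun p : Euc n × Euc m => toEuclideanLin H p.1 - p.2) 2 (μ.prod ν) :=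
    (memLp_toEuclideanLin h1 H).sub h2
  have h4 := memLp_toEuclideanLin h3 A
  have hid : HasGaussianLaw (id : Euc n × Euc m → Euc n × Euc m) (μ.prod ν) :=
    IsGaussian.hasGaussianLaw_id
  have hG := hid.map_fun
    ((ContinuousLinearMap.fst ℝ (Euc n) (Euc m) -
      (LinearMap.toContinuousLinearMap (toEuclideanLin A)).comp
        ((LinearMap.toContinuousLinearMap (toEuclideanLin H)).comp
          (ContinuousLinearMap.fst ℝ (Euc n) (Euc m)) -
          ContinuousLinearMap.snd ℝ (Euc n) (Euc m))).prod
      ((LinearMap.toContinuousLinearMap (toEuclideanLin H)).comp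
          (ContinuousLinearMap.fst ℝ (Euc n) (Euc m)) -
          ContinuousLinearMap.snd ℝ (Euc n) (Euc m)))
  have hR : MemLp (fun p : Euc n × Euc m => p.1 - toEuclideanLin A
      (toEuclideanLin H p.1 - p.2)) 2 (μ.prod ν) := h1.sub h4
  have hzero : crossCov (μ.prod ν) (fun p => p.1 - toEuclideanLin A (toEuclideanLin H p.1 - p.2))
      (fun p => toEuclideanLin H p.1 - p.2) = 0 := by
    have h0 := crossCov_fst_snd (μ := μ) (ν := ν) hμ hν
    have h0' : crossCov (μ.prod ν) (fun p => p.2) (fun p => p.1) = 0 := by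
      rw [← crossCov_transpose, h0, transpose_zero]
    have hH := memLp_toEuclideanLin h1 H
    rw [crossCov_sub_left h1 h4 h3, crossCov_linear_left h3 h3, crossCov_sub_left hH h2 h3,
      crossCov_sub_right h1 hH h2, crossCov_linear_left h1 h3, crossCov_sub_right h1 hH h2,
      crossCov_sub_right h2 hH h2, crossCov_linear_right h1 h1, crossCov_linear_right h2 h1,
      h0, h0', crossCov_fst_fst, crossCov_snd_snd,
      covMat_multivariateGaussian _ hΓ.posSemidef, Matrix.zero_mul, sub_zero, zero_sub, sub_neg_eq_add,
      ← Matrix.mul_assoc, innovation_orthogonal H hΓ hC, sub_self]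
  -- Jointly Gaussian vectors are independent once they are uncorrelated.
  refine HasGaussianLaw.indepFun_of_covariance_inner hG fun x z => ?_
  have e1 : ∀ (k : ℕ) (X : Euc n × Euc m → Euc k) (w : Euc k),
      (fun p => inner ℝ w (X p)) = fun p => ∑ i, w i * X p i := by
    intro k X w
    funext p
    simp [PiLp.inner_apply, mul_comm]
  change covariance (fun p => inner ℝ x (p.1 - toEuclideanLin A (toEuclideanLin H p.1 - p.2)))
    (fun p => inner ℝ z (toEuclideanLin H p.1 - p.2)) (μ.prod ν) = 0
  rw [e1 n, e1 m, covariance_fun_sum_fun_sum (fun i => (memLp_coord hR i).const_mul _)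
    (fun i => (memLp_coord h3 i).const_mul _)]
  refine Finset.sum_eq_zero fun i _ => Finset.sum_eq_zero fun k _ => ?_
  rw [covariance_const_mul_left, covariance_const_mul_right]
  have := congrFun (congrFun hzero i) k
  simp only [crossCov, of_apply, Matrix.zero_apply] at this
  rw [this]
  simp

end Innovation

/-! ### The density of the standard Gaussian. -/

section Density

variable {n m : ℕ}

/-- The unnormalised standard Gaussian density. -/
def gaussWeight (x : Euc m) : ℝ := Real.exp (-(1 / 2) * ‖x‖ ^ 2)

lemma continuous_gaussWeight : Continuous (gaussWeight (m := m)) := by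
  unfold gaussWeight; fun_prop

lemma gaussWeight_pos (x : Euc m) : 0 < gaussWeight x := Real.exp_pos _

lemma gaussWeight_le_one (x : Euc m) : gaussWeight x ≤ 1 := by
  rw [gaussWeight, Real.exp_le_one_iff]
  nlinarith [sq_nonneg ‖x‖]

lemma gaussWeight_sub_comm (x z : Euc m) : gaussWeight (x - z) = gaussWeight (z - x) := by
  rw [gaussWeight, gaussWeight, norm_sub_rev]

lemma integrable_gaussWeight : Integrable (gaussWeight (m := m)) := by
  have h := (GaussianFourier.integrable_cexp_neg_mul_sq_norm_add (V := Euc m)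
    (show 0 < ((1 / 2 : ℝ) : ℂ).re by norm_num) 0 0).re
  refine h.congr (Filter.Eventually.of_forall fun x => ?_)
  simp only [zero_mul, add_zero, gaussWeight]
  rw [show -((1 / 2 : ℝ) : ℂ) * (‖x‖ : ℂ) ^ 2 = ((-(1 / 2) * ‖x‖ ^ 2 : ℝ) : ℂ) by push_cast; ring]
  exact Complex.exp_ofReal_re _

lemma integral_gaussWeight_pos : 0 < ∫ x : Euc m, gaussWeight x := by
  rw [integral_pos_iff_support_of_nonneg (fun x => (gaussWeight_pos x).le) integrable_gaussWeight]
  have : Function.support (gaussWeight (m := m)) = Set.univ := by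
    ext x; simp [(gaussWeight_pos x).ne']
  rw [this]
  exact (Measure.measure_univ_pos (μ := (volume : Measure (Euc m)))).2 (NeZero.ne _)

/-- Both sides have the same characteristic function; the Fourier integral at `0` identifies the
normalising constant. -/
lemma stdGaussian_eq_withDensity : stdGaussian (Euc m) =
    ENNReal.ofReal (∫ x : Euc m, gaussWeight x)⁻¹ •
      (volume : Measure (Euc m)).withDensity (fun x => ENNReal.ofReal (gaussWeight x)) := by
  have hi := integrable_gaussWeight (m := m)
  have hpos := integral_gaussWeight_pos (m := m)
  have : IsFiniteMeasure ((volume : Measure (Euc m)).withDensity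
      (fun x => ENNReal.ofReal (gaussWeight x))) := isFiniteMeasure_withDensity_ofReal hi.2
  have : IsFiniteMeasure (ENNReal.ofReal (∫ x : Euc m, gaussWeight x)⁻¹ •
      (volume : Measure (Euc m)).withDensity (fun x => ENNReal.ofReal (gaussWeight x))) :=
    Measure.smul_finite _ ENNReal.ofReal_ne_top
  refine Measure.ext_of_charFun (funext fun t => ?_)
  have key : ∀ w : Euc m, ∫ x : Euc m, (gaussWeight x : ℂ) * Complex.exp (inner ℝ x w * Complex.I)
      = (Real.pi / ((1 / 2 : ℝ) : ℂ)) ^ (Module.finrank ℝ (Euc m) / 2 : ℂ) *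
        Complex.exp (-‖w‖ ^ 2 / 2) := by
    intro w
    have h := GaussianFourier.integral_cexp_neg_mul_sq_norm_add (V := Euc m)
      (show 0 < ((1 / 2 : ℝ) : ℂ).re by norm_num) Complex.I w
    convert! h using 2
    · funext x
      rw [Complex.exp_add, gaussWeight, Complex.ofReal_exp, real_inner_comm x w]
      push_cast
      ring_nf
    · rw [Complex.I_sq]; push_cast; ring_nf
  have h0 : ((∫ x : Euc m, gaussWeight x : ℝ) : ℂ) =
      (Real.pi / ((1 / 2 : ℝ) : ℂ)) ^ (Module.finrank ℝ (Euc m) / 2 : ℂ) := by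
    have := key 0
    simp only [inner_zero_right, Complex.ofReal_zero, zero_mul, Complex.exp_zero, mul_one,
      norm_zero] at this
    rw [← integral_complex_ofReal, this]
    simp
  rw [charFun_stdGaussian, charFun_apply, integral_smul_measure,
    integral_withDensity_eq_integral_toReal_smul (by
      exact (continuous_gaussWeight.measurable).ennreal_ofReal)
      (Filter.Eventually.of_forall fun _ => ENNReal.ofReal_lt_top)]
  simp only [ENNReal.toReal_ofReal (gaussWeight_pos _).le, Complex.real_smul]
  rw [key, ← h0, ENNReal.toReal_ofReal (inv_pos.2 hpos).le]
  push_cast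
  rw [← mul_assoc, inv_mul_cancel₀, one_mul]
  exact_mod_cast hpos.ne'

lemma exists_integral_stdGaussian (m : ℕ) : ∃ c : ℝ, 0 < c ∧ ∀ f : Euc m → ℝ,
    ∫ x, f x ∂(stdGaussian (Euc m)) = c * ∫ x, gaussWeight x * f x := by
  refine ⟨(∫ x : Euc m, gaussWeight x)⁻¹, inv_pos.2 integral_gaussWeight_pos, fun f => ?_⟩
  rw [stdGaussian_eq_withDensity, integral_smul_measure,
    integral_withDensity_eq_integral_toReal_smul (by
      exact (continuous_gaussWeight.measurable).ennreal_ofReal)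
      (Filter.Eventually.of_forall fun _ => ENNReal.ofReal_lt_top)]
  simp only [ENNReal.toReal_ofReal (gaussWeight_pos _).le, smul_eq_mul,
    ENNReal.toReal_ofReal (inv_pos.2 integral_gaussWeight_pos).le]

lemma integrable_gaussWeight_prod (μ : Measure (Euc n)) [IsProbabilityMeasure μ]
    {T : Euc n → Euc m} (hT : Continuous T) :
    Integrable (fun p : Euc n × Euc m => gaussWeight (p.2 - T p.1)) (μ.prod volume) := by
  have hc : Continuous (fun p : Euc n × Euc m => gaussWeight (p.2 - T p.1)) :=
    continuous_gaussWeight.comp (by fun_prop)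
  rw [integrable_prod_iff hc.aestronglyMeasurable]
  refine ⟨Filter.Eventually.of_forall fun v => integrable_gaussWeight.comp_sub_right (T v), ?_⟩
  have : (fun v => ∫ z, ‖gaussWeight (z - T v)‖) = fun _ => ∫ z : Euc m, ‖gaussWeight z‖ := by
    funext v
    exact integral_sub_right_eq_self (fun z : Euc m => ‖gaussWeight z‖) (T v)
  rw [this]
  exact integrable_const _

/-- The law of `T v - ξ` with a standard Gaussian `ξ`, in terms of the density. -/
lemma integral_prod_stdGaussian {c : ℝ} (hc : ∀ f : Euc m → ℝ,
      ∫ x, f x ∂(stdGaussian (Euc m)) = c * ∫ x, gaussWeight x * f x)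
    (μ : Measure (Euc n)) [IsProbabilityMeasure μ] {T : Euc n → Euc m} (hT : Continuous T)
    {φ : Euc n → ℝ} (hφ : Measurable φ) {ψ : Euc m → ℝ} (hψ : Measurable ψ) {s t : ℝ}
    (hs : ∀ v, |φ v| ≤ s) (ht : ∀ z, |ψ z| ≤ t) :
    ∫ p, φ p.1 * ψ (T p.1 - p.2) ∂(μ.prod (stdGaussian (Euc m))) =
      c * ∫ z, ψ z * ∫ v, gaussWeight (z - T v) * φ v ∂μ := by
  have hi : Integrable (fun p : Euc n × Euc m => φ p.1 * ψ (T p.1 - p.2))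
      (μ.prod (stdGaussian (Euc m))) := by
    refine Integrable.of_bound (C := s * t)
      (by have : Measurable T := hT.measurable
          exact Measurable.aestronglyMeasurable (by fun_prop)) (Filter.Eventually.of_forall fun p => ?_)
    rw [norm_mul]
    exact mul_le_mul (hs _) (ht _) (norm_nonneg _) ((abs_nonneg _).trans (hs p.1))
  have hj : Integrable (fun p : Euc n × Euc m => φ p.1 * ψ p.2 * gaussWeight (p.2 - T p.1))
      (μ.prod volume) := by
    refine (integrable_gaussWeight_prod μ hT).bdd_mul (c := s * t) (by fun_prop)
      (Filter.Eventually.of_forall fun p => ?_)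
    rw [norm_mul]
    exact mul_le_mul (hs _) (ht _) (norm_nonneg _) ((abs_nonneg _).trans (hs p.1))
  -- Substitution `z = T v - x`, together with the evenness of the density.
  have e : ∀ v, ∫ x, φ v * ψ (T v - x) ∂(stdGaussian (Euc m)) =
      c * ∫ z, φ v * ψ z * gaussWeight (z - T v) := by
    intro v
    rw [hc]
    congr 1
    rw [← integral_sub_left_eq_self (fun z => φ v * ψ z * gaussWeight (z - T v)) volume (T v)]
    refine integral_congr_ae (Filter.Eventually.of_forall fun x => ?_)
    simp only
    rw [gaussWeight_sub_comm (T v - x), sub_sub_cancel]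
    ring
  rw [integral_prod _ hi]
  simp only [e]
  rw [integral_const_mul, integral_integral_swap hj]
  congr 1
  refine integral_congr_ae (Filter.Eventually.of_forall fun z => ?_)
  simp only
  rw [← integral_const_mul]
  refine integral_congr_ae (Filter.Eventually.of_forall fun v => ?_)
  simp only
  ring

end Density

/-! ### Conditioning on the innovation. -/

section Conditional

variable {n m : ℕ}

lemma continuous_integral_gaussWeight (μ : Measure (Euc n)) [IsProbabilityMeasure μ]
    {T : Euc n → Euc m} (hT : Continuous T) {φ : Euc n → ℝ} (hφ : Measurable φ) {s : ℝ}
    (hs : ∀ v, |φ v| ≤ s) :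
    Continuous (fun z => ∫ v, gaussWeight (z - T v) * φ v ∂μ) := by
  refine continuous_of_dominated (bound := fun _ => s) (fun z => ?_) (fun z => ?_)
    (integrable_const _) (Filter.Eventually.of_forall fun v => ?_)
  · have : Measurable (fun v => gaussWeight (z - T v)) :=
      (continuous_gaussWeight.comp (by fun_prop)).measurable
    exact (this.mul hφ).aestronglyMeasurable
  · refine Filter.Eventually.of_forall fun v => ?_
    rw [norm_mul, Real.norm_of_nonneg (gaussWeight_pos _).le]
    exact (mul_le_mul (gaussWeight_le_one _) (hs v) (abs_nonneg _) zero_le_one).trans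
      (one_mul s).le
  · exact (continuous_gaussWeight.comp (by fun_prop)).mul_const _

/-- If `v = R + B Z` with `R` independent of `Z = T v - ξ`, then the law of `v` weighted with the
density of `Z` at `z` is a multiple of the law of `R + B z`. -/
lemma integral_gaussWeight_mul_of_indepFun (μ : Measure (Euc n)) [IsProbabilityMeasure μ]
    {T : Euc n → Euc m} (hT : Continuous T) {R : Euc n × Euc m → Euc n} (hR : Measurable R)
    {B : Euc m → Euc n} (hB : Continuous B) (hRB : ∀ p, p.1 = R p + B (T p.1 - p.2))
    (hind : IndepFun R (fun p => T p.1 - p.2) (μ.prod (stdGaussian (Euc m))))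
    {φ : Euc n → ℝ} (hφ : Continuous φ) {s : ℝ} (hs : ∀ v, |φ v| ≤ s) (z : Euc m) :
    ∫ v, gaussWeight (z - T v) * φ v ∂μ = (∫ v, gaussWeight (z - T v) ∂μ) *
      ∫ p, φ (R p + B z) ∂(μ.prod (stdGaussian (Euc m))) := by
  obtain ⟨c, hc0, hc⟩ := exists_integral_stdGaussian m
  set P := μ.prod (stdGaussian (Euc m))
  set Φ : Euc m → ℝ := fun z => ∫ p, φ (R p + B z) ∂P with hΦ
  have hΦs : ∀ z, |Φ z| ≤ s := fun z => by
    refine (norm_integral_le_of_norm_le_const (μ := P) (f := fun p => φ (R p + B z)) (C := s)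
      (Filter.Eventually.of_forall fun p => hs _)).trans ?_
    simp
  have hΦc : Continuous Φ := by
    refine continuous_of_dominated (bound := fun _ => s) (fun z => ?_)
      (fun z => Filter.Eventually.of_forall fun p => hs _)
      (integrable_const _) (Filter.Eventually.of_forall fun v => by fun_prop)
    exact (hφ.measurable.comp (by fun_prop)).aestronglyMeasurable
  have hone : ∀ v : Euc n, |(fun _ => (1 : ℝ)) v| ≤ 1 := fun v => by simp
  have hLc := continuous_integral_gaussWeight μ hT hφ.measurable hs
  have hGc := continuous_integral_gaussWeight μ hT measurable_const hone
  simp only [mul_one] at hGc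
  have hswap := (integrable_gaussWeight_prod μ hT).swap.integral_prod_left
  have hLi : Integrable (fun z => ∫ v, gaussWeight (z - T v) * φ v ∂μ) volume := by
    have : Integrable (fun p : Euc n × Euc m => gaussWeight (p.2 - T p.1) * φ p.1)
        (μ.prod volume) :=
      (integrable_gaussWeight_prod μ hT).mul_bdd (c := s)
        (hφ.comp continuous_fst).aestronglyMeasurable (Filter.Eventually.of_forall fun p => hs _)
    exact this.swap.integral_prod_left
  have hGi : Integrable (fun z => ∫ v, gaussWeight (z - T v) ∂μ) volume := hswap
  have hGΦi : Integrable (fun z => (∫ v, gaussWeight (z - T v) ∂μ) * Φ z) volume :=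
    hGi.mul_bdd (c := s) hΦc.aestronglyMeasurable (Filter.Eventually.of_forall fun p => hΦs _)
  have hZ : Measurable (fun p : Euc n × Euc m => T p.1 - p.2) := by fun_prop
  -- Both sides compute the mean of `φ(v) ψ(Z)`: the left one from the density of `Z` given `v`, the
  -- right one by averaging `φ(R + B Z)` over `R` first, which independence permits.
  have hset : ∀ ψ : Euc m → ℝ, Measurable ψ → (∀ z, |ψ z| ≤ 1) →
      ∫ z, ψ z * ∫ v, gaussWeight (z - T v) * φ v ∂μ =
        ∫ z, ψ z * ((∫ v, gaussWeight (z - T v) ∂μ) * Φ z) := by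
    intro ψ hψ hψ1
    have h1 := integral_prod_stdGaussian hc μ hT hφ.measurable hψ hs hψ1
    have h2 := integral_prod_stdGaussian hc μ hT measurable_const (hψ.mul hΦc.measurable) hone
      (t := 1 * s) (fun z => by
        rw [Pi.mul_apply, abs_mul]
        exact mul_le_mul (hψ1 z) (hΦs z) (abs_nonneg _) zero_le_one)
    have h3 : ∫ p, φ p.1 * ψ (T p.1 - p.2) ∂P = ∫ p, 1 * (ψ * Φ) (T p.1 - p.2) ∂P := by
      have hm : Measurable (fun q : Euc n × Euc m => φ (q.1 + B q.2) * ψ q.2) := by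
        have := hφ.measurable
        have := hB.measurable
        fun_prop
      have : IsProbabilityMeasure (P.map R) := Measure.isProbabilityMeasure_map hR.aemeasurable
      have : IsProbabilityMeasure (P.map fun p => T p.1 - p.2) :=
        Measure.isProbabilityMeasure_map hZ.aemeasurable
      have hprod := (indepFun_iff_map_prod_eq_prod_map_map hR.aemeasurable hZ.aemeasurable).1 hind
      calc ∫ p, φ p.1 * ψ (T p.1 - p.2) ∂P
          = ∫ p, φ (R p + B (T p.1 - p.2)) * ψ (T p.1 - p.2) ∂P := by
            refine integral_congr_ae (Filter.Eventually.of_forall fun p => ?_)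
            simp only
            rw [← hRB p]
        _ = ∫ q, φ (q.1 + B q.2) * ψ q.2 ∂((P.map R).prod (P.map fun p => T p.1 - p.2)) := by
            rw [← hprod, integral_map (by fun_prop) hm.aestronglyMeasurable]
        _ = ∫ z, ∫ x, φ (x + B z) * ψ z ∂(P.map R) ∂(P.map fun p => T p.1 - p.2) := by
            rw [integral_prod_symm _ ?_]
            refine Integrable.of_bound (C := s * 1) hm.aestronglyMeasurable
              (Filter.Eventually.of_forall fun q => ?_)
            rw [norm_mul]
            exact mul_le_mul (hs _) (hψ1 _) (norm_nonneg _) ((abs_nonneg _).trans (hs q.1))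
        _ = ∫ p, 1 * (ψ * Φ) (T p.1 - p.2) ∂P := by
            rw [integral_map (by fun_prop)]
            · refine integral_congr_ae (Filter.Eventually.of_forall fun p => ?_)
              simp only
              rw [integral_mul_const, integral_map hR.aemeasurable, one_mul, Pi.mul_apply, mul_comm]
              exact (hφ.comp (by fun_prop)).aestronglyMeasurable
            · refine (Measurable.stronglyMeasurable ?_).aestronglyMeasurable
              exact (StronglyMeasurable.integral_prod_left' (μ := P.map R)
                hm.stronglyMeasurable).measurable
    rw [h1, h2] at h3
    simp only [mul_one, Pi.mul_apply] at h3
    have h4 := mul_left_cancel₀ hc0.ne' h3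
    rw [h4]
    refine integral_congr_ae (Filter.Eventually.of_forall fun z => ?_)
    simp only
    ring
  -- Indicators as `ψ` give equality almost everywhere. Both sides are continuous in `z`, so it
  -- holds at every `z`, as conditioning on one given observation requires.
  have hae : (fun z => ∫ v, gaussWeight (z - T v) * φ v ∂μ) =ᵐ[volume]
      fun z => (∫ v, gaussWeight (z - T v) ∂μ) * Φ z := by
    refine Integrable.ae_eq_of_forall_setIntegral_eq _ _ hLi hGΦi fun S hS _ => ?_
    have h := hset (S.indicator fun _ => 1) (measurable_const.indicator hS) (fun z => by
      by_cases hz : z ∈ S <;> simp [hz])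
    rw [← integral_indicator hS, ← integral_indicator hS]
    convert h using 2 <;>
    · funext z
      by_cases hz : z ∈ S <;> simp [hz]
  exact congrFun ((hLc.ae_eq_iff_eq volume (hGc.mul hΦc)).1 hae) z

end Conditional

/-! ### The Bayes update and its Gaussian case. -/

section Bayes

open scoped MatrixOrder Matrix.Norms.L2Operator

variable {n m : ℕ}

lemma continuous_likelihood (H : Matrix (Fin m) (Fin n) ℝ) (Γ : Matrix (Fin m) (Fin m) ℝ)
    (y : Euc m) : Continuous (fun u => likelihood H Γ u y) := by
  have h : Continuous fun u : Euc n => (y - toEuclideanLin H u).ofLp := by fun_prop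
  unfold likelihood
  exact Real.continuous_exp.comp (continuous_const.mul
    (h.dotProduct (Continuous.matrix_mulVec continuous_const h)))

lemma likelihood_pos (H : Matrix (Fin m) (Fin n) ℝ) (Γ : Matrix (Fin m) (Fin m) ℝ)
    (u : Euc n) (y : Euc m) : 0 < likelihood H Γ u y := Real.exp_pos _

lemma likelihood_le_one (H : Matrix (Fin m) (Fin n) ℝ) {Γ : Matrix (Fin m) (Fin m) ℝ}
    (hΓ : Γ.PosDef) (u : Euc n) (y : Euc m) : likelihood H Γ u y ≤ 1 := by
  rw [likelihood, Real.exp_le_one_iff]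
  have := hΓ.inv.posSemidef.dotProduct_mulVec_nonneg (y - toEuclideanLin H u).ofLp
  simp only [star_trivial] at this
  linarith

lemma integrable_likelihood (H : Matrix (Fin m) (Fin n) ℝ) {Γ : Matrix (Fin m) (Fin m) ℝ}
    (hΓ : Γ.PosDef) (y : Euc m) (μ : Measure (Euc n)) [IsProbabilityMeasure μ] :
    Integrable (fun u => likelihood H Γ u y) μ :=
  Integrable.of_bound (C := 1) (continuous_likelihood H Γ y).aestronglyMeasurable
    (Filter.Eventually.of_forall fun u => by
      rw [Real.norm_of_nonneg (likelihood_pos H Γ u y).le]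
      exact likelihood_le_one H hΓ u y)

lemma integral_likelihood_pos (H : Matrix (Fin m) (Fin n) ℝ) {Γ : Matrix (Fin m) (Fin m) ℝ}
    (hΓ : Γ.PosDef) (y : Euc m) (μ : Measure (Euc n)) [IsProbabilityMeasure μ] :
    0 < ∫ u, likelihood H Γ u y ∂μ := by
  rw [integral_pos_iff_support_of_nonneg (fun u => (likelihood_pos H Γ u y).le)
    (integrable_likelihood H hΓ y μ)]
  have : Function.support (fun u => likelihood H Γ u y) = Set.univ := by
    ext x; simp [(likelihood_pos H Γ x y).ne']
  rw [this]
  simp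

lemma lintegral_likelihood (H : Matrix (Fin m) (Fin n) ℝ) {Γ : Matrix (Fin m) (Fin m) ℝ}
    (hΓ : Γ.PosDef) (y : Euc m) (μ : Measure (Euc n)) [IsProbabilityMeasure μ] :
    ∫⁻ u, ENNReal.ofReal (likelihood H Γ u y) ∂μ =
      ENNReal.ofReal (∫ u, likelihood H Γ u y ∂μ) :=
  (ofReal_integral_eq_lintegral_ofReal (integrable_likelihood H hΓ y μ)
    (Filter.Eventually.of_forall fun u => (likelihood_pos H Γ u y).le)).symm

lemma isProbabilityMeasure_bayes (H : Matrix (Fin m) (Fin n) ℝ) {Γ : Matrix (Fin m) (Fin m) ℝ}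
    (hΓ : Γ.PosDef) (y : Euc m) (μ : Measure (Euc n)) [IsProbabilityMeasure μ] :
    IsProbabilityMeasure (bayes H Γ y μ) := by
  refine ⟨?_⟩
  rw [bayes, Measure.smul_apply, withDensity_apply _ MeasurableSet.univ, Measure.restrict_univ,
    smul_eq_mul, lintegral_likelihood H hΓ]
  exact ENNReal.inv_mul_cancel
    (ENNReal.ofReal_pos.2 (integral_likelihood_pos H hΓ y μ)).ne' ENNReal.ofReal_ne_top

lemma integral_bayes (H : Matrix (Fin m) (Fin n) ℝ) {Γ : Matrix (Fin m) (Fin m) ℝ}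
    (hΓ : Γ.PosDef) (y : Euc m) (μ : Measure (Euc n)) [IsProbabilityMeasure μ] (f : Euc n → ℝ) :
    ∫ u, f u ∂(bayes H Γ y μ) =
      (∫ u, likelihood H Γ u y ∂μ)⁻¹ * ∫ u, likelihood H Γ u y * f u ∂μ := by
  rw [bayes, integral_smul_measure, lintegral_likelihood H hΓ,
    integral_withDensity_eq_integral_toReal_smul
      ((continuous_likelihood H Γ y).measurable.ennreal_ofReal)
      (Filter.Eventually.of_forall fun _ => ENNReal.ofReal_lt_top), ENNReal.toReal_inv,
    ENNReal.toReal_ofReal (integral_likelihood_pos H hΓ y μ).le]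
  simp only [ENNReal.toReal_ofReal (likelihood_pos _ _ _ _).le, smul_eq_mul]

/-- A symmetric square root of a positive definite matrix. -/
lemma exists_sqrt_posDef {Γ : Matrix (Fin m) (Fin m) ℝ} (hΓ : Γ.PosDef) :
    CFC.sqrt Γ * CFC.sqrt Γ = Γ ∧ (CFC.sqrt Γ)ᵀ = CFC.sqrt Γ ∧ IsUnit (CFC.sqrt Γ).det := by
  have h1 : CFC.sqrt Γ * CFC.sqrt Γ = Γ := by
    have := CFC.sqrt_mul_sqrt_self Γ hΓ.posSemidef.nonneg
    exact this
  refine ⟨h1, ?_, ?_⟩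
  · have h := (CFC.sqrt_nonneg Γ)
    have := (Matrix.nonneg_iff_posSemidef.1 h).isHermitian
    rw [← conjTranspose_eq_transpose_of_trivial]
    exact this
  · have h2 : IsUnit Γ.det := (isUnit_iff_isUnit_det _).1 hΓ.isUnit
    rw [← h1, det_mul] at h2
    exact isUnit_of_mul_isUnit_left h2

/-- Whitening with the square root of `Γ` reduces the observation noise to the standard Gaussian. -/
lemma likelihood_eq_gaussWeight (H : Matrix (Fin m) (Fin n) ℝ) {Γ : Matrix (Fin m) (Fin m) ℝ}
    (hΓ : Γ.PosDef) (u : Euc n) (y : Euc m) :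
    likelihood H Γ u y = gaussWeight (toEuclideanLin (CFC.sqrt Γ)⁻¹ y -
      toEuclideanLin (CFC.sqrt Γ)⁻¹ (toEuclideanLin H u)) := by
  obtain ⟨h1, h2, h3⟩ := exists_sqrt_posDef hΓ
  set S := CFC.sqrt Γ
  rw [likelihood, gaussWeight, ← map_sub]
  set w := y - toEuclideanLin H u
  congr 2
  have h4 : Γ⁻¹ = (S⁻¹)ᵀ * S⁻¹ := by
    rw [transpose_nonsing_inv, h2, ← Matrix.mul_inv_rev, h1]
  rw [h4, ← mulVec_mulVec, dotProduct_mulVec, vecMul_transpose, EuclideanSpace.norm_sq_eq]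
  simp [dotProduct, toLpLin_apply, sq]

/-- For a Gaussian forecast the perturbed-observation update is the Bayes update. -/
theorem bayes_eq_linUpdate (H : Matrix (Fin m) (Fin n) ℝ) {Γ : Matrix (Fin m) (Fin m) ℝ}
    (hΓ : Γ.PosDef) (y : Euc m) (μ : Measure (Euc n)) [IsGaussian μ]
    (hC : (covMat μ).PosSemidef) : bayes H Γ y μ = linUpdate H Γ y (covMat μ) μ := by
  obtain ⟨h1, h2, h3⟩ := exists_sqrt_posDef hΓ
  have hind := indepFun_innovation H hΓ μ hC
  set A := gain H Γ (covMat μ) with hA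
  set S := CFC.sqrt Γ with hS
  have hSS : ∀ w : Euc m, toEuclideanLin S (toEuclideanLin S⁻¹ w) = w := fun w => by
    simp [toLpLin_apply, mul_nonsing_inv _ h3]
  have hSS' : ∀ w : Euc m, toEuclideanLin S⁻¹ (toEuclideanLin S w) = w := fun w => by
    simp [toLpLin_apply, nonsing_inv_mul _ h3]
  have hSc : Continuous (toEuclideanLin S) := (toEuclideanLin S).continuous_of_finiteDimensional
  have hSc' : Continuous (toEuclideanLin S⁻¹) :=
    (toEuclideanLin S⁻¹).continuous_of_finiteDimensional
  have hAc : Continuous (toEuclideanLin A) := (toEuclideanLin A).continuous_of_finiteDimensional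
  have hHc : Continuous (toEuclideanLin H) := (toEuclideanLin H).continuous_of_finiteDimensional
  have hnoise : multivariateGaussian (0 : Euc m) Γ =
      (stdGaussian (Euc m)).map (toEuclideanLin S) := by
    rw [multivariateGaussian]
    congr 1
    funext x
    rw [zero_add]
    rfl
  have hprod : μ.prod (multivariateGaussian (0 : Euc m) Γ) =
      (μ.prod (stdGaussian (Euc m))).map (Prod.map id (toEuclideanLin S)) := by
    rw [hnoise, ← Measure.map_prod_map _ _ measurable_id hSc.measurable, Measure.map_id]
  have hem : Measurable (Prod.map id (toEuclideanLin S) : Euc n × Euc m → Euc n × Euc m) :=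
    measurable_id.prodMap hSc.measurable
  have hRm : Measurable (fun p : Euc n × Euc m =>
      p.1 - toEuclideanLin A (toEuclideanLin H p.1 - p.2)) := by fun_prop
  have hZm : Measurable (fun p : Euc n × Euc m => toEuclideanLin H p.1 - p.2) := by fun_prop
  have hind' : IndepFun (fun p : Euc n × Euc m =>
        p.1 - toEuclideanLin A (toEuclideanLin H p.1 - toEuclideanLin S p.2))
      (fun p => toEuclideanLin S⁻¹ (toEuclideanLin H p.1) - p.2)
      (μ.prod (stdGaussian (Euc m))) := by
    rw [hprod] at hind
    have h4 : IndepFun (fun p : Euc n × Euc m =>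
        p.1 - toEuclideanLin A (toEuclideanLin H p.1 - toEuclideanLin S p.2))
      (fun p => toEuclideanLin H p.1 - toEuclideanLin S p.2)
      (μ.prod (stdGaussian (Euc m))) := by
      have : IsProbabilityMeasure ((μ.prod (stdGaussian (Euc m))).map
          (Prod.map id (toEuclideanLin S))) := Measure.isProbabilityMeasure_map hem.aemeasurable
      rw [indepFun_iff_map_prod_eq_prod_map_map (by fun_prop) (by fun_prop)] at hind ⊢
      rw [Measure.map_map (by fun_prop) hem, Measure.map_map (by fun_prop) hem,
        Measure.map_map (by fun_prop) hem] at hind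
      exact hind
    have h5 := h4.comp measurable_id hSc'.measurable
    have e : (toEuclideanLin S⁻¹) ∘ (fun p : Euc n × Euc m =>
        toEuclideanLin H p.1 - toEuclideanLin S p.2) =
        fun p => toEuclideanLin S⁻¹ (toEuclideanLin H p.1) - p.2 := by
      funext p
      simp only [Function.comp_apply, map_sub, hSS']
    rw [e] at h5
    exact h5
  have := isProbabilityMeasure_bayes H hΓ y μ
  have := isProbabilityMeasure_linUpdate H Γ y (covMat μ) μ
  refine ext_of_forall_integral_eq_of_IsFiniteMeasure fun φ => ?_
  -- Weighting with the likelihood is conditioning on `H v - η = y`. Given this event `v` is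
  -- distributed as `R + A y = v - A (H v - η) + A y`, which is the analysis map.
  have hcore := integral_gaussWeight_mul_of_indepFun μ
    (T := fun v => toEuclideanLin S⁻¹ (toEuclideanLin H v)) (hSc'.comp hHc)
    (R := fun p => p.1 - toEuclideanLin A (toEuclideanLin H p.1 - toEuclideanLin S p.2))
    (by fun_prop) (B := fun z => toEuclideanLin A (toEuclideanLin S z)) (hAc.comp hSc)
    (fun p => by simp only [map_sub, hSS]; abel) hind' φ.continuous (fun v => φ.norm_coe_le_norm v)
    (toEuclideanLin S⁻¹ y)
  simp only [hS, ← likelihood_eq_gaussWeight H hΓ] at hcore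
  rw [integral_bayes H hΓ, hcore, ← mul_assoc,
    inv_mul_cancel₀ (integral_likelihood_pos H hΓ y μ).ne', one_mul, linUpdate,
    integral_map (measurable_analysis H A y).aemeasurable φ.continuous.aestronglyMeasurable, hprod,
    integral_map hem.aemeasurable (Measurable.aestronglyMeasurable (by
      exact φ.continuous.measurable.comp (measurable_analysis H A y)))]
  refine integral_congr_ae (Filter.Eventually.of_forall fun p => ?_)
  simp only [Prod.map_fst, Prod.map_snd, id, analysis]
  rw [← hS, hSS]
  congr 1
  simp only [map_sub, map_add]
  abel

lemma isGaussian_linUpdate (H : Matrix (Fin m) (Fin n) ℝ) (Γ : Matrix (Fin m) (Fin m) ℝ)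
    (y : Euc m) (C : Matrix (Fin n) (Fin n) ℝ) (μ : Measure (Euc n)) [IsGaussian μ] :
    IsGaussian (linUpdate H Γ y C μ) := by
  set A := gain H Γ C with hA
  let T : Euc n × Euc m →L[ℝ] Euc n := ContinuousLinearMap.fst ℝ (Euc n) (Euc m) -
    (LinearMap.toContinuousLinearMap (toEuclideanLin A)).comp
      ((LinearMap.toContinuousLinearMap (toEuclideanLin H)).comp
        (ContinuousLinearMap.fst ℝ (Euc n) (Euc m)) - ContinuousLinearMap.snd ℝ (Euc n) (Euc m))
  have e : (fun p : Euc n × Euc m => analysis H A y p.2 p.1) =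
      (fun x => x + toEuclideanLin A y) ∘ T := by
    funext p
    change _ = p.1 - toEuclideanLin A (toEuclideanLin H p.1 - p.2) + toEuclideanLin A y
    simp only [analysis, map_add, map_sub]
    abel
  rw [linUpdate, ← hA, e, ← Measure.map_map (by fun_prop) T.continuous.measurable]
  infer_instance

lemma exists_momentLE_of_isGaussian (p : ℕ) (μ : Measure (Euc n)) [IsGaussian μ] :
    ∃ M, MomentLE p M μ := by
  refine ⟨_, ?_, le_rfl⟩
  have h : MemLp (fun u : Euc n => u) p μ := IsGaussian.memLp_id μ p (ENNReal.natCast_ne_top p)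
  have h5 : MemLp (fun u : Euc n => 1 + ‖u‖) p μ := (memLp_const (1 : ℝ)).add h.norm
  refine (h5.integrable_norm_pow').congr (Filter.Eventually.of_forall fun u => ?_)
  simp only
  rw [Real.norm_of_nonneg (by positivity)]

/-- On Gaussian initial data, a kernel that preserves Gaussians has the same mean-field EnKF as
filtering distribution. -/
lemma trueFilter_eq_mfEnKF {k : Kernel (Euc n) (Euc n)}
    (hk : ∀ μ : Measure (Euc n), IsGaussian μ → IsGaussian (k ∘ₘ μ))
    (H : Matrix (Fin m) (Fin n) ℝ) {Γ : Matrix (Fin m) (Fin m) ℝ} (hΓ : Γ.PosDef)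
    {ρ₀ : Measure (Euc n)} (hρ : IsGaussian ρ₀) (y : ℕ → Euc m) (j : ℕ) :
    trueFilter k H Γ ρ₀ y j = mfEnKF k H Γ ρ₀ y j ∧ IsGaussian (mfEnKF k H Γ ρ₀ y j) := by
  induction j with
  | zero => exact ⟨rfl, hρ⟩
  | succ j ih =>
    obtain ⟨h1, h2⟩ := ih
    have h3 := hk _ h2
    obtain ⟨M, h4⟩ := exists_momentLE_of_isGaussian 2 (k ∘ₘ mfEnKF k H Γ ρ₀ y j)
    refine ⟨?_, ?_⟩
    · rw [trueFilter, h1, mfEnKF, bayes_eq_linUpdate H hΓ _ _ (covMat_posSemidef h4)]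
    · rw [mfEnKF]
      exact isGaussian_linUpdate H Γ _ _ _

end Bayes

/-! ### The Gaussian projection, and a Lipschitz bound for the gain. -/

section GaussProj

open scoped MatrixOrder Matrix.Norms.L2Operator

variable {n m : ℕ}

instance isGaussian_gaussProj (μ : Measure (Euc n)) : IsGaussian (gaussProj μ) := by
  unfold gaussProj; infer_instance

lemma norm_sqrt_sq {S : Matrix (Fin n) (Fin n) ℝ} (hS : S.PosSemidef) :
    ‖CFC.sqrt S‖ * ‖CFC.sqrt S‖ = ‖S‖ := by
  have h1 : CFC.sqrt S * CFC.sqrt S = S := CFC.sqrt_mul_sqrt_self S hS.nonneg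
  have h2 : star (CFC.sqrt S) = CFC.sqrt S := (CFC.sqrt_nonneg S).isSelfAdjoint
  conv_rhs => rw [← h1]
  nth_rw 3 [← h2]
  exact CStarRing.norm_star_mul_self.symm

/-- The projection is an affine image of the standard Gaussian; the shift and the square root of the
covariance are bounded by the first two moments of `μ`. -/
lemma exists_momentLE_gaussProj (n : ℕ) (M : ℕ → ℝ) : ∃ M' : ℕ → ℝ, ∀ μ : Measure (Euc n),
    IsProbabilityMeasure μ → (∀ p, MomentLE p (M p) μ) → ∀ p, MomentLE p (M' p) (gaussProj μ) := by
  obtain ⟨s, hs⟩ := exists_norm_covMat_le n (M 2)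
  have hstd : ∀ p : ℕ, ∃ N, MomentLE p N (stdGaussian (Euc n)) := fun p =>
    exists_momentLE_of_isGaussian p _
  choose N hN using hstd
  refine ⟨fun p => (2 + M 1 + |s|) ^ p * N p, fun μ hμ hM p => ?_⟩
  have hcov := hs μ hμ (hM 2)
  have hM1 := (hM 1).nonneg
  have hmean : ‖∫ u, u ∂μ‖ ≤ M 1 := by
    refine (norm_integral_le_integral_norm _).trans (le_trans ?_ (hM 1).2)
    refine integral_mono_of_nonneg (Filter.Eventually.of_forall fun u => norm_nonneg u) (hM 1).1
      (Filter.Eventually.of_forall fun u => ?_)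
    simp only [pow_one]
    linarith
  have hsq : ‖CFC.sqrt (covMat μ)‖ ≤ 1 + |s| := by
    have h1 := norm_sqrt_sq (covMat_posSemidef (hM 2))
    have h2 := le_abs_self s
    nlinarith [norm_nonneg (CFC.sqrt (covMat μ)), abs_nonneg s]
  have hmap : Measurable (fun x : Euc n =>
      (∫ u, u ∂μ) + toEuclideanCLM (𝕜 := ℝ) (CFC.sqrt (covMat μ)) x) := by fun_prop
  have hle : ∀ x : Euc n, 1 + ‖(∫ u, u ∂μ) + toEuclideanCLM (𝕜 := ℝ) (CFC.sqrt (covMat μ)) x‖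
      ≤ (2 + M 1 + |s|) * (1 + ‖x‖) := by
    intro x
    have h1 : ‖toEuclideanCLM (𝕜 := ℝ) (CFC.sqrt (covMat μ)) x‖ ≤ (1 + |s|) * ‖x‖ :=
      (norm_toEuclideanLin_le (CFC.sqrt (covMat μ)) x).trans (by gcongr)
    have h2 := norm_add_le (∫ u, u ∂μ) (toEuclideanCLM (𝕜 := ℝ) (CFC.sqrt (covMat μ)) x)
    nlinarith [norm_nonneg x, abs_nonneg s, mul_nonneg hM1 (norm_nonneg x)]
  have hpm : Measurable fun u : Euc n => (1 + ‖u‖) ^ p := by fun_prop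
  have hi := (hN p).1.const_mul ((2 + M 1 + |s|) ^ p)
  have hi' : Integrable (fun x : Euc n => (1 + ‖(∫ u, u ∂μ) +
      toEuclideanCLM (𝕜 := ℝ) (CFC.sqrt (covMat μ)) x‖) ^ p) (stdGaussian (Euc n)) := by
    refine hi.mono' (hpm.comp hmap).aestronglyMeasurable (Filter.Eventually.of_forall fun x => ?_)
    rw [Real.norm_of_nonneg (by positivity), ← mul_pow]
    exact pow_le_pow_left₀ (by positivity) (hle x) p
  refine ⟨?_, ?_⟩
  · rw [gaussProj, multivariateGaussian]
    exact (integrable_map_measure hpm.aestronglyMeasurable hmap.aemeasurable).2 hi'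
  · rw [gaussProj, multivariateGaussian, integral_map hmap.aemeasurable hpm.aestronglyMeasurable]
    refine (integral_mono hi' hi fun x => ?_).trans ?_
    · simp only
      rw [← mul_pow]
      exact pow_le_pow_left₀ (by positivity) (hle x) p
    · rw [integral_const_mul]
      exact mul_le_mul_of_nonneg_left (hN p).2 (by positivity)

lemma covMat_gaussProj {μ : Measure (Euc n)} [IsProbabilityMeasure μ] {M : ℝ}
    (h : MomentLE 2 M μ) : covMat (gaussProj μ) = covMat μ :=
  covMat_multivariateGaussian _ (covMat_posSemidef h)

lemma abs_sub_le_of_tvDist {μ ν : Measure (Euc n)} {e s : ℝ} (he : 0 ≤ e)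
    (h : tvDist μ ν ≤ ENNReal.ofReal e) {f : Euc n → ℝ} (hf : Measurable f)
    (hs : ∀ u, |f u| ≤ s) : |∫ u, f u ∂μ - ∫ u, f u ∂ν| ≤ s * e := by
  have hs0 : 0 ≤ s := (abs_nonneg _).trans (hs 0)
  rcases hs0.eq_or_lt with h0 | h0
  · have : ∀ u, f u = 0 := fun u => abs_nonpos_iff.1 (by simpa [← h0] using hs u)
    simp [this, ← h0]
  · have h1 := abs_sub_le_of_supDist (f := fun u => s⁻¹ * f u) he h (hf.const_mul _) fun u => by
      rw [abs_mul, abs_of_pos (inv_pos.2 h0), inv_mul_le_iff₀ h0]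
      simpa using hs u
    rw [integral_const_mul, integral_const_mul, ← mul_sub, abs_mul, abs_of_pos (inv_pos.2 h0),
      inv_mul_le_iff₀ h0] at h1
    exact h1

/-- The Kalman gain is Lipschitz on bounded sets of covariances. -/
lemma exists_gain_lipschitz (H : Matrix (Fin m) (Fin n) ℝ) {Γ : Matrix (Fin m) (Fin m) ℝ}
    (hΓ : Γ.PosDef) (M : ℝ) : ∃ a : ℝ, 1 ≤ a ∧ ∀ C C' : Matrix (Fin n) (Fin n) ℝ,
      C.PosSemidef → C'.PosSemidef → ‖C‖ ≤ M → ‖C'‖ ≤ M →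
      ‖gain H Γ C‖ ≤ a ∧ ‖gain H Γ C' - gain H Γ C‖ ≤ a * ‖C' - C‖ := by
  obtain ⟨a, ε, ha, hε, h⟩ := gain_bounds H hΓ M
  have ha' : a ≤ a + 2 * a / ε := le_add_of_nonneg_right (by positivity)
  refine ⟨a + 2 * a / ε, ha.trans ha', fun C C' hC hC' hM hM' => ?_⟩
  have h1 := (h C C hC hM (by simpa using hε.le)).1
  have h2 := (h C' C' hC' hM' (by simpa using hε.le)).1
  refine ⟨h1.trans ha', ?_⟩
  -- For distant covariances the difference of the gains is at most `2 a`, hence at most `(2 a / ε)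
  -- ‖C' - C‖`.
  rcases le_total ‖C' - C‖ ε with h3 | h3
  · exact (h C C' hC hM h3).2.trans (by gcongr)
  · refine (norm_sub_le _ _).trans ((add_le_add h2 h1).trans ?_)
    have : 2 * a ≤ 2 * a / ε * ‖C' - C‖ := by
      rw [div_mul_eq_mul_div, le_div_iff₀ hε]
      gcongr
    nlinarith [norm_nonneg (C' - C)]

/-- Joseph's form of the analysis covariance. -/
lemma covMat_linUpdate_covMat (H : Matrix (Fin m) (Fin n) ℝ) {Γ : Matrix (Fin m) (Fin m) ℝ}
    (hΓ : Γ.PosDef) (y : Euc m) {μ : Measure (Euc n)} [IsProbabilityMeasure μ] {M : ℝ}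
    (h : MomentLE 2 M μ) :
    covMat (linUpdate H Γ y (covMat μ) μ) = covMat μ - gain H Γ (covMat μ) * H * covMat μ := by
  have hμ : MemLp id 2 μ := by
    rw [← memLp_norm_iff aestronglyMeasurable_id]
    have hm : AEStronglyMeasurable (fun u : Euc n => ‖id u‖) μ :=
      Continuous.aestronglyMeasurable (by fun_prop)
    rw [memLp_two_iff_integrable_sq hm]
    refine h.integrable (c := 1) (hm.pow 2) fun u => ?_
    rw [abs_of_nonneg (by positivity), one_mul]
    exact pow_le_pow_left₀ (norm_nonneg _) (by simp) 2
  have hC := covMat_posSemidef h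
  have hCt : (covMat μ)ᵀ = covMat μ := by
    have := hC.isHermitian
    rwa [IsHermitian, conjTranspose_eq_transpose_of_trivial] at this
  rw [covMat_linUpdate H hΓ y _ μ hμ]
  have ho := innovation_orthogonal H hΓ hC
  set C := covMat μ
  set A := gain H Γ C
  -- By the normal equations the last two terms of this regrouping cancel.
  have e : (1 - A * H) * C * (1 - A * H)ᵀ + A * Γ * Aᵀ =
      C - A * H * C - C * Hᵀ * Aᵀ + A * (H * C * Hᵀ + Γ) * Aᵀ := by
    rw [transpose_sub, transpose_one, transpose_mul]
    simp only [Matrix.sub_mul, Matrix.mul_sub, Matrix.add_mul, Matrix.mul_add, Matrix.one_mul,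
      Matrix.mul_one, Matrix.mul_assoc]
    abel
  rw [e, ho]
  abel

end GaussProj

/-! ### Stability of the Bayes update in total variation. -/

section BayesStability

open scoped Matrix.Norms.L2Operator

variable {n m : ℕ}

/-- The normalised integral against `μ` is at most one in absolute value, so only the normalising
constant of `ν` is divided by; it will belong to the reference filter. -/
lemma abs_integral_bayes_sub_le (H : Matrix (Fin m) (Fin n) ℝ) {Γ : Matrix (Fin m) (Fin m) ℝ}
    (hΓ : Γ.PosDef) (y : Euc m) {μ ν : Measure (Euc n)} [IsProbabilityMeasure μ]
    [IsProbabilityMeasure ν] {δ : ℝ}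
    (h : ∀ f : Euc n → ℝ, Measurable f → (∀ u, |f u| ≤ 1) → |∫ u, f u ∂μ - ∫ u, f u ∂ν| ≤ δ)
    {f : Euc n → ℝ} (hf : Measurable f) (hb : ∀ u, |f u| ≤ 1) :
    |∫ u, f u ∂(bayes H Γ y μ) - ∫ u, f u ∂(bayes H Γ y ν)|
      ≤ 2 * δ / ∫ u, likelihood H Γ u y ∂ν := by
  have hlm := (continuous_likelihood H Γ y).measurable
  have hl1 : ∀ u, |likelihood H Γ u y| ≤ 1 := fun u => by
    rw [abs_of_pos (likelihood_pos H Γ u y)]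
    exact likelihood_le_one H hΓ u y
  have h1 := h _ hlm hl1
  have h2 := h (fun u => likelihood H Γ u y * f u) (hlm.mul hf) fun u => by
    rw [abs_mul]
    exact mul_le_one₀ (hl1 u) (abs_nonneg _) (hb u)
  have hμ := integral_likelihood_pos H hΓ y μ
  have hν := integral_likelihood_pos H hΓ y ν
  rw [integral_bayes H hΓ, integral_bayes H hΓ]
  have h3 : |∫ u, likelihood H Γ u y * f u ∂μ| ≤ ∫ u, likelihood H Γ u y ∂μ := by
    refine abs_integral_le_integral_abs.trans ?_
    refine integral_mono_of_nonneg (Filter.Eventually.of_forall fun _ => abs_nonneg _)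
      (integrable_likelihood H hΓ y μ) (Filter.Eventually.of_forall fun u => ?_)
    simp only
    rw [abs_mul, abs_of_pos (likelihood_pos H Γ u y)]
    exact mul_le_of_le_one_right (likelihood_pos H Γ u y).le (hb u)
  set Zμ := ∫ u, likelihood H Γ u y ∂μ
  set Zν := ∫ u, likelihood H Γ u y ∂ν
  set a := ∫ u, likelihood H Γ u y * f u ∂μ
  set b := ∫ u, likelihood H Γ u y * f u ∂ν
  have e : Zμ⁻¹ * a - Zν⁻¹ * b = Zν⁻¹ * ((a - b) - (a / Zμ) * (Zμ - Zν)) := by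
    field_simp
    ring
  rw [e, abs_mul, abs_of_pos (inv_pos.2 hν), div_eq_inv_mul (2 * δ)]
  have h4 : |a / Zμ| ≤ 1 := by
    rw [abs_div, abs_of_pos hμ]
    exact div_le_one_of_le₀ h3 hμ.le
  refine mul_le_mul_of_nonneg_left ?_ (inv_pos.2 hν).le
  refine (abs_sub _ _).trans ?_
  rw [abs_mul]
  have := mul_le_mul h4 h1 (abs_nonneg _) zero_le_one
  linarith

/-- Jensen's inequality in tangent form: the likelihood is at least `exp (-κ (1 + ‖u‖)²)`, which
lies above its tangent at the exponent `κ M`. Integration with the second moment bound leaves `exp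
(-κ M)`. -/
lemma exists_integral_likelihood_ge (H : Matrix (Fin m) (Fin n) ℝ) {Γ : Matrix (Fin m) (Fin m) ℝ}
    (hΓ : Γ.PosDef) (r M : ℝ) : ∃ z : ℝ, 0 < z ∧ ∀ (μ : Measure (Euc n)) (y : Euc m),
      IsProbabilityMeasure μ → MomentLE 2 M μ → ‖y‖ ≤ r → z ≤ ∫ u, likelihood H Γ u y ∂μ := by
  set κ := ‖Γ⁻¹‖ * (|r| + ‖H‖) ^ 2
  have hκ : 0 ≤ κ := by positivity
  refine ⟨Real.exp (-(κ * M)), Real.exp_pos _, fun μ y hμ hM hy => ?_⟩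
  have hlow : ∀ u, Real.exp (-(κ * M)) * (1 - (κ * (1 + ‖u‖) ^ 2 - κ * M))
      ≤ likelihood H Γ u y := by
    intro u
    set w := y - toEuclideanLin H u
    have hw : ‖w‖ ≤ (|r| + ‖H‖) * (1 + ‖u‖) := by
      have h1 := norm_sub_le y (toEuclideanLin H u)
      have h2 := norm_toEuclideanLin_le H u
      have h3 := le_abs_self r
      have h4 : 0 ≤ |r| * ‖u‖ := by positivity
      have h5 := norm_nonneg H
      change ‖w‖ ≤ _ at h1
      linarith
    have hq : w.ofLp ⬝ᵥ Γ⁻¹ *ᵥ w.ofLp ≤ κ * (1 + ‖u‖) ^ 2 := by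
      have h1 : w.ofLp ⬝ᵥ Γ⁻¹ *ᵥ w.ofLp = inner ℝ (toEuclideanLin Γ⁻¹ w) w := by
        simp [PiLp.inner_apply, dotProduct, toLpLin_apply, mulVec]
      rw [h1]
      refine (real_inner_le_norm _ _).trans ?_
      calc ‖toEuclideanLin Γ⁻¹ w‖ * ‖w‖ ≤ (‖Γ⁻¹‖ * ‖w‖) * ‖w‖ := by
            gcongr; exact norm_toEuclideanLin_le _ _
        _ = ‖Γ⁻¹‖ * ‖w‖ ^ 2 := by ring
        _ ≤ ‖Γ⁻¹‖ * ((|r| + ‖H‖) * (1 + ‖u‖)) ^ 2 := by gcongr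
        _ = _ := by rw [mul_pow, ← mul_assoc]
    have hq0 : 0 ≤ κ * (1 + ‖u‖) ^ 2 := by positivity
    have h2 := Real.add_one_le_exp (κ * M - κ * (1 + ‖u‖) ^ 2)
    calc _ ≤ Real.exp (-(κ * M)) * Real.exp (κ * M - κ * (1 + ‖u‖) ^ 2) := by
          gcongr; linarith
      _ = Real.exp (-(κ * (1 + ‖u‖) ^ 2)) := by rw [← Real.exp_add]; ring_nf
      _ ≤ _ := by
        rw [likelihood]
        gcongr
        change _ ≤ -(1 / 2) * (w.ofLp ⬝ᵥ Γ⁻¹ *ᵥ w.ofLp)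
        linarith
  have hiκ : Integrable (fun u => κ * (1 + ‖u‖) ^ 2) μ := hM.1.const_mul κ
  have hiκ' : Integrable (fun u => κ * (1 + ‖u‖) ^ 2 - κ * M) μ := hiκ.sub (integrable_const _)
  have hi : Integrable (fun u => Real.exp (-(κ * M)) * (1 - (κ * (1 + ‖u‖) ^ 2 - κ * M))) μ :=
    ((integrable_const _).sub hiκ').const_mul _
  refine le_trans ?_ (integral_mono hi (integrable_likelihood H hΓ y μ) hlow)
  rw [integral_const_mul, integral_sub (integrable_const _) hiκ', integral_sub hiκ (integrable_const _),
    integral_const_mul]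
  simp only [integral_const, probReal_univ, smul_eq_mul, one_mul]
  have : κ * ∫ u, (1 + ‖u‖) ^ 2 ∂μ ≤ κ * M := by
    have := hM.2
    gcongr
  exact le_mul_of_one_le_right (Real.exp_pos _).le (by linarith)

end BayesStability

/-! ### Nonlinear drift: both filters are close to the filter without dynamics. -/

section Nonlinear

open scoped Matrix.Norms.L2Operator

variable {n m : ℕ}

/-- Over a short time a kernel moves the averages of functions with bounded second differences by
at most `δ (1 + |x|²)`. -/
def ShortTime {n : ℕ} (k : Kernel (Euc n) (Euc n)) (δ : ℝ) : Prop :=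
  ∀ f : Euc n → ℝ, PolyLip 1 1 f → (∀ x z, |f (x + z) + f (x - z) - 2 * f x| ≤ 2 * ‖z‖ ^ 2) →
    ∀ x, |∫ v, f v ∂(k x) - f x| ≤ δ * (1 + ‖x‖) ^ 2

/-- Data of a filtering problem whose initial law is nearly Gaussian and whose kernel is nearly the
identity on the filters, up to time-step `h`. -/
structure SmoothData {n m : ℕ} (H : Matrix (Fin m) (Fin n) ℝ) (Γ : Matrix (Fin m) (Fin m) ℝ)
    (B M₀ : ℕ → ℝ) (r b : ℝ) (c : ℕ → ℝ) (h : ℝ) (k : Kernel (Euc n) (Euc n))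
    (ρ₀ : Measure (Euc n)) (y : ℕ → Euc m) : Prop extends FilterData B M₀ r k ρ₀ y where
  pos : 0 ≤ h
  short : ShortTime k (b * h)
  gauss : tvDist ρ₀ (gaussProj ρ₀) ≤ ENNReal.ofReal (b * h)
  mf : ∀ j, tvDist (k ∘ₘ mfEnKF k H Γ ρ₀ y j) (mfEnKF k H Γ ρ₀ y j) ≤ ENNReal.ofReal (c j * h)
  filter : ∀ j, tvDist (k ∘ₘ trueFilter k H Γ ρ₀ y j) (trueFilter k H Γ ρ₀ y j)
    ≤ ENNReal.ofReal (c j * h)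

variable {H : Matrix (Fin m) (Fin n) ℝ} {Γ : Matrix (Fin m) (Fin m) ℝ}

lemma trueFilter_prob {k : Kernel (Euc n) (Euc n)} [IsMarkovKernel k] (hΓ : Γ.PosDef)
    {ρ₀ : Measure (Euc n)} [IsProbabilityMeasure ρ₀] (y : ℕ → Euc m) (j : ℕ) :
    IsProbabilityMeasure (trueFilter k H Γ ρ₀ y j) := by
  induction j with
  | zero => simpa [trueFilter]
  | succ j ih => exact isProbabilityMeasure_bayes H hΓ _ _

/-- The filter without dynamics started from the Gaussian projection. -/
def staticFilter (H : Matrix (Fin m) (Fin n) ℝ) (Γ : Matrix (Fin m) (Fin m) ℝ)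
    (ρ₀ : Measure (Euc n)) (y : ℕ → Euc m) (j : ℕ) : Measure (Euc n) :=
  mfEnKF Kernel.id H Γ (gaussProj ρ₀) y j

/-- Without dynamics all laws stay Gaussian, so one process is the reference for the Bayes and for
the Kalman recursion. -/
lemma staticFilter_eq (hΓ : Γ.PosDef) (ρ₀ : Measure (Euc n)) (y : ℕ → Euc m) (j : ℕ) :
    trueFilter Kernel.id H Γ (gaussProj ρ₀) y j = staticFilter H Γ ρ₀ y j :=
  (trueFilter_eq_mfEnKF (fun μ hμ => by simpa using hμ) H hΓ inferInstance y j).1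

lemma exists_staticFilter_bounds (H : Matrix (Fin m) (Fin n) ℝ) (hΓ : Γ.PosDef) (M₀ : ℕ → ℝ)
    (r : ℝ) (j : ℕ) : ∃ M : ℕ → ℝ, ∀ (ρ₀ : Measure (Euc n)) (y : ℕ → Euc m),
      IsProbabilityMeasure ρ₀ → (∀ p, MomentLE p (M₀ p) ρ₀) → (∀ i, ‖y i‖ ≤ r) →
      IsProbabilityMeasure (staticFilter H Γ ρ₀ y j) ∧
      ∀ p, MomentLE p (M p) (staticFilter H Γ ρ₀ y j) := by
  obtain ⟨M', hM'⟩ := exists_momentLE_gaussProj n M₀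
  obtain ⟨M, a, ε, -, -, h⟩ := exists_mfEnKF_bounds H hΓ (fun _ => 1) M' r j
  refine ⟨M, fun ρ₀ y hρ hm hy => ?_⟩
  have hd : FilterData (fun _ => 1) M' r Kernel.id (gaussProj ρ₀) y :=
    ⟨regularKernel_id, inferInstance, hM' ρ₀ hρ hm, hy⟩
  exact ⟨mfEnKF_prob hd H Γ j, (h _ _ y hd).1⟩

/-- Each step adds the `O(h)` by which the dynamics moves the filter and multiplies by the Bayes
factor `2 / z`. Moments of the static filter supply `z`; moments of the true filter are never
needed. -/
lemma exists_trueFilter_close (H : Matrix (Fin m) (Fin n) ℝ) (hΓ : Γ.PosDef) (B M₀ : ℕ → ℝ)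
    (r : ℝ) {b : ℝ} (hb : 0 ≤ b) {c : ℕ → ℝ} (hc : ∀ j, 0 ≤ c j) (j : ℕ) :
    ∃ C : ℝ, 0 ≤ C ∧ ∀ (h : ℝ) (k : Kernel (Euc n) (Euc n)) (ρ₀ : Measure (Euc n))
      (y : ℕ → Euc m), SmoothData H Γ B M₀ r b c h k ρ₀ y → ∀ f : Euc n → ℝ, Measurable f →
      (∀ u, |f u| ≤ 1) →
      |∫ u, f u ∂(trueFilter k H Γ ρ₀ y j) - ∫ u, f u ∂(staticFilter H Γ ρ₀ y j)| ≤ C * h := by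
  induction j with
  | zero =>
    refine ⟨b, hb, fun h k ρ₀ y hd f hf hf1 => ?_⟩
    have := abs_sub_le_of_tvDist (mul_nonneg hb hd.pos) hd.gauss hf hf1
    rw [one_mul] at this
    exact this
  | succ j ih =>
    obtain ⟨C, hC, ih⟩ := ih
    obtain ⟨M, hM⟩ := exists_staticFilter_bounds H hΓ M₀ r j
    obtain ⟨z, hz, hZ⟩ := exists_integral_likelihood_ge H hΓ r (M 2)
    have hcj := hc j
    refine ⟨2 * (c j + C) / z, by positivity, fun h k ρ₀ y hd f hf hf1 => ?_⟩
    have := hd.reg.markov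
    have := hd.prob
    have := trueFilter_prob (H := H) (k := k) (ρ₀ := ρ₀) hΓ y j
    obtain ⟨_, hm⟩ := hM ρ₀ y hd.prob hd.moment hd.obs
    have hh := hd.pos
    have h1 : ∀ g : Euc n → ℝ, Measurable g → (∀ u, |g u| ≤ 1) →
        |∫ u, g u ∂(k ∘ₘ trueFilter k H Γ ρ₀ y j) - ∫ u, g u ∂(staticFilter H Γ ρ₀ y j)|
          ≤ (c j + C) * h := by
      intro g hg hg1
      have h2 := abs_sub_le_of_tvDist (mul_nonneg hcj hh) (hd.filter j) hg hg1
      have h3 := ih h k ρ₀ y hd g hg hg1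
      refine (abs_sub_le _ (∫ u, g u ∂(trueFilter k H Γ ρ₀ y j)) _).trans ?_
      linarith
    have h4 := abs_integral_bayes_sub_le H hΓ (y (j + 1)) h1 hf hf1
    rw [← staticFilter_eq hΓ, trueFilter, trueFilter, Measure.id_comp, staticFilter_eq hΓ]
    refine h4.trans ?_
    rw [div_mul_eq_mul_div]
    refine div_le_div₀ (by positivity) (by linarith) hz ?_
    exact hZ _ _ inferInstance (hm 2) (hd.obs _)

/-- Coordinates and their products belong to the class in `ShortTime`: their second differences are
`0` and `2 zᵢ zₗ`. -/
lemma abs_covMat_comp_sub_le {k : Kernel (Euc n) (Euc n)} {B : ℕ → ℝ} (hk : RegularKernel k B)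
    {δ : ℝ} (hδ : 0 ≤ δ) (hs : ShortTime k δ) {μ : Measure (Euc n)} [IsProbabilityMeasure μ]
    {M : ℝ} (hM : MomentLE 2 M μ) (i l : Fin n) :
    |covMat (k ∘ₘ μ) i l - covMat μ i l| ≤ δ * M * (1 + 2 * M + δ * M) := by
  have := hk.markov
  have key : ∀ f : Euc n → ℝ, PolyLip 1 1 f →
      (∀ x z, |f (x + z) + f (x - z) - 2 * f x| ≤ 2 * ‖z‖ ^ 2) →
      |∫ u, f u ∂(k ∘ₘ μ) - ∫ u, f u ∂μ| ≤ δ * M := by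
    intro f hf hf2
    rw [hk.integral_comp hM hf, ← integral_sub ((hk.polyLip hf).integrable hM) (hf.integrable hM)]
    exact hM.abs_integral_le hδ (hs f hf hf2)
  refine covMat_sub_le (hk.comp_moment hM) hM (fun i => ?_) (fun i l => ?_) i l
  · refine key _ ((polyLip_coord i).mono zero_le_one) fun x z => ?_
    have : (x + z) i + (x - z) i - 2 * x i = 0 := by
      simp only [PiLp.add_apply, PiLp.sub_apply]; ring
    rw [this, abs_zero]
    positivity
  · refine key _ (polyLip_coord_mul i l) fun x z => ?_
    have : (x + z) i * (x + z) l + (x - z) i * (x - z) l - 2 * (x i * x l) = 2 * (z i * z l) := by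
      simp only [PiLp.add_apply, PiLp.sub_apply]; ring
    rw [this, abs_mul, abs_mul, abs_of_pos (by norm_num : (0 : ℝ) < 2), sq]
    gcongr
    · exact abs_coord_le z i
    · exact abs_coord_le z l

/-- The averaged analysis map preserves bounded Lipschitz functions. -/
lemma integral_analysis_boundedLipschitz {A : Matrix (Fin n) (Fin m) ℝ} {a r s l : ℝ} {y : Euc m}
    (hA : ‖A‖ ≤ a) (hr : 0 ≤ r) (hl : 0 ≤ l) {f : Euc n → ℝ} (hf : Continuous f)
    (hs : ∀ u, |f u| ≤ s) (hfl : ∀ u v, |f u - f v| ≤ l * ‖u - v‖) :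
    (∀ v, |∫ η, f (analysis H A y η v) ∂(multivariateGaussian 0 Γ)| ≤ s) ∧
    ∀ v v', |∫ η, f (analysis H A y η v) ∂(multivariateGaussian 0 Γ) -
      ∫ η, f (analysis H A y η v') ∂(multivariateGaussian 0 Γ)|
        ≤ l * analysisConst H a r * ‖v - v'‖ := by
  have hm : ∀ v, Measurable fun η => f (analysis H A y η v) := fun v =>
    hf.measurable.comp ((measurable_analysis H A y).comp (measurable_const.prodMk measurable_id))
  have hi : ∀ v, Integrable (fun η => f (analysis H A y η v)) (multivariateGaussian 0 Γ) :=
    fun v => Integrable.of_bound (hm v).aestronglyMeasurable s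
      (Filter.Eventually.of_forall fun η => hs _)
  have hconst : ∀ {g : Euc m → ℝ} {t : ℝ}, (∀ η, |g η| ≤ t) →
      |∫ η, g η ∂(multivariateGaussian 0 Γ)| ≤ t := fun {g t} hg => by
    simpa using norm_integral_le_of_norm_le_const (μ := multivariateGaussian (0 : Euc m) Γ)
      (f := g) (C := t) (Filter.Eventually.of_forall fun η => hg η)
  refine ⟨fun v => hconst fun η => hs _, fun v v' => ?_⟩
  rw [← integral_sub (hi v) (hi v')]
  refine hconst fun η => (hfl _ _).trans ?_
  rw [mul_assoc]
  exact mul_le_mul_of_nonneg_left (analysis_sub_le hA hr v v' η) hl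

-- Bounded test functions do not control the covariance that fixes the gain, so two errors are
-- propagated together. The covariance error has a recursion of its own: the dynamics adds `O(h)` by
-- `ShortTime`, and the analysis covariance is a function of the forecast covariance, Lipschitz on
-- bounded sets. The error on test functions sees it through the gain only.
set_option maxHeartbeats 1000000 in
lemma exists_mfEnKF_close (H : Matrix (Fin m) (Fin n) ℝ) (hΓ : Γ.PosDef) (B M₀ : ℕ → ℝ)
    (r hmax : ℝ) {b : ℝ} (hb : 0 ≤ b) {c : ℕ → ℝ} (hc : ∀ j, 0 ≤ c j) (j : ℕ) :
    ∃ C : ℝ, 0 ≤ C ∧ ∀ (h : ℝ) (k : Kernel (Euc n) (Euc n)) (ρ₀ : Measure (Euc n))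
      (y : ℕ → Euc m), h ≤ hmax → SmoothData H Γ B M₀ r b c h k ρ₀ y →
      ‖covMat (mfEnKF k H Γ ρ₀ y j) - covMat (staticFilter H Γ ρ₀ y j)‖ ≤ C * h ∧
      ∀ (f : Euc n → ℝ) (s l : ℝ), 0 ≤ l → (∀ u, |f u| ≤ s) →
      (∀ u v, |f u - f v| ≤ l * ‖u - v‖) →
      |∫ u, f u ∂(mfEnKF k H Γ ρ₀ y j) - ∫ u, f u ∂(staticFilter H Γ ρ₀ y j)|
        ≤ C * h * (s + l) := by
  have hcont : ∀ (f : Euc n → ℝ) (l : ℝ), (∀ u v, |f u - f v| ≤ l * ‖u - v‖) → Continuous f := by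
    intro f l hfl
    refine (LipschitzWith.of_dist_le_mul (K := l.toNNReal) fun u v => ?_).continuous
    rw [Real.dist_eq, dist_eq_norm]
    exact (hfl u v).trans (by gcongr; exact Real.le_coe_toNNReal l)
  induction j with
  | zero =>
    refine ⟨b, hb, fun h k ρ₀ y _ hd => ⟨?_, fun f s l hl hs hfl => ?_⟩⟩
    · have := hd.prob
      -- The Gaussian projection keeps the covariance, so this error starts from zero.
      have : covMat (staticFilter H Γ ρ₀ y 0) = covMat (mfEnKF k H Γ ρ₀ y 0) :=
        covMat_gaussProj (hd.moment 2)
      rw [this, sub_self, norm_zero]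
      exact mul_nonneg hb hd.pos
    · have := abs_sub_le_of_tvDist (mul_nonneg hb hd.pos) hd.gauss (hcont f l hfl).measurable hs
      refine this.trans ?_
      nlinarith [mul_nonneg hb hd.pos]
  | succ j ih =>
    obtain ⟨C, hC, ih⟩ := ih
    obtain ⟨MG, hMG⟩ := exists_staticFilter_bounds H hΓ M₀ r j
    obtain ⟨Mπ, _, _, -, -, hMπ⟩ := exists_mfEnKF_bounds H hΓ B M₀ r j
    set M := max (MG 2) (B 2 * Mπ 2) with hMdef
    obtain ⟨S, hS⟩ := exists_norm_covMat_le n M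
    obtain ⟨a, ha, hgain⟩ := exists_gain_lipschitz H hΓ S
    obtain ⟨κ, hκ, hκ'⟩ := exists_norm_le_of_entries n n
    set P := |Mπ 2| with hP
    -- `D h` bounds the covariance error of the forecast and `E1 h` that of the analysis. `E2`
    -- collects the gain error, the motion by the dynamics, and the earlier error tested on the
    -- averaged analysis, whose Lipschitz constant is larger by the factor `α`.
    set D := κ * (b * P * (1 + 2 * P + b * |hmax| * P)) + C with hD
    have hD0 : 0 ≤ D := by positivity
    set E1 := D + a * D * ‖H‖ * |S| + a * ‖H‖ * D with hE1
    set α := analysisConst H a |r| with hα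
    have hα1 : 1 ≤ α := one_le_analysisConst H (by linarith) (abs_nonneg r)
    set E2 := (2 * α) ^ 1 * (a * D) * (|B 1 * Mπ 1| * noiseMoment Γ 1) + c j + C * α with hE2
    have hcj := hc j
    have hnm := one_le_noiseMoment Γ 1
    have hE1' : 0 ≤ E1 := by positivity
    have hE2' : 0 ≤ E2 := by positivity
    refine ⟨E1 + E2, by positivity, fun h k ρ₀ y hhm hd => ?_⟩
    have hh := hd.pos
    have hr : 0 ≤ r := (norm_nonneg _).trans (hd.obs 0)
    have := hd.reg.markov
    have := hd.prob
    have hπp := mfEnKF_prob hd.toFilterData H Γ j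
    obtain ⟨hGp, hGm⟩ := hMG ρ₀ y hd.prob hd.moment hd.obs
    have hπm := (hMπ k ρ₀ y hd.toFilterData).1
    obtain ⟨ihc, ihf⟩ := ih h k ρ₀ y hhm hd
    set π := mfEnKF k H Γ ρ₀ y j with hπ
    set G := staticFilter H Γ ρ₀ y j with hG
    have hμm : ∀ p, MomentLE p (B p * Mπ p) (k ∘ₘ π) := fun p => hd.reg.comp_moment (hπm p)
    have hGsucc : staticFilter H Γ ρ₀ y (j + 1) = linUpdate H Γ (y (j + 1)) (covMat G) G := by
      rw [hG, staticFilter, staticFilter, mfEnKF, Measure.id_comp]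
    have hμ2 : MomentLE 2 M (k ∘ₘ π) := (hμm 2).mono_const (le_max_right _ _)
    have hG2 : MomentLE 2 M G := (hGm 2).mono_const (le_max_left _ _)
    have hS0 : S ≤ |S| := le_abs_self S
    have hμS := hS _ inferInstance hμ2
    have hGS := hS _ hGp hG2
    have hcov : ‖covMat (k ∘ₘ π) - covMat G‖ ≤ D * h := by
      have hPM : MomentLE 2 P π := (hπm 2).mono_const (le_abs_self _)
      have h1 : ‖covMat (k ∘ₘ π) - covMat π‖ ≤
          κ * (b * h * P * (1 + 2 * P + b * h * P)) := by
        refine hκ' _ _ (by positivity) fun i l => ?_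
        exact abs_covMat_comp_sub_le hd.reg (mul_nonneg hb hh) hd.short hPM i l
      have h2 : κ * (b * h * P * (1 + 2 * P + b * h * P)) ≤
          κ * (b * P * (1 + 2 * P + b * |hmax| * P)) * h := by
        have h3 : h ≤ |hmax| := hhm.trans (le_abs_self _)
        calc _ = κ * (b * P * (1 + 2 * P + b * h * P)) * h := by ring
          _ ≤ _ := by gcongr
      calc _ = ‖(covMat (k ∘ₘ π) - covMat π) + (covMat π - covMat G)‖ := by congr 1; abel
        _ ≤ _ := norm_add_le _ _
        _ ≤ D * h := by rw [hD, add_mul]; linarith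
    obtain ⟨hg1, hg2⟩ := hgain (covMat G) (covMat (k ∘ₘ π)) (covMat_posSemidef hG2)
      (covMat_posSemidef hμ2) hGS hμS
    have hg3 := (hgain (covMat (k ∘ₘ π)) (covMat G) (covMat_posSemidef hμ2)
      (covMat_posSemidef hG2) hμS hGS).1
    have hgd : ‖gain H Γ (covMat (k ∘ₘ π)) - gain H Γ (covMat G)‖ ≤ a * D * h :=
      hg2.trans (by rw [mul_assoc]; gcongr)
    refine ⟨?_, fun f s l hl hs hfl => ?_⟩
    · rw [hGsucc, mfEnKF, covMat_linUpdate_covMat H hΓ _ hμ2, covMat_linUpdate_covMat H hΓ _ hG2]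
      set C1 := covMat (k ∘ₘ π)
      set C2 := covMat G
      set A1 := gain H Γ C1
      set A2 := gain H Γ C2
      have e : C1 - A1 * H * C1 - (C2 - A2 * H * C2) =
          (C1 - C2) - (A1 - A2) * H * C1 - A2 * H * (C1 - C2) := by
        simp only [Matrix.sub_mul, Matrix.mul_sub]
        abel
      rw [e]
      have h1 : ‖(A1 - A2) * H * C1‖ ≤ a * D * h * ‖H‖ * |S| := by
        refine (l2_opNorm_mul _ _).trans ?_
        have := l2_opNorm_mul (A1 - A2) H
        calc _ ≤ ‖A1 - A2‖ * ‖H‖ * ‖C1‖ := by gcongr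
          _ ≤ _ := by gcongr; linarith
      have h2 : ‖A2 * H * (C1 - C2)‖ ≤ a * ‖H‖ * (D * h) := by
        refine (l2_opNorm_mul _ _).trans ?_
        have := l2_opNorm_mul A2 H
        calc _ ≤ ‖A2‖ * ‖H‖ * ‖C1 - C2‖ := by gcongr
          _ ≤ _ := by gcongr
      have h3 := norm_sub_le (C1 - C2 - (A1 - A2) * H * C1) (A2 * H * (C1 - C2))
      have h4 := norm_sub_le (C1 - C2) ((A1 - A2) * H * C1)
      have h5 : 0 ≤ E2 * h := by positivity
      have h6 : E1 * h = D * h + a * D * h * ‖H‖ * |S| + a * ‖H‖ * (D * h) := by rw [hE1]; ring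
      linarith
    · have hfc := hcont f l hfl
      have hs0 : 0 ≤ s := (abs_nonneg _).trans (hs 0)
      rw [hGsucc, mfEnKF]
      set A2 := gain H Γ (covMat G) with hA2
      have hpl : PolyLip 0 (s + l) f := by
        refine ⟨fun u => (hs u).trans ?_, fun u v => (hfl u v).trans ?_⟩
        · simp only [zero_add, pow_one]
          have := norm_nonneg u
          nlinarith [mul_nonneg (add_nonneg hs0 hl) this]
        · simp only [pow_zero, mul_one]
          gcongr
          linarith
      have h1 := integral_linUpdate_gain_sub_le (Γ := Γ) hpl (C := covMat G)
        (C' := covMat (k ∘ₘ π)) ((hμm 1).mono_const (le_abs_self _)) hg1 hg3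
        ((hd.obs (j + 1)).trans (le_abs_self r))
      have h1' : (s + l) * (2 * α) ^ (0 + 1) *
          ‖gain H Γ (covMat (k ∘ₘ π)) - gain H Γ (covMat G)‖ *
          (|B 1 * Mπ 1| * noiseMoment Γ (0 + 1)) ≤
          (2 * α) ^ 1 * (a * D) * (|B 1 * Mπ 1| * noiseMoment Γ 1) * h * (s + l) := by
        calc _ ≤ (s + l) * (2 * α) ^ 1 * (a * D * h) * (|B 1 * Mπ 1| * noiseMoment Γ 1) := by
              gcongr
          _ = _ := by ring
      obtain ⟨hPs, hPl⟩ := integral_analysis_boundedLipschitz (H := H) (Γ := Γ) (y := y (j + 1))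
        hg1 (abs_nonneg r) hl hfc hs hfl
      rw [← hα] at hPl
      set Pf : Euc n → ℝ := fun v => ∫ η, f (analysis H A2 (y (j + 1)) η v)
        ∂(multivariateGaussian 0 Γ) with hPf
      have h2 : ∫ u, f u ∂(linUpdate H Γ (y (j + 1)) (covMat G) (k ∘ₘ π)) = ∫ v, Pf v ∂(k ∘ₘ π) :=
        hpl.integral_linUpdate H Γ _ _ (hμm 1)
      have h3 : ∫ u, f u ∂(linUpdate H Γ (y (j + 1)) (covMat G) G) = ∫ v, Pf v ∂G :=
        hpl.integral_linUpdate H Γ _ _ (hGm 1)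
      have h4 := abs_sub_le_of_tvDist (mul_nonneg hcj hh) (hd.mf j)
        (hcont Pf (l * α) hPl).measurable hPs
      have h5 := ihf Pf s (l * α) (by positivity) hPs hPl
      rw [← hπ] at h4
      rw [h2] at h1
      rw [h3]
      refine (abs_sub_le _ (∫ v, Pf v ∂(k ∘ₘ π)) _).trans ((add_le_add (h1.trans h1')
        ((abs_sub_le _ (∫ v, Pf v ∂π) _).trans (add_le_add h4 h5))).trans ?_)
      have h7 : s * (c j * h) ≤ c j * h * (s + l) := by
        have : 0 ≤ c j * h * l := by positivity
        linarith
      have h8 : C * h * (s + l * α) ≤ C * α * h * (s + l) := by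
        have : 0 ≤ C * h * s * (α - 1) := mul_nonneg (by positivity) (by linarith)
        linarith
      have h9 : 0 ≤ E1 * h * (s + l) := by positivity
      have h10 : E2 * h * (s + l) = (2 * α) ^ 1 * (a * D) * (|B 1 * Mπ 1| * noiseMoment Γ 1) * h *
          (s + l) + c j * h * (s + l) + C * α * h * (s + l) := by rw [hE2]; ring
      linarith

/-- The mean-field EnKF is close to the filtering distribution over short observation times. -/
lemma exists_mfEnKF_trueFilter_close (H : Matrix (Fin m) (Fin n) ℝ) (hΓ : Γ.PosDef)
    (B M₀ : ℕ → ℝ) (r hmax : ℝ) {b : ℝ} (hb : 0 ≤ b) {c : ℕ → ℝ} (hc : ∀ j, 0 ≤ c j) (j : ℕ) :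
    ∃ C : ℝ, 0 ≤ C ∧ ∀ (h : ℝ) (k : Kernel (Euc n) (Euc n)) (ρ₀ : Measure (Euc n))
      (y : ℕ → Euc m), h ≤ hmax → SmoothData H Γ B M₀ r b c h k ρ₀ y →
      ∀ f : Euc n → ℝ, IsBLUnit f →
      |∫ u, f u ∂(mfEnKF k H Γ ρ₀ y j) - ∫ u, f u ∂(trueFilter k H Γ ρ₀ y j)| ≤ C * h := by
  obtain ⟨C1, hC1, h1⟩ := exists_trueFilter_close H hΓ B M₀ r hb hc j
  obtain ⟨C2, hC2, h2⟩ := exists_mfEnKF_close H hΓ B M₀ r hmax hb hc j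
  refine ⟨C2 + C1, by positivity, fun h k ρ₀ y hh hd f hf => ?_⟩
  obtain ⟨s, l, hs, hl, hsl, hfs, hfl⟩ := hf
  have hcont : Continuous f := by
    refine (LipschitzWith.of_dist_le_mul (K := l.toNNReal) fun u v => ?_).continuous
    rw [Real.dist_eq, dist_eq_norm, Real.coe_toNNReal l hl]
    exact hfl u v
  have h3 := h1 h k ρ₀ y hd f hcont.measurable fun u => (hfs u).trans (by linarith)
  have h4 := (h2 h k ρ₀ y hh hd).2 f s l hl hfs hfl
  have h5 : C2 * h * (s + l) ≤ C2 * h :=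
    mul_le_of_le_one_right (mul_nonneg hC2 hd.pos) hsl
  rw [abs_sub_comm] at h3
  refine (abs_sub_le _ (∫ u, f u ∂(staticFilter H Γ ρ₀ y j)) _).trans ?_
  linarith

end Nonlinear

/-! ### Grönwall, Duhamel and Riemann sums. -/

section Pathwise

open Filter Topology

variable {E : Type*} [NormedAddCommGroup E] [NormedSpace ℝ E]

/-- Grönwall's inequality in integral form. -/
lemma gronwall_integral {φ : ℝ → ℝ} (hφ : Continuous φ) (h0 : ∀ t, 0 ≤ φ t) {A K T : ℝ}
    (hA : 0 ≤ A) (hK : 0 ≤ K) (h : ∀ t ∈ Set.Icc 0 T, φ t ≤ A + K * ∫ s in (0 : ℝ)..t, φ s) :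
    ∀ t ∈ Set.Icc 0 T, φ t ≤ A * Real.exp (K * t) := by
  intro t ht
  have hd : ∀ s, HasDerivAt (fun t => A + K * ∫ s in (0 : ℝ)..t, φ s) (K * φ s) s := fun s =>
    ((intervalIntegral.integral_hasDerivAt_right (hφ.intervalIntegrable _ _)
      hφ.stronglyMeasurable.stronglyMeasurableAtFilter hφ.continuousAt).const_mul K).const_add A
  have hnn : ∀ s ∈ Set.Icc 0 T, 0 ≤ A + K * ∫ s in (0 : ℝ)..s, φ s := fun s hs =>
    add_nonneg hA (mul_nonneg hK (intervalIntegral.integral_nonneg hs.1 fun r _ => h0 r))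
  -- The differential inequality is applied to the majorant `A + K ∫ φ`, as `φ` itself is merely
  -- continuous.
  have h1 := norm_le_gronwallBound_of_norm_deriv_right_le (δ := A) (K := K) (ε := 0) (a := 0)
    (b := T) (f' := fun s => K * φ s) (f := fun t => A + K * ∫ s in (0 : ℝ)..t, φ s)
    (fun s _ => (hd s).continuousAt.continuousWithinAt) (fun s _ => (hd s).hasDerivWithinAt)
    (by simp [abs_of_nonneg hA]) (fun s hs => by
      have hs' : s ∈ Set.Icc 0 T := ⟨hs.1, hs.2.le⟩
      rw [Real.norm_of_nonneg (mul_nonneg hK (h0 s)), Real.norm_of_nonneg (hnn s hs'), add_zero]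
      exact mul_le_mul_of_nonneg_left (h s hs') hK) t ht
  rw [gronwallBound_ε0, sub_zero, Real.norm_of_nonneg (hnn t ht)] at h1
  exact (h t ht).trans h1

/-- Duhamel's formula. -/
lemma duhamel [CompleteSpace E] (A : E →L[ℝ] E) {z g : ℝ → E} (hg : Continuous g)
    (hz : ∀ s, 0 ≤ s → HasDerivWithinAt z (A (z s) + g s) (Set.Ici s) s)
    (hzc : Continuous z) {t : ℝ} (ht : 0 ≤ t) :
    z t = NormedSpace.exp (t • A) (z 0) +
      NormedSpace.exp (t • A) (∫ s in (0 : ℝ)..t, NormedSpace.exp ((-s) • A) (g s)) := by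
  have hexp : ∀ s, HasDerivAt (fun s : ℝ => NormedSpace.exp ((-s) • A))
      (-(NormedSpace.exp ((-s) • A) * A)) s := fun s => by
    have h1 := (hasDerivAt_exp_smul_const (𝕂 := ℝ) A (-s)).scomp s (hasDerivAt_neg s)
    simpa [Function.comp_def] using h1
  have hec : Continuous fun s : ℝ => NormedSpace.exp ((-s) • A) :=
    continuous_iff_continuousAt.2 fun s => (hexp s).continuousAt
  -- Integrating factor: `exp (-s A) z(s)` has derivative `exp (-s A) g(s)`.
  have hd : ∀ s ∈ Set.Ioo (0 : ℝ) t, HasDerivWithinAt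
      (fun s => NormedSpace.exp ((-s) • A) (z s)) (NormedSpace.exp ((-s) • A) (g s))
      (Set.Ioi s) s := by
    intro s hs
    have h1 := ((hexp s).hasDerivWithinAt (s := Set.Ici s)).clm_apply (hz s hs.1.le)
    have h2 : (-(NormedSpace.exp ((-s) • A) * A)) (z s) +
        (NormedSpace.exp ((-s) • A)) (A (z s) + g s) = NormedSpace.exp ((-s) • A) (g s) := by
      simp
    rw [h2] at h1
    exact h1.mono Set.Ioi_subset_Ici_self
  have hint : Continuous fun s => NormedSpace.exp ((-s) • A) (g s) := hec.clm_apply hg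
  have h3 := intervalIntegral.integral_eq_sub_of_hasDeriv_right_of_le ht
    (hec.clm_apply hzc).continuousOn hd (hint.intervalIntegrable 0 t)
  rw [h3, ← map_add]
  simp only [neg_zero, zero_smul, NormedSpace.exp_zero, one_apply_eq_self]
  have h4 : NormedSpace.exp (t • A) * NormedSpace.exp ((-t) • A) = 1 := by
    let _ : NormedAlgebra ℚ (E →L[ℝ] E) := NormedAlgebra.restrictScalars ℚ ℝ _
    rw [neg_smul, ← NormedSpace.exp_add_of_commute (Commute.neg_right (Commute.refl (t • A)))]
    simp
  rw [add_sub_cancel, ← mul_apply_eq_comp, h4, one_apply_eq_self]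

/-- Riemann sums of a continuous function converge. -/
lemma tendsto_riemannSum [CompleteSpace E] {g : ℝ → E} (hg : Continuous g) {t : ℝ} (ht : 0 ≤ t) :
    Tendsto (fun n : ℕ => ∑ k ∈ Finset.range (n + 1), (t / (n + 1 : ℕ)) • g (k * (t / (n + 1 : ℕ))))
      atTop (𝓝 (∫ s in (0 : ℝ)..t, g s)) := by
  have huc : UniformContinuousOn g (Set.Icc 0 t) :=
    isCompact_Icc.uniformContinuousOn_of_continuous hg.continuousOn
  rw [Metric.tendsto_atTop]
  intro ε hε
  obtain ⟨δ, hδ, hu⟩ := Metric.uniformContinuousOn_iff.1 huc (ε / (t + 1)) (by positivity)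
  obtain ⟨N, hN⟩ := exists_nat_gt (t / δ)
  refine ⟨N, fun n hn => ?_⟩
  set τ := t / (n + 1 : ℕ) with hτ
  have hn0 : (0 : ℝ) < (n + 1 : ℕ) := by positivity
  have hτ0 : 0 ≤ τ := by positivity
  have hτδ : τ < δ := by
    rw [hτ, div_lt_iff₀ hn0]
    rw [div_lt_iff₀ hδ] at hN
    have : (N : ℝ) ≤ (n + 1 : ℕ) := by exact_mod_cast (hn.trans (Nat.le_succ n))
    nlinarith
  have hend : ((n + 1 : ℕ) : ℝ) * τ = t := by rw [hτ]; field_simp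
  have hsplit : ∫ s in (0 : ℝ)..t, g s =
      ∑ k ∈ Finset.range (n + 1), ∫ s in (k * τ)..((k + 1 : ℕ) * τ), g s := by
    rw [intervalIntegral.sum_integral_adjacent_intervals (a := fun k : ℕ => (k : ℝ) * τ)
      (fun k _ => hg.intervalIntegrable _ _), hend]
    simp
  rw [dist_eq_norm, hsplit, ← Finset.sum_sub_distrib]
  have hterm : ∀ k ∈ Finset.range (n + 1), ‖τ • g (k * τ) -
      ∫ s in (k * τ)..((k + 1 : ℕ) * τ), g s‖ ≤ ε / (t + 1) * τ := by
    intro k hk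
    have hk' : ((k + 1 : ℕ) : ℝ) ≤ (n + 1 : ℕ) := by exact_mod_cast Finset.mem_range.1 hk
    have e : τ • g (k * τ) = ∫ _ in (k * τ)..((k + 1 : ℕ) * τ), g (k * τ) := by
      rw [intervalIntegral.integral_const]
      congr 1
      push_cast; ring
    have hle : (k : ℝ) * τ ≤ (k + 1 : ℕ) * τ := by push_cast; nlinarith
    rw [e, ← intervalIntegral.integral_sub (by simp) (hg.intervalIntegrable _ _)]
    refine (intervalIntegral.norm_integral_le_of_norm_le_const (C := ε / (t + 1))
      fun s hs => ?_).trans (le_of_eq ?_)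
    · rw [Set.uIoc_of_le hle] at hs
      rw [← dist_eq_norm]
      have h1 : (k + 1 : ℕ) * τ ≤ t := by rw [← hend]; gcongr
      have h2 : 0 ≤ (k : ℝ) * τ := by positivity
      refine (hu _ ⟨h2, hle.trans h1⟩ _ ⟨h2.trans hs.1.le, hs.2.trans h1⟩ ?_).le
      rw [Real.dist_eq, abs_sub_comm, abs_of_pos (by linarith [hs.1])]
      have := hs.2
      push_cast at this
      linarith
    · rw [abs_of_nonneg (by linarith)]
      push_cast; ring
  refine (norm_sum_le_of_le _ hterm).trans_lt ?_
  rw [Finset.sum_const, Finset.card_range, nsmul_eq_mul, mul_comm, mul_assoc, mul_comm τ, hend,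
    div_mul_eq_mul_div, div_lt_iff₀ (by positivity)]
  nlinarith

end Pathwise

/-! ### Pathwise estimates for the Langevin equation. -/

section LangevinPath

variable {n : ℕ}

/-- `u` solves `u(t) = x + ∫₀ᵗ F(u) ds + σ w(t)`. -/
structure LangevinPath {n : ℕ} (F : Euc n → Euc n) (σ : ℝ) (w : ℝ≥0 → Euc n) (x : Euc n)
    (u : ℝ≥0 → Euc n) : Prop where
  cont : Continuous u
  eq : ∀ t : ℝ≥0, u t = x + (∫ s in (0 : ℝ)..t, F (u s.toNNReal)) + σ • w t

variable {F : Euc n → Euc n} {L : ℝ≥0} {σ : ℝ} {w : ℝ≥0 → Euc n} {x x' : Euc n} {u u' : ℝ≥0 → Euc n}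

/-- Both paths are driven by the same noise, which cancels in the difference; this couples the
solutions from two starting points. -/
lemma LangevinPath.norm_sub_le (h : LangevinPath F σ w x u) (h' : LangevinPath F σ w x' u')
    (hF : LipschitzWith L F) (t : ℝ≥0) : ‖u t - u' t‖ ≤ Real.exp (L * t) * ‖x - x'‖ := by
  have hc := h.cont
  have hc' := h'.cont
  have hFc := hF.continuous
  have hφ : Continuous fun s : ℝ => ‖u s.toNNReal - u' s.toNNReal‖ := by fun_prop
  have hi : Continuous fun s : ℝ => F (u s.toNNReal) := by fun_prop
  have hi' : Continuous fun s : ℝ => F (u' s.toNNReal) := by fun_prop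
  have := gronwall_integral hφ (fun _ => norm_nonneg _) (A := ‖x - x'‖) (K := L) (T := t)
    (norm_nonneg _) L.coe_nonneg (fun s hs => ?_) t ⟨t.coe_nonneg, le_rfl⟩
  · rw [Real.toNNReal_coe] at this
    rwa [mul_comm]
  · have e : u s.toNNReal - u' s.toNNReal = (x - x') +
        ∫ r in (0 : ℝ)..s, (F (u r.toNNReal) - F (u' r.toNNReal)) := by
      rw [h.eq, h'.eq, Real.coe_toNNReal s hs.1, intervalIntegral.integral_sub
        (hi.intervalIntegrable _ _) (hi'.intervalIntegrable _ _)]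
      abel
    rw [e]
    refine (norm_add_le _ _).trans (add_le_add le_rfl ?_)
    rw [← intervalIntegral.integral_const_mul]
    refine intervalIntegral.norm_integral_le_of_norm_le hs.1
      (Filter.Eventually.of_forall fun r _ => ?_) ((hφ.const_smul (L : ℝ)).intervalIntegrable _ _)
    exact hF.norm_sub_le _ _

/-- What remains after removal of start and noise is the integral of the drift, which is estimated
by itself plus a forcing linear in `‖x‖` and in the noise; then Grönwall. -/
lemma LangevinPath.norm_sub_sub_le (h : LangevinPath F σ w x u) (hF : LipschitzWith L F)
    (hσ : 0 ≤ σ) (hw : Continuous w) (t : ℝ≥0) :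
    ‖u t - x - σ • w t‖ ≤ Real.exp (L * t) *
      (t * (‖F 0‖ + L * ‖x‖) + L * σ * ∫ s in (0 : ℝ)..t, ‖w s.toNNReal‖) := by
  have hc := h.cont
  have hFc := hF.continuous
  have hφ : Continuous fun s : ℝ => ‖u s.toNNReal - x - σ • w s.toNNReal‖ := by fun_prop
  have hi : Continuous fun s : ℝ => F (u s.toNNReal) := by fun_prop
  have hwn : Continuous fun s : ℝ => ‖w s.toNNReal‖ := by fun_prop
  have hI : ∀ s, 0 ≤ s → 0 ≤ ∫ r in (0 : ℝ)..s, ‖w r.toNNReal‖ := fun s hs =>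
    intervalIntegral.integral_nonneg hs fun r _ => norm_nonneg _
  have hIt := hI t t.coe_nonneg
  have := gronwall_integral hφ (fun _ => norm_nonneg _) (K := L) (T := t)
    (A := t * (‖F 0‖ + L * ‖x‖) + L * σ * ∫ s in (0 : ℝ)..t, ‖w s.toNNReal‖)
    (by positivity) L.coe_nonneg (fun s hs => ?_) t ⟨t.coe_nonneg, le_rfl⟩
  · rw [Real.toNNReal_coe] at this
    rwa [mul_comm]
  · have e : u s.toNNReal - x - σ • w s.toNNReal = ∫ r in (0 : ℝ)..s, F (u r.toNNReal) := by
      rw [h.eq, Real.coe_toNNReal s hs.1]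
      abel
    rw [e]
    have hbound : Continuous fun r : ℝ => (‖F 0‖ + L * ‖x‖) + (L * σ * ‖w r.toNNReal‖ +
        L * ‖u r.toNNReal - x - σ • w r.toNNReal‖) := by fun_prop
    have h1 : ‖∫ r in (0 : ℝ)..s, F (u r.toNNReal)‖ ≤ ∫ r in (0 : ℝ)..s,
        ((‖F 0‖ + L * ‖x‖) + (L * σ * ‖w r.toNNReal‖ +
          L * ‖u r.toNNReal - x - σ • w r.toNNReal‖)) := by
      refine intervalIntegral.norm_integral_le_of_norm_le hs.1
        (Filter.Eventually.of_forall fun r _ => ?_) (hbound.intervalIntegrable _ _)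
      have h2 : ‖F (u r.toNNReal)‖ ≤ ‖F 0‖ + L * ‖u r.toNNReal‖ := by
        have h3 := hF.norm_sub_le (u r.toNNReal) 0
        rw [sub_zero] at h3
        have h4 := _root_.norm_sub_norm_le (F (u r.toNNReal)) (F 0)
        linarith
      have h5 : ‖u r.toNNReal‖ ≤ ‖x‖ + σ * ‖w r.toNNReal‖ +
          ‖u r.toNNReal - x - σ • w r.toNNReal‖ := by
        have h6 : u r.toNNReal = x + σ • w r.toNNReal +
          (u r.toNNReal - x - σ • w r.toNNReal) := by abel
        conv_lhs => rw [h6]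
        refine (norm_add_le _ _).trans (add_le_add ((norm_add_le _ _).trans ?_) le_rfl)
        rw [norm_smul, Real.norm_of_nonneg hσ]
      have := mul_le_mul_of_nonneg_left h5 L.coe_nonneg
      linarith
    refine h1.trans ?_
    have i1 : IntervalIntegrable (fun r : ℝ => L * σ * ‖w r.toNNReal‖) volume 0 s :=
      (hwn.const_smul (L * σ : ℝ)).intervalIntegrable _ _
    have i2 : IntervalIntegrable (fun r : ℝ => L * ‖u r.toNNReal - x - σ • w r.toNNReal‖)
        volume 0 s := (hφ.const_smul (L : ℝ)).intervalIntegrable _ _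
    rw [intervalIntegral.integral_add (by simp) (i1.add i2), intervalIntegral.integral_add i1 i2,
      intervalIntegral.integral_const_mul, intervalIntegral.integral_const_mul,
      intervalIntegral.integral_const, sub_zero, smul_eq_mul, ← add_assoc]
    have h3 : ∫ r in (0 : ℝ)..s, ‖w r.toNNReal‖ ≤ ∫ r in (0 : ℝ)..t, ‖w r.toNNReal‖ :=
      intervalIntegral.integral_mono_interval le_rfl hs.1 hs.2
        (Filter.Eventually.of_forall fun r => norm_nonneg _) (hwn.intervalIntegrable _ _)
    gcongr
    exact hs.2

/-- Subtracting the noise leaves a differentiable path, so Duhamel's formula applies path by path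
and no stochastic integral occurs. -/
lemma LangevinPath.eq_duhamel {A : Euc n →L[ℝ] Euc n} (h : LangevinPath A σ w x u)
    (hw : Continuous w) (t : ℝ≥0) :
    u t = NormedSpace.exp ((t : ℝ) • A) x + (σ • w t + NormedSpace.exp ((t : ℝ) • A)
      (∫ s in (0 : ℝ)..t, NormedSpace.exp ((-s) • A) (σ • A (w s.toNNReal)))) := by
  have hc := h.cont
  have hi : Continuous fun s : ℝ => A (u s.toNNReal) := by fun_prop
  set z : ℝ → Euc n := fun t => x + ∫ s in (0 : ℝ)..t, A (u s.toNNReal) with hz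
  have hd : ∀ s, HasDerivAt z (A (u s.toNNReal)) s := fun s =>
    (intervalIntegral.integral_hasDerivAt_right (hi.intervalIntegrable _ _)
      hi.stronglyMeasurable.stronglyMeasurableAtFilter hi.continuousAt).const_add x
  have hzc : Continuous z := continuous_iff_continuousAt.2 fun s => (hd s).continuousAt
  have hu : ∀ s, 0 ≤ s → u s.toNNReal = z s + σ • w s.toNNReal := fun s hs => by
    rw [h.eq, Real.coe_toNNReal s hs]
  have h1 := duhamel A (z := z) (g := fun s => σ • A (w s.toNNReal)) (by fun_prop)
    (fun s hs => by
      have := (hd s).hasDerivWithinAt (s := Set.Ici s)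
      rwa [hu s hs, map_add, map_smul] at this) hzc t.coe_nonneg
  have h2 := hu t t.coe_nonneg
  rw [Real.toNNReal_coe] at h2
  rw [h2, h1]
  have h0 : z 0 = x := by simp [hz]
  rw [h0]
  abel

end LangevinPath

/-! ### Almost sure limits of centred Gaussians. -/

section GaussianLimit

open Filter Topology

variable {Ω : Type*} [MeasurableSpace Ω] {P : Measure Ω}

/-- An almost sure limit of centred real Gaussians is Gaussian. -/
lemma exists_map_eq_gaussianReal_of_tendsto [IsProbabilityMeasure P] {X : ℕ → Ω → ℝ} {Y : Ω → ℝ}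
    {v : ℕ → ℝ≥0} (hX : ∀ n, AEMeasurable (X n) P) (hY : AEMeasurable Y P)
    (hlaw : ∀ n, P.map (X n) = gaussianReal 0 (v n))
    (hlim : ∀ᵐ ω ∂P, Tendsto (fun n => X n ω) atTop (𝓝 (Y ω))) :
    ∃ v : ℝ≥0, P.map Y = gaussianReal 0 v := by
  have : IsProbabilityMeasure (P.map Y) := Measure.isProbabilityMeasure_map hY
  have hcf : ∀ (Z : Ω → ℝ), AEMeasurable Z P → ∀ s : ℝ,
      charFun (P.map Z) s = ∫ ω, Complex.exp (s * Z ω * Complex.I) ∂P := fun Z hZ s => by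
    rw [charFun_apply_real, integral_map hZ (Continuous.aestronglyMeasurable (by fun_prop))]
  have hconv : ∀ s : ℝ, Tendsto (fun n => Complex.exp (-(v n * s ^ 2 / 2) : ℝ)) atTop
      (𝓝 (charFun (P.map Y) s)) := by
    intro s
    have h1 : ∀ n, Complex.exp (-(v n * s ^ 2 / 2) : ℝ) = charFun (P.map (X n)) s := fun n => by
      rw [hlaw, charFun_gaussianReal]
      congr 1
      push_cast
      ring
    simp only [h1, hcf _ (hX _), hcf Y hY]
    refine tendsto_integral_of_dominated_convergence (fun _ => 1) (fun n => ?_)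
      (integrable_const _) (fun n => Eventually.of_forall fun ω => ?_) ?_
    · have := hX n
      exact (Complex.measurable_exp.comp_aemeasurable (by fun_prop)).aestronglyMeasurable
    · rw [← Complex.ofReal_mul, Complex.norm_exp_ofReal_mul_I]
    · filter_upwards [hlim] with ω hω
      have : Continuous fun y : ℝ => Complex.exp (s * y * Complex.I) := by fun_prop
      exact (this.tendsto _).comp hω
  have hre : ∀ s : ℝ, Tendsto (fun n => Real.exp (-(v n * s ^ 2 / 2))) atTop
      (𝓝 (charFun (P.map Y) s).re) := fun s => by
    refine ((Complex.continuous_re.tendsto _).comp (hconv s)).congr fun n => ?_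
    simp only [Function.comp_apply]
    exact Complex.exp_ofReal_re _
  set ρ := (charFun (P.map Y) 1).re with hρ
  have hρ0 : 0 ≤ ρ := ge_of_tendsto' (hre 1) fun n => (Real.exp_pos _).le
  -- Were the limit zero at `1`, the variances would diverge and the limiting characteristic
  -- function would have zero real part off `0`, against continuity at `0`. Positivity lets the
  -- logarithm turn convergence into that of the variances.
  have hρpos : 0 < ρ := by
    rcases hρ0.eq_or_lt with h0 | h0
    · exfalso
      have h1 := hre 1
      rw [← hρ, ← h0, Real.tendsto_exp_comp_nhds_zero] at h1
      have hz : ∀ s : ℝ, s ≠ 0 → (charFun (P.map Y) s).re = 0 := by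
        intro s hs
        refine tendsto_nhds_unique (hre s) (Real.tendsto_exp_comp_nhds_zero.2 ?_)
        have := h1.atBot_mul_const (show 0 < s ^ 2 by positivity)
        refine this.congr fun n => ?_
        ring
      have hcont : Continuous fun s => (charFun (P.map Y) s).re :=
        Complex.continuous_re.comp continuous_charFun
      have h2 : Tendsto (fun s => (charFun (P.map Y) s).re) (𝓝[≠] 0)
          (𝓝 (charFun (P.map Y) 0).re) := (hcont.tendsto 0).mono_left nhdsWithin_le_nhds
      have h3 : Tendsto (fun s => (charFun (P.map Y) s).re) (𝓝[≠] 0) (𝓝 0) :=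
        tendsto_const_nhds.congr' (eventually_nhdsWithin_of_forall fun s hs => (hz s hs).symm)
      have h4 := tendsto_nhds_unique h2 h3
      simp at h4
    · exact h0
  have hv : Tendsto (fun n => (v n : ℝ)) atTop (𝓝 (-2 * Real.log ρ)) := by
    have h1 := ((Real.continuousAt_log hρpos.ne').tendsto.comp (hre 1)).const_mul (-2)
    refine h1.congr fun n => ?_
    simp only [Function.comp_apply, Real.log_exp]
    ring
  have hv0 : 0 ≤ -2 * Real.log ρ := ge_of_tendsto' hv fun n => (v n).coe_nonneg
  refine ⟨(-2 * Real.log ρ).toNNReal, Measure.ext_of_charFun (funext fun s => ?_)⟩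
  refine tendsto_nhds_unique (hconv s) ?_
  rw [charFun_gaussianReal]
  have h5 : Continuous fun r : ℝ => Complex.exp (-(r * s ^ 2 / 2) : ℝ) := by fun_prop
  have h6 := (h5.tendsto _).comp hv
  rw [Real.coe_toNNReal _ hv0]
  refine Eq.subst (motive := fun z => Tendsto _ atTop (𝓝 z)) ?_ h6
  push_cast
  ring_nf

lemma hasGaussianLaw_of_tendsto [IsProbabilityMeasure P] {n : ℕ} {X : ℕ → Ω → Euc n}
    {Y : Ω → Euc n} (hX : ∀ k, HasGaussianLaw (X k) P) (hX0 : ∀ k, ∫ ω, X k ω ∂P = 0)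
    (hlim : ∀ᵐ ω ∂P, Tendsto (fun k => X k ω) atTop (𝓝 (Y ω))) : HasGaussianLaw Y P := by
  have hY : AEMeasurable Y P := aemeasurable_of_tendsto_metrizable_ae atTop
    (fun k => (hX k).aemeasurable) hlim
  refine ⟨isGaussian_of_map_eq_gaussianReal fun T => ?_⟩
  have h1 : ∀ k, P.map (fun ω => T (X k ω)) =
      gaussianReal 0 (Var[fun ω => T (X k ω); P]).toNNReal := fun k => by
    have h2 := ((hX k).map_fun T).map_eq_gaussianReal
    rw [T.integral_comp_comm (hX k).integrable, hX0, map_zero] at h2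
    exact h2
  obtain ⟨v, hv⟩ := exists_map_eq_gaussianReal_of_tendsto
    (fun k => ((hX k).map_fun T).aemeasurable) (T.continuous.measurable.comp_aemeasurable hY) h1
    (by
      filter_upwards [hlim] with ω hω
      exact (T.continuous.tendsto _).comp hω)
  refine ⟨0, v, ?_⟩
  rw [AEMeasurable.map_map_of_aemeasurable T.continuous.measurable.aemeasurable hY]
  exact hv

end GaussianLimit

/-! ### Laws and moments of Brownian motion. -/

section Brownian

open Filter Topology

variable {n : ℕ} {Ω : Type*} [MeasurableSpace Ω] {P : Measure Ω} {W : ℝ≥0 → Ω → Euc n}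

lemma IsBrownianEuc.aemeasurable (hW : IsBrownianEuc W P) (t : ℝ≥0) : AEMeasurable (W t) P := by
  have h : AEMeasurable (fun ω => (fun i => W t ω i : Fin n → ℝ)) P :=
    aemeasurable_pi_lambda _ fun i => (hW.coord i).toIsPreBrownianReal.aemeasurable t
  exact (PiLp.continuous_toLp 2 _).measurable.comp_aemeasurable h

lemma IsBrownianEuc.continuous (hW : IsBrownianEuc W P) :
    ∀ᵐ ω ∂P, Continuous fun t => W t ω := by
  have h := ae_all_iff.2 fun i => (hW.coord i).cont
  filter_upwards [h] with ω hω
  exact (PiLp.continuous_toLp 2 _).comp (continuous_pi hω)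

/-- The law of Brownian motion at time `t` is the scaled standard Gaussian. -/
lemma IsBrownianEuc.map_eq [IsProbabilityMeasure P] (hW : IsBrownianEuc W P) (t : ℝ≥0) :
    P.map (W t) = (stdGaussian (Euc n)).map (fun z => Real.sqrt t • z) := by
  have hm : ∀ i, AEMeasurable (fun ω => W t ω i) P := fun i =>
    (hW.coord i).toIsPreBrownianReal.aemeasurable t
  have hind : iIndepFun (fun i ω => W t ω i) P :=
    hW.indep.comp (fun _ (w : ℝ≥0 → ℝ) => w t) fun _ => measurable_pi_apply t
  have h1 := (iIndepFun_iff_map_fun_eq_pi_map hm).1 hind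
  have h2 : ∀ i, P.map (fun ω => W t ω i) = gaussianReal 0 t := fun i =>
    ((hW.coord i).toIsPreBrownianReal.hasLaw_eval t).map_eq
  simp only [h2] at h1
  have h3 : P.map (W t) = (Measure.pi fun _ : Fin n => gaussianReal 0 t).map (WithLp.toLp 2) := by
    rw [← h1, AEMeasurable.map_map_of_aemeasurable
      (PiLp.continuous_toLp 2 _).measurable.aemeasurable (aemeasurable_pi_lambda _ hm)]
    rfl
  rw [h3]
  have : IsProbabilityMeasure ((Measure.pi fun _ : Fin n => gaussianReal 0 t).map
      (WithLp.toLp 2)) := Measure.isProbabilityMeasure_map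
        (PiLp.continuous_toLp 2 _).measurable.aemeasurable
  have : IsProbabilityMeasure ((stdGaussian (Euc n)).map fun z => Real.sqrt t • z) :=
    Measure.isProbabilityMeasure_map (by fun_prop)
  refine Measure.ext_of_charFun (funext fun ξ => ?_)
  rw [charFun_map_smul, charFun_stdGaussian, norm_smul, Real.norm_of_nonneg (Real.sqrt_nonneg _)]
  simp_rw [charFun_pi, charFun_gaussianReal, ← Complex.exp_sum]
  congr 1
  have hsq : ((Real.sqrt t : ℝ) : ℂ) ^ 2 = t := by
    rw [← Complex.ofReal_pow, Real.sq_sqrt t.coe_nonneg]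
  have hn : (‖ξ‖ : ℂ) ^ 2 = ∑ i, (ξ i : ℂ) ^ 2 := by
    rw [← Complex.ofReal_pow, EuclideanSpace.real_norm_sq_eq]
    push_cast
    rfl
  rw [Complex.ofReal_mul, mul_pow, hsq, hn, Finset.mul_sum, ← Finset.sum_neg_distrib,
    Finset.sum_div]
  refine Finset.sum_congr rfl fun i _ => ?_
  simp only [Complex.ofReal_zero, mul_zero, zero_mul, zero_sub]
  ring

lemma IsBrownianEuc.integral_comp [IsProbabilityMeasure P] (hW : IsBrownianEuc W P) (t : ℝ≥0)
    {f : Euc n → ℝ} (hf : Measurable f) :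
    ∫ ω, f (W t ω) ∂P = ∫ z, f (Real.sqrt t • z) ∂(stdGaussian (Euc n)) := by
  rw [← integral_map (hW.aemeasurable t) hf.aestronglyMeasurable, hW.map_eq,
    integral_map (by fun_prop) hf.aestronglyMeasurable]

/-- This symmetry removes the term of order `√h` from the short-time expansion. -/
lemma IsBrownianEuc.integral_comp_neg [IsProbabilityMeasure P] (hW : IsBrownianEuc W P) (t : ℝ≥0)
    {f : Euc n → ℝ} (hf : Measurable f) : ∫ ω, f (-W t ω) ∂P = ∫ ω, f (W t ω) ∂P := by
  have hf' : Measurable fun z => f (-z) := hf.comp measurable_neg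
  have hf'' : Measurable fun z => f (Real.sqrt t • z) := hf.comp (by fun_prop)
  rw [hW.integral_comp t hf', hW.integral_comp t hf]
  have h := stdGaussian_map (LinearIsometryEquiv.neg ℝ (E := Euc n))
  conv_rhs => rw [← h]
  rw [integral_map (by fun_prop) hf''.aestronglyMeasurable]
  simp

lemma IsBrownianEuc.lintegral_norm_pow_le [IsProbabilityMeasure P] (hW : IsBrownianEuc W P)
    (t : ℝ≥0) (q : ℕ) : ∫⁻ ω, ENNReal.ofReal (‖W t ω‖ ^ q) ∂P =
      ENNReal.ofReal (Real.sqrt t ^ q * ∫ z, ‖z‖ ^ q ∂(stdGaussian (Euc n))) := by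
  have hm : Measurable fun z : Euc n => ENNReal.ofReal (‖z‖ ^ q) := by fun_prop
  have hi : Integrable (fun z : Euc n => ‖z‖ ^ q) (stdGaussian (Euc n)) :=
    (IsGaussian.memLp_id (stdGaussian (Euc n)) q (ENNReal.natCast_ne_top q)).integrable_norm_pow'
  rw [← lintegral_map' (f := fun z : Euc n => ENNReal.ofReal (‖z‖ ^ q)) hm.aemeasurable
    (hW.aemeasurable t), hW.map_eq, lintegral_map hm (by fun_prop)]
  simp only [norm_smul, Real.norm_of_nonneg (Real.sqrt_nonneg _), mul_pow]
  rw [← integral_const_mul, ofReal_integral_eq_lintegral_ofReal (hi.const_mul _)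
    (Eventually.of_forall fun z => by positivity)]

/-- Moments of the time average of `|W|`. -/
lemma lintegral_integral_norm_pow_le {h : ℝ≥0} (hh : 0 < h) (hWm : ∀ t, AEMeasurable (W t) P)
    (hWc : ∀ᵐ ω ∂P, Continuous fun t => W t ω) {q : ℕ} {m : ℝ≥0∞}
    (hm : ∀ t ≤ h, ∫⁻ ω, ENNReal.ofReal (‖W t ω‖ ^ q) ∂P ≤ m) :
    AEMeasurable (fun ω => (h : ℝ)⁻¹ * ∫ s in (0 : ℝ)..h, ‖W s.toNNReal ω‖) P ∧
    ∫⁻ ω, ENNReal.ofReal (((h : ℝ)⁻¹ * ∫ s in (0 : ℝ)..h, ‖W s.toNNReal ω‖) ^ q) ∂P ≤ m := by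
  -- Riemann sums involve finitely many times, so measurability of each `W t` suffices. Jensen's
  -- inequality bounds their moments and Fatou's lemma passes to the limit.
  set τ : ℕ → ℕ → ℝ≥0 := fun N k => k * (h / (N + 1 : ℕ)) with hτ
  set R : ℕ → Ω → ℝ := fun N ω => ∑ k ∈ Finset.range (N + 1),
    (1 / (N + 1 : ℕ) : ℝ) * ‖W (τ N k) ω‖ with hR
  have hRm : ∀ N, AEMeasurable (R N) P := fun N =>
    Finset.aemeasurable_fun_sum _ fun k _ => ((hWm _).norm).const_mul _
  have hlim : ∀ᵐ ω ∂P, Tendsto (fun N => R N ω) atTop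
      (𝓝 ((h : ℝ)⁻¹ * ∫ s in (0 : ℝ)..h, ‖W s.toNNReal ω‖)) := by
    filter_upwards [hWc] with ω hω
    have hg : Continuous fun s : ℝ => ‖W s.toNNReal ω‖ :=
      (hω.comp continuous_real_toNNReal).norm
    refine ((tendsto_riemannSum hg h.coe_nonneg).const_mul (h : ℝ)⁻¹).congr fun N => ?_
    rw [hR, Finset.mul_sum]
    refine Finset.sum_congr rfl fun k _ => ?_
    have h1 : ((k : ℝ) * (h / (N + 1 : ℕ))).toNNReal = τ N k := by
      rw [show (k : ℝ) * (h / (N + 1 : ℕ)) = ((τ N k : ℝ≥0) : ℝ) by simp [hτ],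
        Real.toNNReal_coe]
    have h2 : (h : ℝ) ≠ 0 := by exact_mod_cast hh.ne'
    rw [h1, smul_eq_mul]
    field_simp
  refine ⟨aemeasurable_of_tendsto_metrizable_ae atTop hRm hlim, ?_⟩
  have hfatou := lintegral_liminf_le' (μ := P) (u := atTop)
    (f := fun N ω => ENNReal.ofReal (R N ω ^ q)) (fun N => ((hRm N).pow_const q).ennreal_ofReal)
  have e : ∫⁻ ω, ENNReal.ofReal (((h : ℝ)⁻¹ * ∫ s in (0 : ℝ)..h, ‖W s.toNNReal ω‖) ^ q) ∂P =
      ∫⁻ ω, liminf (fun N => ENNReal.ofReal (R N ω ^ q)) atTop ∂P := by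
    refine lintegral_congr_ae ?_
    filter_upwards [hlim] with ω hω
    exact ((ENNReal.tendsto_ofReal (hω.pow q)).liminf_eq).symm
  rw [e]
  refine hfatou.trans (liminf_le_of_le (by isBoundedDefault) fun b hb => ?_)
  obtain ⟨N, hN⟩ := hb.exists
  refine hN.trans ?_
  have hw : ∑ _k ∈ Finset.range (N + 1), (1 / (N + 1 : ℕ) : ℝ) = 1 := by
    rw [Finset.sum_const, Finset.card_range, nsmul_eq_mul]
    field_simp
  calc ∫⁻ ω, ENNReal.ofReal (R N ω ^ q) ∂P
      ≤ ∫⁻ ω, ∑ k ∈ Finset.range (N + 1), ENNReal.ofReal (1 / (N + 1 : ℕ) : ℝ) *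
          ENNReal.ofReal (‖W (τ N k) ω‖ ^ q) ∂P := by
        refine lintegral_mono fun ω => ?_
        refine (ENNReal.ofReal_le_ofReal (Real.pow_arith_mean_le_arith_mean_pow
          (Finset.range (N + 1)) (fun _ => (1 / (N + 1 : ℕ) : ℝ)) (fun k => ‖W (τ N k) ω‖)
          (fun _ _ => by positivity) hw (fun _ _ => norm_nonneg _) q)).trans (le_of_eq ?_)
        rw [ENNReal.ofReal_sum_of_nonneg fun _ _ => by positivity]
        exact Finset.sum_congr rfl fun k _ => ENNReal.ofReal_mul (by positivity)
    _ = ∑ k ∈ Finset.range (N + 1), ENNReal.ofReal (1 / (N + 1 : ℕ) : ℝ) *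
          ∫⁻ ω, ENNReal.ofReal (‖W (τ N k) ω‖ ^ q) ∂P := by
        rw [lintegral_finsetSum' _ fun k _ =>
          (((hWm _).norm.pow_const q).ennreal_ofReal).const_mul _]
        exact Finset.sum_congr rfl fun k _ =>
          lintegral_const_mul'' _ ((hWm _).norm.pow_const q).ennreal_ofReal
    _ ≤ ∑ k ∈ Finset.range (N + 1), ENNReal.ofReal (1 / (N + 1 : ℕ) : ℝ) * m := by
        refine Finset.sum_le_sum fun k hk => ?_
        gcongr
        refine hm _ ?_
        rw [hτ]
        have hk' : (k : ℝ≥0) ≤ (N + 1 : ℕ) := by exact_mod_cast (Finset.mem_range.1 hk).le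
        calc (k : ℝ≥0) * (h / (N + 1 : ℕ)) ≤ (N + 1 : ℕ) * (h / (N + 1 : ℕ)) := by gcongr
          _ = h := by
            rw [mul_div_cancel₀]
            exact_mod_cast Nat.succ_ne_zero N
    _ = m := by
        rw [← Finset.sum_mul, ← ENNReal.ofReal_sum_of_nonneg fun _ _ => by positivity, hw]
        simp

end Brownian

/-! ### Linear drift: the kernel preserves Gaussian laws. -/

section LinearDrift

open Filter Topology

variable {n : ℕ} {Ω : Type*} [MeasurableSpace Ω] {P : Measure Ω} {W : ℝ≥0 → Ω → Euc n}

lemma IsBrownianEuc.memLp_two [IsProbabilityMeasure P] (hW : IsBrownianEuc W P) (t : ℝ≥0) :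
    MemLp (W t) 2 P := by
  have h : MemLp id 2 (P.map (W t)) := by
    rw [hW.map_eq]
    have : IsGaussian ((stdGaussian (Euc n)).map fun z => Real.sqrt t • z) :=
      isGaussian_map (Real.sqrt t • ContinuousLinearMap.id ℝ (Euc n))
    exact IsGaussian.memLp_id _ 2 (by simp)
  exact (memLp_map_measure_iff aestronglyMeasurable_id (hW.aemeasurable t)).1 h

lemma IsBrownianEuc.integral_eq_zero [IsProbabilityMeasure P] (hW : IsBrownianEuc W P) (t : ℝ≥0) :
    ∫ ω, W t ω ∂P = 0 := by
  rw [← integral_map (f := fun z => z) (hW.aemeasurable t) aestronglyMeasurable_id, hW.map_eq,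
    integral_map (f := fun z => z) (by fun_prop) aestronglyMeasurable_id, integral_smul, integral_id_stdGaussian,
    smul_zero]

/-- Linear functionals of finitely many values of Brownian motion are centred Gaussian. -/
lemma IsBrownianEuc.hasGaussianLaw_sum [IsProbabilityMeasure P] (hW : IsBrownianEuc W P)
    {ι : Type*} [Fintype ι] (τ : ι → ℝ≥0) (G : ι → Euc n →L[ℝ] Euc n) :
    HasGaussianLaw (fun ω => ∑ k, G k (W (τ k) ω)) P ∧ ∫ ω, ∑ k, G k (W (τ k) ω) ∂P = 0 := by
  classical
  constructor
  -- The coordinate processes restricted to the times in `I` are independent Gaussian vectors, and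
  -- the sum is linear in them.
  · set I : Finset ℝ≥0 := Finset.univ.image τ
    have hI : ∀ k, τ k ∈ I := fun k => Finset.mem_image_of_mem τ (Finset.mem_univ k)
    have h1 : ∀ i, HasGaussianLaw (fun ω => I.restrict (fun t => W t ω i)) P := fun i =>
      ((hW.coord i).toIsPreBrownianReal.hasLaw I).hasGaussianLaw
    have h2 : iIndepFun (fun i ω => I.restrict (fun t => W t ω i)) P :=
      hW.indep.comp (fun _ (w : ℝ≥0 → ℝ) => I.restrict w) fun _ => Finset.measurable_restrict I
    have h3 := iIndepFun.hasGaussianLaw h1 h2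
    let T : (Fin n → I → ℝ) →ₗ[ℝ] Euc n :=
      { toFun := fun w => ∑ k, G k (WithLp.toLp 2 fun i => w i ⟨τ k, hI k⟩)
        map_add' := fun w w' => by
          rw [← Finset.sum_add_distrib]
          refine Finset.sum_congr rfl fun k _ => ?_
          rw [← map_add]
          rfl
        map_smul' := fun c w => by
          rw [RingHom.id_apply, Finset.smul_sum]
          refine Finset.sum_congr rfl fun k _ => ?_
          rw [← map_smul]
          rfl }
    exact h3.map_fun (LinearMap.toContinuousLinearMap T)
  · rw [integral_finsetSum _ fun k _ =>
      (G k).integrable_comp ((hW.memLp_two (τ k)).integrable (by norm_num))]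
    refine Finset.sum_eq_zero fun k _ => ?_
    rw [(G k).integral_comp_comm ((hW.memLp_two (τ k)).integrable (by norm_num)),
      hW.integral_eq_zero, map_zero]

lemma continuous_exp_neg_smul (A : Euc n →L[ℝ] Euc n) :
    Continuous fun s : ℝ => NormedSpace.exp ((-s) • A) := by
  have h : Continuous fun s : ℝ => NormedSpace.exp (s • A) :=
    continuous_iff_continuousAt.2 fun s => (hasDerivAt_exp_smul_const (𝕂 := ℝ) A s).continuousAt
  exact h.comp continuous_neg

/-- The Ornstein–Uhlenbeck noise is Gaussian. -/
lemma IsBrownianEuc.hasGaussianLaw_duhamel [IsProbabilityMeasure P] (hW : IsBrownianEuc W P)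
    (σ : ℝ) (A : Euc n →L[ℝ] Euc n) (t : ℝ≥0) :
    HasGaussianLaw (fun ω => σ • W t ω + NormedSpace.exp ((t : ℝ) • A)
      (∫ s in (0 : ℝ)..t, NormedSpace.exp ((-s) • A) (σ • A (W s.toNNReal ω)))) P := by
  -- The index `none` carries the term `σ W_t`, the indices `some k` the Riemann sum of the
  -- integral.
  set τ : (N : ℕ) → Option (Fin (N + 1)) → ℝ≥0 := fun N k =>
    k.elim t fun k => ((k : ℕ) * ((t : ℝ) / (N + 1 : ℕ))).toNNReal with hτ
  set G : (N : ℕ) → Option (Fin (N + 1)) → Euc n →L[ℝ] Euc n := fun N k =>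
    k.elim (σ • ContinuousLinearMap.id ℝ (Euc n)) fun k =>
      (NormedSpace.exp ((t : ℝ) • A)).comp (((t : ℝ) / (N + 1 : ℕ)) •
        (NormedSpace.exp ((-((k : ℕ) * ((t : ℝ) / (N + 1 : ℕ)))) • A)).comp (σ • A)) with hG
  refine hasGaussianLaw_of_tendsto (X := fun N ω => ∑ k, G N k (W (τ N k) ω))
    (fun N => (hW.hasGaussianLaw_sum (τ N) (G N)).1)
    (fun N => (hW.hasGaussianLaw_sum (τ N) (G N)).2) ?_
  filter_upwards [hW.continuous] with ω hω
  have hg : Continuous fun s : ℝ => NormedSpace.exp ((-s) • A) (σ • A (W s.toNNReal ω)) := by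
    have h1 : Continuous fun s : ℝ => W s.toNNReal ω := hω.comp continuous_real_toNNReal
    exact (continuous_exp_neg_smul A).clm_apply ((A.continuous.comp h1).const_smul σ)
  have h2 := (((NormedSpace.exp ((t : ℝ) • A)).continuous.tendsto _).comp
    (tendsto_riemannSum hg t.coe_nonneg)).const_add (σ • W t ω)
  refine h2.congr fun N => ?_
  rw [Fintype.sum_option]
  simp only [hG, hτ, Option.elim, Function.comp_apply]
  congr 1
  rw [map_sum, Finset.sum_range]
  refine Finset.sum_congr rfl fun k _ => ?_
  simp

/-- Over an affine Gaussian kernel Gaussian laws are preserved. -/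
lemma isGaussian_comp_of_affine {k : Kernel (Euc n) (Euc n)} [IsSFiniteKernel k]
    {Φ : Euc n →L[ℝ] Euc n} {ν : Measure (Euc n)} [IsGaussian ν]
    (hk : ∀ x, k x = ν.map fun z => Φ x + z) (μ : Measure (Euc n)) [IsGaussian μ] :
    IsGaussian (k ∘ₘ μ) := by
  have e : k ∘ₘ μ = (μ.prod ν).map
      (Φ.comp (ContinuousLinearMap.fst ℝ (Euc n) (Euc n)) +
        ContinuousLinearMap.snd ℝ (Euc n) (Euc n)) := by
    ext s hs
    rw [Measure.bind_apply hs k.measurable.aemeasurable, Measure.map_apply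
      (ContinuousLinearMap.continuous _).measurable hs, Measure.prod_apply
      ((ContinuousLinearMap.continuous _).measurable hs)]
    refine lintegral_congr fun x => ?_
    rw [hk, Measure.map_apply (by fun_prop) hs]
    rfl
  rw [e]
  infer_instance

/-- For a linear drift the Langevin kernel preserves Gaussian laws. -/
lemma IsLangevinKernel.isGaussian_comp {F : Euc n → Euc n} {b : ℝ}
    {K : ℝ≥0 → Kernel (Euc n) (Euc n)} (hK : IsLangevinKernel F b K) (hF : IsLinearMap ℝ F)
    (t : ℝ≥0) (μ : Measure (Euc n)) (hμ : IsGaussian μ) : IsGaussian (K t ∘ₘ μ) := by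
  obtain ⟨Ω, _, P, W, u, hP, hW, hum, hu, hKu⟩ := hK
  let A : Euc n →L[ℝ] Euc n := LinearMap.toContinuousLinearMap (hF.mk' F)
  have hAF : (A : Euc n → Euc n) = F := rfl
  set Y : Ω → Euc n := fun ω => Real.sqrt (2 * b) • W t ω + NormedSpace.exp ((t : ℝ) • A)
      (∫ s in (0 : ℝ)..t, NormedSpace.exp ((-s) • A) (Real.sqrt (2 * b) • A (W s.toNNReal ω)))
  have hY : HasGaussianLaw Y P := hW.hasGaussianLaw_duhamel _ A t
  have := hY.isGaussian_map
  have : IsMarkovKernel (K t) := ⟨fun x => by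
    rw [hKu]; exact Measure.isProbabilityMeasure_map (hum x t).aemeasurable⟩
  refine isGaussian_comp_of_affine (Φ := NormedSpace.exp ((t : ℝ) • A)) (ν := P.map Y)
    (fun x => ?_) μ
  rw [hKu, AEMeasurable.map_map_of_aemeasurable (by fun_prop) hY.aemeasurable]
  refine Measure.map_congr ?_
  filter_upwards [hu x, hW.continuous] with ω hω hWω
  have hp : LangevinPath A (Real.sqrt (2 * b)) (fun t => W t ω) x (fun t => u x t ω) :=
    ⟨hω.1, hω.2⟩
  exact hp.eq_duhamel hWω t

end LinearDrift

/-! ### Regularity and short-time behaviour of the Langevin kernel. -/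

section LangevinKernel

open Filter Topology

variable {n : ℕ} {Ω : Type*} [MeasurableSpace Ω] {P : Measure Ω} {W : ℝ≥0 → Ω → Euc n}

/-- The size of a Brownian path over `[0, h]`. -/
def noiseSize {n : ℕ} (h : ℝ≥0) (w : ℝ≥0 → Euc n) : ℝ :=
  1 + ‖w h‖ + (h : ℝ)⁻¹ * ∫ s in (0 : ℝ)..h, ‖w s.toNNReal‖

lemma average_norm_nonneg (h : ℝ≥0) (w : ℝ≥0 → Euc n) :
    0 ≤ (h : ℝ)⁻¹ * ∫ s in (0 : ℝ)..h, ‖w s.toNNReal‖ :=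
  mul_nonneg (inv_nonneg.2 h.coe_nonneg)
    (intervalIntegral.integral_nonneg h.coe_nonneg fun _ _ => norm_nonneg _)

lemma one_le_noiseSize (h : ℝ≥0) (w : ℝ≥0 → Euc n) : 1 ≤ noiseSize h w := by
  have := average_norm_nonneg h w
  have := norm_nonneg (w h)
  rw [noiseSize]
  linarith

lemma add_pow_le_three_pow {a b : ℝ} (ha : 0 ≤ a) (hb : 0 ≤ b) (q : ℕ) :
    (1 + a + b) ^ q ≤ 3 ^ q * (1 + a ^ q + b ^ q) := by
  have h1 : 1 + a + b ≤ 3 * max 1 (max a b) := by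
    have h2 := le_max_left 1 (max a b)
    have h3 := (le_max_left a b).trans (le_max_right 1 (max a b))
    have h4 := (le_max_right a b).trans (le_max_right 1 (max a b))
    linarith
  refine (pow_le_pow_left₀ (by positivity) h1 q).trans ?_
  rw [mul_pow]
  gcongr
  have ha' : 0 ≤ a ^ q := by positivity
  have hb' : 0 ≤ b ^ q := by positivity
  rcases max_choice 1 (max a b) with h | h
  · rw [h, one_pow]; linarith
  · rw [h]
    rcases max_choice a b with h | h <;> rw [h] <;> linarith

/-- The bound is uniform in `h ≤ T` because `noiseSize` contains the time average of `‖w‖` and not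
its integral divided by a smaller power of time. -/
lemma IsBrownianEuc.exists_noiseSize_moment [IsProbabilityMeasure P] (hW : IsBrownianEuc W P)
    (T : ℝ≥0) : ∃ m : ℕ → ℝ, ∀ h, 0 < h → h ≤ T → ∀ q : ℕ,
      Integrable (fun ω => noiseSize h (fun t => W t ω) ^ q) P ∧
      ∫ ω, noiseSize h (fun t => W t ω) ^ q ∂P ≤ m q := by
  set g : ℕ → ℝ := fun q => Real.sqrt T ^ q * ∫ z, ‖z‖ ^ q ∂(stdGaussian (Euc n)) with hg
  have hg0 : ∀ q, 0 ≤ g q := fun q => mul_nonneg (by positivity)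
    (integral_nonneg fun z => by positivity)
  refine ⟨fun q => 3 ^ q * (1 + g q + g q), fun h hh hT q => ?_⟩
  have hmom : ∀ t ≤ h, ∫⁻ ω, ENNReal.ofReal (‖W t ω‖ ^ q) ∂P ≤ ENNReal.ofReal (g q) := by
    intro t ht
    rw [hW.lintegral_norm_pow_le t q]
    refine ENNReal.ofReal_le_ofReal ?_
    have : Real.sqrt t ≤ Real.sqrt T := Real.sqrt_le_sqrt (by exact_mod_cast ht.trans hT)
    have h0 : 0 ≤ ∫ z, ‖z‖ ^ q ∂(stdGaussian (Euc n)) := integral_nonneg fun z => by positivity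
    exact mul_le_mul_of_nonneg_right (pow_le_pow_left₀ (Real.sqrt_nonneg _) this q) h0
  clear_value g
  obtain ⟨hJm, hJ⟩ := lintegral_integral_norm_pow_le hh hW.aemeasurable hW.continuous hmom
  have hQm : AEMeasurable (fun ω => noiseSize h (fun t => W t ω)) P :=
    ((hW.aemeasurable h).norm.const_add 1).add hJm
  have hpos : ∀ ω, 0 ≤ noiseSize h (fun t => W t ω) ^ q := fun ω =>
    pow_nonneg (zero_le_one.trans (one_le_noiseSize h _)) q
  have hle : ∫⁻ ω, ENNReal.ofReal (noiseSize h (fun t => W t ω) ^ q) ∂P ≤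
      ENNReal.ofReal (3 ^ q * (1 + g q + g q)) := by
    have hWh := ((hW.aemeasurable h).norm.pow_const q).ennreal_ofReal
    calc _ ≤ ∫⁻ ω, ENNReal.ofReal (3 ^ q) * (1 + ENNReal.ofReal (‖W h ω‖ ^ q) + ENNReal.ofReal
          (((h : ℝ)⁻¹ * ∫ s in (0 : ℝ)..h, ‖W s.toNNReal ω‖) ^ q)) ∂P := by
          refine lintegral_mono fun ω => ?_
          have hJ0 := average_norm_nonneg h fun t => W t ω
          refine (ENNReal.ofReal_le_ofReal
            (add_pow_le_three_pow (norm_nonneg (W h ω)) hJ0 q)).trans (le_of_eq ?_)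
          rw [ENNReal.ofReal_mul (by positivity), ENNReal.ofReal_add (by positivity)
            (by positivity), ENNReal.ofReal_add zero_le_one (by positivity), ENNReal.ofReal_one]
      _ = ENNReal.ofReal (3 ^ q) * (1 + ∫⁻ ω, ENNReal.ofReal (‖W h ω‖ ^ q) ∂P + ∫⁻ ω,
          ENNReal.ofReal (((h : ℝ)⁻¹ * ∫ s in (0 : ℝ)..h, ‖W s.toNNReal ω‖) ^ q) ∂P) := by
          rw [lintegral_const_mul' _ _ ENNReal.ofReal_ne_top,
            lintegral_add_left' (hWh.const_add 1), lintegral_add_left' aemeasurable_const]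
          simp
      _ ≤ ENNReal.ofReal (3 ^ q) * (1 + ENNReal.ofReal (g q) + ENNReal.ofReal (g q)) := by
          gcongr
          exact hmom h le_rfl
      _ = _ := by
          rw [ENNReal.ofReal_mul (by positivity), ENNReal.ofReal_add (add_nonneg zero_le_one (hg0 q))
            (hg0 q), ENNReal.ofReal_add zero_le_one (hg0 q), ENNReal.ofReal_one]
  have hQq : AEStronglyMeasurable (fun ω => noiseSize h (fun t => W t ω) ^ q) P :=
    (hQm.pow_const q).aestronglyMeasurable
  refine ⟨⟨hQq, ?_⟩, ?_⟩
  · rw [hasFiniteIntegral_iff_ofReal (Eventually.of_forall hpos)]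
    exact hle.trans_lt ENNReal.ofReal_lt_top
  · rw [integral_eq_lintegral_of_nonneg_ae (Eventually.of_forall hpos) hQq]
    exact ENNReal.toReal_le_of_le_ofReal
      (mul_nonneg (by positivity) (by linarith [hg0 q])) hle

/-- Growth constant of the displacement of a Langevin path. -/
def pathConst {n : ℕ} (F : Euc n → Euc n) (L : ℝ≥0) (σ : ℝ) (T : ℝ≥0) : ℝ :=
  Real.exp (L * T) * (‖F 0‖ + L + L * σ)

variable {F : Euc n → Euc n} {L : ℝ≥0} {σ : ℝ} {w : ℝ≥0 → Euc n} {x : Euc n} {u : ℝ≥0 → Euc n}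

lemma pathConst_nonneg (F : Euc n → Euc n) (L : ℝ≥0) (hσ : 0 ≤ σ) (T : ℝ≥0) :
    0 ≤ pathConst F L σ T := by
  unfold pathConst; positivity

/-- Writing the time integral as `h` times the average extracts the factor `h`. -/
lemma LangevinPath.displacement_le (hp : LangevinPath F σ w x u) (hF : LipschitzWith L F)
    (hσ : 0 ≤ σ) (hw : Continuous w) {h T : ℝ≥0} (hh : 0 < h) (hT : h ≤ T) :
    ‖u h - x - σ • w h‖ ≤ pathConst F L σ T * h * ((1 + ‖x‖) * noiseSize h w) := by
  refine (hp.norm_sub_sub_le hF hσ hw h).trans ?_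
  have hJ := average_norm_nonneg h w
  have hQ := one_le_noiseSize h w
  set J := (h : ℝ)⁻¹ * ∫ s in (0 : ℝ)..h, ‖w s.toNNReal‖ with hJdef
  have hh' : (h : ℝ) ≠ 0 := by exact_mod_cast hh.ne'
  have e : ∫ s in (0 : ℝ)..h, ‖w s.toNNReal‖ = h * J := by
    rw [hJdef, ← mul_assoc, mul_inv_cancel₀ hh', one_mul]
  have hJQ : J ≤ noiseSize h w := by
    rw [noiseSize]
    have := norm_nonneg (w h)
    linarith
  set Q := noiseSize h w
  have hx := norm_nonneg x
  have hXQ : 1 + ‖x‖ ≤ (1 + ‖x‖) * Q := le_mul_of_one_le_right (by positivity) hQ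
  have hQX : Q ≤ (1 + ‖x‖) * Q := le_mul_of_one_le_left (by positivity) (by linarith)
  rw [e, pathConst]
  have hL := L.coe_nonneg
  have h1 : ‖F 0‖ + L * ‖x‖ ≤ (‖F 0‖ + L) * ((1 + ‖x‖) * Q) := by
    have := mul_le_mul_of_nonneg_left hXQ (add_nonneg (norm_nonneg (F 0)) hL)
    have h2 : 0 ≤ ‖F 0‖ * ‖x‖ := by positivity
    linarith
  have h3 : L * σ * J ≤ L * σ * ((1 + ‖x‖) * Q) := by
    have : J ≤ (1 + ‖x‖) * Q := hJQ.trans hQX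
    gcongr
  have h4 : Real.exp (L * h) ≤ Real.exp (L * T) := by
    gcongr
  calc _ = Real.exp (L * h) * (h * (‖F 0‖ + L * ‖x‖ + L * σ * J)) := by ring
    _ ≤ Real.exp (L * T) * (h * ((‖F 0‖ + L) * ((1 + ‖x‖) * Q) + L * σ * ((1 + ‖x‖) * Q))) := by
      gcongr
    _ = _ := by ring

lemma one_add_norm_add_le (hσ : 0 ≤ σ) (h : ℝ≥0) (w : ℝ≥0 → Euc n) (x : Euc n) :
    1 + ‖x + σ • w h‖ ≤ (1 + σ) * ((1 + ‖x‖) * noiseSize h w) := by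
  have hJ := average_norm_nonneg h w
  have hQ := one_le_noiseSize h w
  have hw : ‖w h‖ ≤ noiseSize h w := by rw [noiseSize]; linarith
  have hx := norm_nonneg x
  have h1 := norm_add_le x (σ • w h)
  rw [norm_smul, Real.norm_of_nonneg hσ] at h1
  have hXQ : 1 + ‖x‖ ≤ (1 + ‖x‖) * noiseSize h w := le_mul_of_one_le_right (by positivity) hQ
  have hQX : noiseSize h w ≤ (1 + ‖x‖) * noiseSize h w :=
    le_mul_of_one_le_left (by positivity) (by linarith)
  have := mul_le_mul_of_nonneg_left (hw.trans hQX) hσ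
  linarith

lemma LangevinPath.one_add_norm_le (hp : LangevinPath F σ w x u) (hF : LipschitzWith L F)
    (hσ : 0 ≤ σ) (hw : Continuous w) {h T : ℝ≥0} (hh : 0 < h) (hT : h ≤ T) :
    1 + ‖u h‖ ≤ (1 + σ + pathConst F L σ T * T) * ((1 + ‖x‖) * noiseSize h w) := by
  have h1 := hp.displacement_le hF hσ hw hh hT
  have h2 := one_add_norm_add_le hσ h w x
  have hQ := zero_le_one.trans (one_le_noiseSize h w)
  have hc := pathConst_nonneg F L hσ T
  have h3 : pathConst F L σ T * h * ((1 + ‖x‖) * noiseSize h w) ≤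
      pathConst F L σ T * T * ((1 + ‖x‖) * noiseSize h w) := by
    have : (h : ℝ) ≤ T := by exact_mod_cast hT
    gcongr
  have h4 : ‖u h‖ ≤ ‖x + σ • w h‖ + ‖u h - x - σ • w h‖ := by
    have e : u h = (x + σ • w h) + (u h - x - σ • w h) := by abel
    conv_lhs => rw [e]
    exact norm_add_le _ _
  rw [add_mul]
  linarith

/-- Over short times the Langevin kernels are regular and nearly the identity, uniformly. -/
lemma IsLangevinKernel.exists_regular {b : ℝ} {K : ℝ≥0 → Kernel (Euc n) (Euc n)}
    (hK : IsLangevinKernel F b K) (hF : LipschitzWith L F) (T : ℝ≥0) :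
    ∃ (B : ℕ → ℝ) (β : ℝ), 0 ≤ β ∧ ∀ h, 0 < h → h ≤ T →
      RegularKernel (K h) B ∧ ShortTime (K h) (β * h) := by
  obtain ⟨Ω, _, P, W, u, hP, hW, hum, hu, hKu⟩ := hK
  obtain ⟨m, hm⟩ := hW.exists_noiseSize_moment T
  set σ := Real.sqrt (2 * b)
  have hσ : 0 ≤ σ := Real.sqrt_nonneg _
  set c₁ := pathConst F L σ T
  have hc₁ : 0 ≤ c₁ := pathConst_nonneg F L hσ T
  set c₂ := 1 + σ + c₁ * T
  have hc₂ : 1 + σ ≤ c₂ := le_add_of_nonneg_right (by positivity)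
  have hc₂' : 1 ≤ c₂ := by linarith
  set g₂ := ∫ z, ‖z‖ ^ 2 ∂(stdGaussian (Euc n))
  have hg₂ : 0 ≤ g₂ := integral_nonneg fun z => by positivity
  have hpath : ∀ x, ∀ᵐ ω ∂P, LangevinPath F σ (fun t => W t ω) x (fun t => u x t ω) ∧
      Continuous fun t => W t ω := fun x => by
    filter_upwards [hu x, hW.continuous] with ω h1 h2
    exact ⟨⟨h1.1, h1.2⟩, h2⟩
  -- The `2` absorbs the two norms in the Lipschitz weight and the exponential is the coupling
  -- constant. In the second witness the first term comes from the drift, the second from the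
  -- variance of the noise.
  refine ⟨fun q => (2 * c₂) ^ q * Real.exp (L * T) * |m q|,
    2 * c₂ * c₁ * |m 2| + σ ^ 2 * g₂, by positivity, fun h hh hT => ?_⟩
  have hgrowth : ∀ x, ∀ᵐ ω ∂P,
      1 + ‖u x h ω‖ ≤ c₂ * ((1 + ‖x‖) * noiseSize h (fun t => W t ω)) := fun x => by
    filter_upwards [hpath x] with ω hω
    exact hω.1.one_add_norm_le hF hσ hω.2 hh hT
  have hQ1 : ∀ ω, 1 ≤ noiseSize h (fun t => W t ω) := fun ω => one_le_noiseSize h _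
  have hQi : ∀ q, Integrable (fun ω => noiseSize h (fun t => W t ω) ^ q) P := fun q =>
    (hm h hh hT q).1
  have hQm : ∀ q, ∫ ω, noiseSize h (fun t => W t ω) ^ q ∂P ≤ |m q| := fun q =>
    (hm h hh hT q).2.trans (le_abs_self _)
  have hmap : ∀ (x : Euc n) {f : Euc n → ℝ}, Measurable f →
      ∫ v, f v ∂(K h x) = ∫ ω, f (u x h ω) ∂P := fun x f hf => by
    rw [hKu, integral_map (hum x h).aemeasurable hf.aestronglyMeasurable]
  have hint : ∀ (x : Euc n) {f : Euc n → ℝ} {q : ℕ} {c : ℝ}, 0 ≤ c → Measurable f →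
      (∀ v, |f v| ≤ c * (1 + ‖v‖) ^ q) → Integrable (fun ω => f (u x h ω)) P := by
    intro x f q c hc hf hfb
    refine ((hQi q).const_mul (c * (c₂ * (1 + ‖x‖)) ^ q)).mono'
      (hf.comp (hum x h)).aestronglyMeasurable ?_
    filter_upwards [hgrowth x] with ω hω
    refine (hfb _).trans ?_
    rw [mul_assoc, ← mul_pow, mul_assoc]
    gcongr
  have hQ0 : ∀ q, 0 ≤ ∫ ω, noiseSize h (fun t => W t ω) ^ q ∂P := fun q =>
    integral_nonneg fun ω => pow_nonneg (zero_le_one.trans (hQ1 ω)) q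
  have hexp : 1 ≤ Real.exp (L * T) := Real.one_le_exp (by positivity)
  constructor
  · refine ⟨⟨fun x => by rw [hKu]; exact Measure.isProbabilityMeasure_map (hum x h).aemeasurable⟩,
      fun q x => ⟨?_, ?_⟩, fun q c f hf x x' => ?_⟩
    · rw [hKu, integrable_map_measure (Continuous.aestronglyMeasurable (by fun_prop))
        (hum x h).aemeasurable]
      refine hint x (f := fun v => (1 + ‖v‖) ^ q) (q := q) zero_le_one (by fun_prop) fun v => ?_
      rw [abs_of_nonneg (by positivity), one_mul]
    · rw [hmap x (by fun_prop)]
      have h1 : ∫ ω, (1 + ‖u x h ω‖) ^ q ∂P ≤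
          ∫ ω, (c₂ * (1 + ‖x‖)) ^ q * noiseSize h (fun t => W t ω) ^ q ∂P := by
        refine integral_mono_of_nonneg (Eventually.of_forall fun ω => by positivity)
          ((hQi q).const_mul _) ?_
        filter_upwards [hgrowth x] with ω hω
        rw [← mul_pow, mul_assoc]
        gcongr
      refine h1.trans ?_
      rw [integral_const_mul, mul_pow]
      have h2 : c₂ ^ q ≤ (2 * c₂) ^ q * Real.exp (L * T) := by
        calc c₂ ^ q ≤ (2 * c₂) ^ q := by gcongr; linarith
          _ ≤ _ := le_mul_of_one_le_right (by positivity) hexp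
      calc c₂ ^ q * (1 + ‖x‖) ^ q * ∫ ω, noiseSize h (fun t => W t ω) ^ q ∂P
          ≤ (2 * c₂) ^ q * Real.exp (L * T) * (1 + ‖x‖) ^ q * |m q| := by
            refine mul_le_mul ?_ (hQm q) (hQ0 q) (by positivity)
            exact mul_le_mul_of_nonneg_right h2 (by positivity)
        _ = _ := by ring
    · have hc := hf.nonneg
      rw [hmap x hf.continuous.measurable, hmap x' hf.continuous.measurable,
        ← integral_sub (hint x hc hf.continuous.measurable hf.1)
          (hint x' hc hf.continuous.measurable hf.1)]
      refine abs_integral_le_integral_abs.trans ?_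
      refine (integral_mono_of_nonneg (Eventually.of_forall fun ω => abs_nonneg _)
        ((hQi q).const_mul (c * ((2 * c₂) * (1 + ‖x‖ + ‖x'‖)) ^ q *
          (Real.exp (L * T) * ‖x - x'‖))) ?_).trans ?_
      · filter_upwards [hgrowth x, hgrowth x', hpath x, hpath x'] with ω h1 h2 h3 h4
        refine (hf.2 _ _).trans ?_
        have h5 : ‖u x h ω - u x' h ω‖ ≤ Real.exp (L * T) * ‖x - x'‖ := by
          refine (h3.1.norm_sub_le h4.1 hF h).trans ?_
          gcongr
        have h6 : 1 + ‖u x h ω‖ + ‖u x' h ω‖ ≤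
            2 * c₂ * (1 + ‖x‖ + ‖x'‖) * noiseSize h (fun t => W t ω) := by
          have hQ := zero_le_one.trans (hQ1 ω)
          have h7 : 0 ≤ c₂ * noiseSize h (fun t => W t ω) * (‖x‖ + ‖x'‖) := by positivity
          linarith
        have hQ := zero_le_one.trans (hQ1 ω)
        calc _ ≤ c * (2 * c₂ * (1 + ‖x‖ + ‖x'‖) * noiseSize h (fun t => W t ω)) ^ q *
              (Real.exp (L * T) * ‖x - x'‖) := by gcongr
          _ = _ := by rw [mul_pow]; ring
      · rw [integral_const_mul, mul_pow]
        calc _ ≤ c * ((2 * c₂) ^ q * (1 + ‖x‖ + ‖x'‖) ^ q) * (Real.exp (L * T) * ‖x - x'‖) * |m q| := by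
              gcongr
              exact hQm q
          _ = _ := by ring
  · intro f hf hf2 x
    have hc := hf.nonneg
    have hfm := hf.continuous.measurable
    have hWm := hW.aemeasurable h
    have hxW : AEMeasurable (fun ω => x + σ • W h ω) P := by fun_prop
    have hxW' : AEMeasurable (fun ω => x - σ • W h ω) P := by fun_prop
    have hgr : ∀ s : ℝ, |s| = σ → ∀ ω, |f (x + s • W h ω)| ≤
        1 * (c₂ * (1 + ‖x‖)) ^ 2 * noiseSize h (fun t => W t ω) ^ 2 := by
      intro s hs ω
      refine (hf.1 _).trans ?_
      rw [mul_assoc, ← mul_pow, mul_assoc]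
      have h1 := one_add_norm_add_le hσ h (fun t => W t ω) x
      have h2 : ‖x + s • W h ω‖ ≤ ‖x‖ + σ * ‖W h ω‖ := by
        refine (norm_add_le _ _).trans ?_
        rw [norm_smul, Real.norm_eq_abs, hs]
      have hJ := average_norm_nonneg h (fun t => W t ω)
      have h3 : 1 + ‖x + s • W h ω‖ ≤ c₂ * ((1 + ‖x‖) * noiseSize h (fun t => W t ω)) := by
        have h4 : ‖W h ω‖ ≤ noiseSize h (fun t => W t ω) := by rw [noiseSize]; linarith
        have hx := norm_nonneg x
        have h5 : 1 + ‖x‖ ≤ (1 + ‖x‖) * noiseSize h (fun t => W t ω) :=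
          le_mul_of_one_le_right (by positivity) (hQ1 ω)
        have h6 : noiseSize h (fun t => W t ω) ≤ (1 + ‖x‖) * noiseSize h (fun t => W t ω) :=
          le_mul_of_one_le_left (zero_le_one.trans (hQ1 ω)) (by linarith)
        have h7 := mul_le_mul_of_nonneg_left (h4.trans h6) hσ
        have h8 := mul_le_mul_of_nonneg_right hc₂
          ((by positivity : (0 : ℝ) ≤ 1 + ‖x‖).trans h5)
        linarith
      gcongr
    have hi0 := hint x hc hfm hf.1
    have hi1 : Integrable (fun ω => f (x + σ • W h ω)) P :=
      ((hQi 2).const_mul _).mono' (hfm.comp_aemeasurable hxW).aestronglyMeasurable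
        (Eventually.of_forall fun ω => hgr σ (abs_of_nonneg hσ) ω)
    have hi2 : Integrable (fun ω => f (x - σ • W h ω)) P := by
      refine ((hQi 2).const_mul (1 * (c₂ * (1 + ‖x‖)) ^ 2)).mono'
        (hfm.comp_aemeasurable hxW').aestronglyMeasurable
        (Eventually.of_forall fun ω => ?_)
      have := hgr (-σ) (by rw [abs_neg, abs_of_nonneg hσ]) ω
      rwa [neg_smul, ← sub_eq_add_neg] at this
    have hsym : ∫ ω, f (x - σ • W h ω) ∂P = ∫ ω, f (x + σ • W h ω) ∂P := by
      have h1 : Measurable fun z : Euc n => f (x + σ • z) := hfm.comp (by fun_prop)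
      rw [← hW.integral_comp_neg h h1]
      refine integral_congr_ae (Eventually.of_forall fun ω => ?_)
      simp only [smul_neg, sub_eq_add_neg]
    have hWi : Integrable (fun ω => ‖W h ω‖ ^ 2) P := (hW.memLp_two h).integrable_norm_pow'
    have hW2 : ∫ ω, ‖W h ω‖ ^ 2 ∂P = h * g₂ := by
      rw [hW.integral_comp h (f := fun z => ‖z‖ ^ 2) (by fun_prop)]
      simp only [norm_smul, mul_pow, Real.norm_of_nonneg (Real.sqrt_nonneg _),
        Real.sq_sqrt h.coe_nonneg]
      rw [integral_const_mul]
    -- Replacing the solution by `x + σ W_h` costs the displacement due to the drift, of order `h`.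
    have h1 : |∫ ω, f (u x h ω) ∂P - ∫ ω, f (x + σ • W h ω) ∂P| ≤
        2 * c₂ * c₁ * |m 2| * h * (1 + ‖x‖) ^ 2 := by
      rw [← integral_sub hi0 hi1]
      refine abs_integral_le_integral_abs.trans ?_
      refine (integral_mono_of_nonneg (Eventually.of_forall fun ω => abs_nonneg _)
        ((hQi 2).const_mul (2 * c₂ * c₁ * h * (1 + ‖x‖) ^ 2)) ?_).trans ?_
      · filter_upwards [hgrowth x, hpath x] with ω h2 h3
        refine (hf.2 _ _).trans ?_
        have h4 := h3.1.displacement_le hF hσ h3.2 hh hT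
        have h5 := one_add_norm_add_le hσ h (fun t => W t ω) x
        have hXQ : 0 ≤ (1 + ‖x‖) * noiseSize h (fun t => W t ω) :=
          mul_nonneg (by positivity) (zero_le_one.trans (hQ1 ω))
        have h6 := mul_le_mul_of_nonneg_right hc₂ hXQ
        have e : u x h ω - (x + σ • W h ω) = u x h ω - x - σ • W h ω := by abel
        rw [e, one_mul, pow_one]
        calc _ ≤ (2 * c₂ * ((1 + ‖x‖) * noiseSize h (fun t => W t ω))) *
              (c₁ * h * ((1 + ‖x‖) * noiseSize h (fun t => W t ω))) := by
              gcongr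
              linarith
          _ = _ := by ring
      · rw [integral_const_mul]
        calc _ ≤ 2 * c₂ * c₁ * h * (1 + ‖x‖) ^ 2 * |m 2| := by gcongr; exact hQm 2
          _ = _ := by ring
    have h2 : |∫ ω, f (x + σ • W h ω) ∂P - f x| ≤ σ ^ 2 * g₂ * h := by
      have hi12 : Integrable (fun ω => f (x + σ • W h ω) + f (x - σ • W h ω)) P := hi1.add hi2
      -- By symmetry the mean increment is half the mean second difference, which is at most of the
      -- order of the second moment of `W_h`, hence of order `h`.
      have e : ∫ ω, f (x + σ • W h ω) ∂P - f x =
          (1 / 2) * ∫ ω, (f (x + σ • W h ω) + f (x - σ • W h ω) - 2 * f x) ∂P := by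
        rw [integral_sub hi12 (integrable_const _), integral_add hi1 hi2, hsym]
        simp only [integral_const, probReal_univ, smul_eq_mul, one_mul]
        ring
      rw [e, abs_mul, abs_of_pos (by norm_num : (0 : ℝ) < 1 / 2)]
      have h3 : |∫ ω, (f (x + σ • W h ω) + f (x - σ • W h ω) - 2 * f x) ∂P| ≤
          ∫ ω, 2 * σ ^ 2 * ‖W h ω‖ ^ 2 ∂P := by
        refine abs_integral_le_integral_abs.trans (integral_mono_of_nonneg
          (Eventually.of_forall fun ω => abs_nonneg _) (hWi.const_mul _)
          (Eventually.of_forall fun ω => ?_))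
        refine (hf2 x (σ • W h ω)).trans (le_of_eq ?_)
        rw [norm_smul, Real.norm_of_nonneg hσ, mul_pow]
        ring
      rw [integral_const_mul, hW2] at h3
      linarith
    rw [hmap x hfm]
    refine (abs_sub_le _ (∫ ω, f (x + σ • W h ω) ∂P) _).trans ?_
    have h3 : σ ^ 2 * g₂ * h ≤ σ ^ 2 * g₂ * h * (1 + ‖x‖) ^ 2 :=
      le_mul_of_one_le_right (by positivity) (one_le_pow₀ (one_le_one_add_norm x))
    linarith

end LangevinKernel

/-! ### From test-function estimates to the distances. -/

section Distances

variable {n : ℕ} {f : Euc n → ℝ}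

lemma IsBLUnit.abs_le_one (hf : IsBLUnit f) (u : Euc n) : |f u| ≤ 1 := by
  obtain ⟨s, l, -, hl, hsl, hs, -⟩ := hf
  exact (hs u).trans (by linarith)

lemma IsBLUnit.polyLip (hf : IsBLUnit f) (q : ℕ) : PolyLip q 1 f := by
  refine PolyLip.mono (q := 0) ⟨fun u => ?_, fun u v => ?_⟩ (Nat.zero_le q)
  · have := hf.abs_le_one u
    have := norm_nonneg u
    rw [zero_add, pow_one]
    linarith
  · obtain ⟨s, l, hs, -, hsl, -, hfl⟩ := hf
    refine (hfl u v).trans ?_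
    rw [pow_zero, mul_one]
    gcongr
    linarith

lemma IsBLUnit.abs_integral_sub_le (hf : IsBLUnit f) (μ ν : Measure (Euc n))
    [IsProbabilityMeasure μ] [IsProbabilityMeasure ν] :
    |∫ u, f u ∂μ - ∫ u, f u ∂ν| ≤ 2 := by
  have h : ∀ (μ : Measure (Euc n)) [IsProbabilityMeasure μ], |∫ u, f u ∂μ| ≤ 1 := fun μ _ => by
    simpa using norm_integral_le_of_norm_le_const (f := f) (C := 1) (μ := μ)
      (Filter.Eventually.of_forall fun u => (Real.norm_eq_abs _).trans_le (hf.abs_le_one u))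
  refine (abs_sub _ _).trans ?_
  linarith [h μ, h ν]

lemma detDist_le {μ ν : Measure (Euc n)} {e : ℝ}
    (h : ∀ f : Euc n → ℝ, IsBLUnit f → |∫ u, f u ∂μ - ∫ u, f u ∂ν| ≤ e) :
    detDist μ ν ≤ ENNReal.ofReal e := by
  refine iSup₂_le fun f hf => ?_
  rw [lintegral_dirac, ENNReal.ofReal_rpow_of_nonneg (by positivity) (by norm_num),
    ← Real.sqrt_eq_rpow, Real.sqrt_sq (abs_nonneg _)]
  exact ENNReal.ofReal_le_ofReal (h f hf)

/-- Indicators are admissible test functions. For `λ = 0` this makes the initial law Gaussian. -/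
lemma eq_of_tvDist_le_zero {μ ν : Measure (Euc n)} [IsFiniteMeasure μ] [IsFiniteMeasure ν]
    (h : tvDist μ ν ≤ 0) : μ = ν := by
  ext s hs
  have h1 := abs_sub_le_of_supDist (f := s.indicator fun _ => 1) le_rfl
    (h.trans zero_le) (measurable_const.indicator hs) fun u => by
      by_cases hu : u ∈ s <;> simp [hu]
  rw [integral_indicator_const _ hs, integral_indicator_const _ hs] at h1
  simp only [smul_eq_mul, mul_one] at h1
  exact (measureReal_eq_measureReal_iff).1 (sub_eq_zero.1 (abs_nonpos_iff.1 h1))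

lemma momentLE_of_lintegral_le {μ : Measure (Euc n)} [IsProbabilityMeasure μ] {p : ℕ} {M : ℝ}
    (h : ∫⁻ u, ENNReal.ofReal (‖u‖ ^ p) ∂μ ≤ ENNReal.ofReal M) :
    MomentLE p (2 ^ p * (1 + |M|)) μ := by
  have hpos : ∀ u : Euc n, 0 ≤ ‖u‖ ^ p := fun u => by positivity
  have hm : AEStronglyMeasurable (fun u : Euc n => ‖u‖ ^ p) μ :=
    Continuous.aestronglyMeasurable (by fun_prop)
  have hi : Integrable (fun u : Euc n => ‖u‖ ^ p) μ := by
    refine ⟨hm, ?_⟩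
    rw [hasFiniteIntegral_iff_ofReal (Filter.Eventually.of_forall hpos)]
    exact h.trans_lt ENNReal.ofReal_lt_top
  have hM : ∫ u, ‖u‖ ^ p ∂μ ≤ |M| := by
    rw [integral_eq_lintegral_of_nonneg_ae (Filter.Eventually.of_forall hpos) hm]
    exact ENNReal.toReal_le_of_le_ofReal (abs_nonneg M)
      (h.trans (ENNReal.ofReal_le_ofReal (le_abs_self M)))
  have hle : ∀ u : Euc n, (1 + ‖u‖) ^ p ≤ 2 ^ p * (1 + ‖u‖ ^ p) := fun u => by
    have h1 : 1 + ‖u‖ ≤ 2 * max 1 ‖u‖ := by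
      linarith [le_max_left 1 ‖u‖, le_max_right 1 ‖u‖]
    refine (pow_le_pow_left₀ (by positivity) h1 p).trans ?_
    rw [mul_pow]
    gcongr
    rcases max_choice 1 ‖u‖ with h2 | h2 <;> rw [h2]
    · rw [one_pow]; linarith [hpos u]
    · linarith
  have hi1 : Integrable (fun u : Euc n => 2 ^ p * (1 + ‖u‖ ^ p)) μ :=
    ((integrable_const 1).add hi).const_mul _
  have hi2 : Integrable (fun u : Euc n => (1 + ‖u‖) ^ p) μ := by
    refine hi1.mono' (Continuous.aestronglyMeasurable (by fun_prop))
      (Filter.Eventually.of_forall fun u => ?_)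
    rw [Real.norm_of_nonneg (by positivity)]
    exact hle u
  refine ⟨hi2, (integral_mono hi2 hi1 hle).trans ?_⟩
  rw [integral_const_mul, integral_add (integrable_const 1) hi]
  simp only [integral_const, probReal_univ, smul_eq_mul, one_mul]
  gcongr

/-- Two means of a function bounded by one differ by at most two, so the truncation is undone at the
cost of a factor. -/
lemma sq_le_four_mul_truncSq {x : ℝ} (hx : |x| ≤ 2) : x ^ 2 ≤ 4 * truncSq x := by
  have h : x ^ 2 ≤ 4 := by
    rw [← sq_abs]
    nlinarith [abs_nonneg x]
  rw [truncSq]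
  rcases min_choice 1 (x ^ 2) with h1 | h1 <;> rw [h1]
  · linarith
  · linarith [sq_nonneg x]

/-- Mean-square closeness of the ensemble to `π`, together with closeness of `π` to `ρ`, bounds the
distance of the empirical measure to `ρ`. -/
lemma EnsembleClose.randDist_le {N : ℕ} (hN : 0 < N) {P : Measure (Fin N → Euc n)}
    {π ρ : Measure (Euc n)} [IsProbabilityMeasure π] {D : ℕ → ℝ} (hD : 0 ≤ D 0)
    (hP : EnsembleClose P π D) {e : ℝ} (he : 0 ≤ e)
    (h : ∀ f : Euc n → ℝ, IsBLUnit f → |∫ u, f u ∂π - ∫ u, f u ∂ρ| ≤ e) :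
    randDist P empirical (fun _ => ρ) ≤
      ENNReal.ofReal (Real.sqrt (8 * D 0) * (N : ℝ) ^ (-(1 / 2 : ℝ)) + 2 * e) := by
  have hN' : (0 : ℝ) < N := by exact_mod_cast hN
  refine iSup₂_le fun f hf => ?_
  set R := Real.sqrt (8 * D 0) * (N : ℝ) ^ (-(1 / 2 : ℝ)) + 2 * e with hR
  have hR0 : 0 ≤ R := by positivity
  -- The left side comes from `(x + y)² ≤ 2 x² + 2 y²` with `x² ≤ 4 truncSq x`.
  have hRsq : 8 * (D 0 / N) + 2 * e ^ 2 ≤ R ^ 2 := by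
    have h1 : (Real.sqrt (8 * D 0) * (N : ℝ) ^ (-(1 / 2 : ℝ))) ^ 2 = 8 * (D 0 / N) := by
      rw [mul_pow, Real.sq_sqrt (by positivity), ← Real.rpow_natCast, ← Real.rpow_mul hN'.le]
      norm_num [Real.rpow_neg_one]
      ring
    have h2 : 0 ≤ Real.sqrt (8 * D 0) * (N : ℝ) ^ (-(1 / 2 : ℝ)) := by positivity
    rw [hR, add_sq, h1]
    nlinarith [mul_nonneg h2 he, sq_nonneg e]
  have hkey : ∫⁻ v, ENNReal.ofReal (|∫ u, f u ∂(empirical v) - ∫ u, f u ∂ρ| ^ 2) ∂P ≤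
      ENNReal.ofReal (R ^ 2) := by
    calc _ ≤ ∫⁻ v, (ENNReal.ofReal 8 * ENNReal.ofReal (truncSq (avg f v - ∫ u, f u ∂π)) +
          ENNReal.ofReal (2 * e ^ 2)) ∂P := by
          refine lintegral_mono fun v => ?_
          have := isProbabilityMeasure_empirical hN v
          have h1 := hf.abs_integral_sub_le (empirical v) π
          rw [integral_empirical] at h1 ⊢
          have h2 := sq_le_four_mul_truncSq h1
          have h3 := h f hf
          rw [← ENNReal.ofReal_mul (by norm_num), ← ENNReal.ofReal_add
            (mul_nonneg (by norm_num) (truncSq_nonneg _)) (by positivity)]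
          refine ENNReal.ofReal_le_ofReal ?_
          have h4 : (∫ u, f u ∂π - ∫ u, f u ∂ρ) ^ 2 ≤ e ^ 2 := sq_le_sq.2 (by rwa [abs_of_nonneg he])
          rw [sq_abs]
          nlinarith [sq_nonneg (avg f v - ∫ u, f u ∂π - (∫ u, f u ∂π - ∫ u, f u ∂ρ))]
      _ = ENNReal.ofReal 8 * ∫⁻ v, ENNReal.ofReal (truncSq (avg f v - ∫ u, f u ∂π)) ∂P +
          ENNReal.ofReal (2 * e ^ 2) * P Set.univ := by
          rw [lintegral_add_right _ measurable_const, lintegral_const,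
            lintegral_const_mul' _ _ ENNReal.ofReal_ne_top]
      _ ≤ ENNReal.ofReal 8 * ENNReal.ofReal (D 0 / N) + ENNReal.ofReal (2 * e ^ 2) * 1 := by
          gcongr
          · exact hP.2 0 f (hf.polyLip 0)
          · exact hP.1
      _ ≤ _ := by
          rw [mul_one, ← ENNReal.ofReal_mul (by norm_num), ← ENNReal.ofReal_add (by positivity)
            (by positivity)]
          exact ENNReal.ofReal_le_ofReal hRsq
  calc _ ≤ ENNReal.ofReal (R ^ 2) ^ (1 / 2 : ℝ) := ENNReal.rpow_le_rpow hkey (by norm_num)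
    _ = ENNReal.ofReal R := by
      rw [ENNReal.ofReal_rpow_of_nonneg (by positivity) (by norm_num), ← Real.sqrt_eq_rpow,
        Real.sqrt_sq hR0]

end Distances

/-! ### Assembly of the bounds. -/

section Conclusion

variable {n m : ℕ} {H : Matrix (Fin m) (Fin n) ℝ} {Γ : Matrix (Fin m) (Fin m) ℝ}

/-- The smallness condition on the error disappears: a bounded test function gives at most `2`, and
`2 ≤ (2 / e₀) e` once `e ≥ e₀`. -/
lemma exists_run_close_boundedLipschitz (H : Matrix (Fin m) (Fin n) ℝ) (hΓ : Γ.PosDef)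
    (B M₀ : ℕ → ℝ) (r : ℝ) (j : ℕ) :
    ∃ C : ℝ, 0 ≤ C ∧ ∀ (k : Kernel (Euc n) (Euc n)) (ρ₀ : Measure (Euc n))
      (y : ℕ → Euc m), FilterData B M₀ r k ρ₀ y → ∀ e e₁ e₂ : ℝ, 0 ≤ e → e₁ ≤ e → e₂ ≤ e →
      ∀ (p phat : ℕ → Measure (Euc n)) (Chat : ℕ → Matrix (Fin n) (Fin n) ℝ),
      IsDMFEnKF k H Γ ρ₀ y e₁ e₂ p phat Chat → ∀ f : Euc n → ℝ, IsBLUnit f →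
        |∫ u, f u ∂(p j) - ∫ u, f u ∂(mfEnKF k H Γ ρ₀ y j)| ≤ C * e := by
  obtain ⟨C, e₀, hC, he₀, h⟩ := exists_run_close H hΓ B M₀ r j
  refine ⟨C + 2 / e₀, by positivity, fun k ρ₀ y hd e e₁ e₂ he h1 h2 p phat Chat hrun f hf => ?_⟩
  rw [add_mul]
  rcases le_total e e₀ with hle | hle
  · have := h k ρ₀ y hd e e₁ e₂ he hle h1 h2 p phat Chat hrun 1 f (hf.polyLip 1)
    have h3 : 0 ≤ 2 / e₀ * e := by positivity
    linarith
  · have := hrun.prob j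
    have := mfEnKF_prob hd H Γ j
    have h3 : 2 ≤ 2 / e₀ * e := by
      rw [div_mul_eq_mul_div, le_div_iff₀ he₀]
      linarith
    have h4 : 0 ≤ C * e := by positivity
    linarith [hf.abs_integral_sub_le (p j) (mfEnKF k H Γ ρ₀ y j)]

/-- The mean-field EnKF is exact for a linear drift, and accurate to the order of the time-step for
a nonlinear one. -/
lemma IsLangevinKernel.exists_mfEnKF_close {F : Euc n → Euc n} {b : ℝ} {K : ℝ≥0 → Kernel (Euc n) (Euc n)} (hK : IsLangevinKernel F b K) (hΓ : Γ.PosDef)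
    (B M₀ : ℕ → ℝ) (r β : ℝ) (hβ : 0 ≤ β) (hmax : ℝ≥0) (ρ₀ : ℝ≥0 → Measure (Euc n))
    (hdata : ∀ h, 0 < h → h ≤ hmax → ∀ y : ℕ → Euc m, (∀ i, ‖y i‖ ≤ r) →
      FilterData B M₀ r (K h) (ρ₀ h) y)
    (hshort : ∀ h, 0 < h → h ≤ hmax → ShortTime (K h) (β * h))
    (hgauss : ∃ c : ℝ, ∀ h, 0 < h → h ≤ hmax →
      tvDist (ρ₀ h) (gaussProj (ρ₀ h)) ≤ ENNReal.ofReal (c * (nonlin F * h)))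
    (hsmooth : ∀ j : ℕ, ∃ c : ℝ, ∀ h, 0 < h → h ≤ hmax →
      ∀ y : ℕ → Euc m, (∀ i, ‖y i‖ ≤ r) →
        tvDist (K h ∘ₘ mfEnKF (K h) H Γ (ρ₀ h) y j) (mfEnKF (K h) H Γ (ρ₀ h) y j)
          ≤ ENNReal.ofReal (c * h) ∧
        tvDist (K h ∘ₘ trueFilter (K h) H Γ (ρ₀ h) y j) (trueFilter (K h) H Γ (ρ₀ h) y j)
          ≤ ENNReal.ofReal (c * h)) (j : ℕ) :
    ∃ C : ℝ, 0 ≤ C ∧ ∀ h, 0 < h → h ≤ hmax → ∀ y : ℕ → Euc m, (∀ i, ‖y i‖ ≤ r) →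
      ∀ f : Euc n → ℝ, IsBLUnit f →
        |∫ u, f u ∂(mfEnKF (K h) H Γ (ρ₀ h) y j) - ∫ u, f u ∂(trueFilter (K h) H Γ (ρ₀ h) y j)|
          ≤ C * (nonlin F * h) := by
  obtain ⟨c₀, hgauss⟩ := hgauss
  by_cases hlin : IsLinearMap ℝ F
  -- With `λ = 0` the initial law equals its Gaussian projection, and both filters stay Gaussian and
  -- equal.
  · have hl : nonlin F = 0 := if_pos hlin
    refine ⟨0, le_rfl, fun h hh hT y hy f _ => ?_⟩
    have hd := hdata h hh hT y hy
    have := hd.prob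
    have h1 := hgauss h hh hT
    rw [hl, zero_mul, mul_zero, ENNReal.ofReal_zero] at h1
    have hρ : IsGaussian (ρ₀ h) := by
      rw [eq_of_tvDist_le_zero h1]
      infer_instance
    rw [(trueFilter_eq_mfEnKF (fun μ hμ => hK.isGaussian_comp hlin h μ hμ) H hΓ hρ y j).1]
    simp
  · have hl : nonlin F = 1 := if_neg hlin
    choose c hc using hsmooth
    obtain ⟨C, hC, hCl⟩ := exists_mfEnKF_trueFilter_close H hΓ B M₀ r hmax
      (hβ.trans (le_max_left β c₀)) (fun i => abs_nonneg (c i)) j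
    refine ⟨C, hC, fun h hh hT y hy f hf => ?_⟩
    have hle : ∀ i, ENNReal.ofReal (c i * h) ≤ ENNReal.ofReal (|c i| * h) := fun i =>
      ENNReal.ofReal_le_ofReal (mul_le_mul_of_nonneg_right (le_abs_self _) h.coe_nonneg)
    rw [hl, one_mul]
    refine hCl h (K h) (ρ₀ h) y (by exact_mod_cast hT)
      ⟨hdata h hh hT y hy, h.coe_nonneg, fun g hg hg2 x => ?_, ?_, fun i => ?_, fun i => ?_⟩ f hf
    · refine (hshort h hh hT g hg hg2 x).trans ?_
      gcongr
      exact le_max_left _ _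
    · refine (hgauss h hh hT).trans (ENNReal.ofReal_le_ofReal ?_)
      rw [hl, one_mul]
      gcongr
      exact le_max_right _ _
    · exact (hc i h hh hT y hy).1.trans (hle i)
    · exact (hc i h hh hT y hy).2.trans (hle i)

end Conclusion

end MeanFieldEnKF

end

open MeanFieldEnKF in
theorem theorem4p3 {d m : ℕ}
    -- the signal `du = F(u) dt + √(2b) dW`
    (F : Euc d → Euc d) (L : ℝ≥0) (hF : LipschitzWith L F) (hF' : Differentiable ℝ F)
    (b : ℝ) (hb : 0 < b) (K : ℝ≥0 → Kernel (Euc d) (Euc d)) (hK : IsLangevinKernel F b K)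
    -- the observations `y = H u + N(0, Γ)`
    (H : Matrix (Fin m) (Fin d) ℝ) (Γ : Matrix (Fin m) (Fin m) ℝ) (hΓ : Γ.PosDef)
    (r : ℝ) (hmax : ℝ≥0)
    -- the initial distribution, which may depend on `h`
    (ρ₀ : ℝ≥0 → Measure (Euc d)) (hρ₀ : ∀ h, IsProbabilityMeasure (ρ₀ h))
    (hmom : ∀ p : ℕ, ∃ M : ℝ, ∀ h, 0 < h → h ≤ hmax →
      ∫⁻ u, ENNReal.ofReal (‖u‖ ^ p) ∂(ρ₀ h) ≤ ENNReal.ofReal M)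
    (hcov : ∃ ε : ℝ, 0 < ε ∧ ∀ h, 0 < h → h ≤ hmax →
      (covMat (ρ₀ h) - ε • (1 : Matrix (Fin d) (Fin d) ℝ)).PosSemidef)
    (hgauss : ∃ c : ℝ, ∀ h, 0 < h → h ≤ hmax →
      tvDist (ρ₀ h) (gaussProj (ρ₀ h)) ≤ ENNReal.ofReal (c * (nonlin F * h)))
    -- `K_hᵀ π_{t_j} = π_{t_j} + O(h)` and `K_hᵀ ρ_{t_j} = ρ_{t_j} + O(h)`
    (hsmooth : ∀ j : ℕ, ∃ c : ℝ, ∀ h, 0 < h → h ≤ hmax →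
      ∀ y : ℕ → Euc m, (∀ i, ‖y i‖ ≤ r) →
        tvDist (K h ∘ₘ mfEnKF (K h) H Γ (ρ₀ h) y j) (mfEnKF (K h) H Γ (ρ₀ h) y j)
          ≤ ENNReal.ofReal (c * h) ∧
        tvDist (K h ∘ₘ trueFilter (K h) H Γ (ρ₀ h) y j) (trueFilter (K h) H Γ (ρ₀ h) y j)
          ≤ ENNReal.ofReal (c * h))
    -- the orders of the Fokker-Planck solver and of the quadrature rule
    (κ₁ κ₂ : ℝ) (hκ₁ : 0 < κ₁) (hκ₂ : 0 < κ₂) (j : ℕ) :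
    ∃ C : ℝ, ∀ h, 0 < h → h ≤ hmax → ∀ y : ℕ → Euc m, (∀ i, ‖y i‖ ≤ r) → ∀ N : ℕ, 0 < N →
      (∀ (a β : ℝ), 0 ≤ a → 0 ≤ β →
        ∀ (p phat : ℕ → Measure (Euc d)) (Chat : ℕ → Matrix (Fin d) (Fin d) ℝ),
          IsDMFEnKF (K h) H Γ (ρ₀ h) y
            (a * (N : ℝ) ^ (-(κ₁ / d)) + β) (a * (N : ℝ) ^ (-(κ₂ / d)) + β) p phat Chat →
          detDist (p j) (trueFilter (K h) H Γ (ρ₀ h) y j)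
            ≤ ENNReal.ofReal (C * (a * (N : ℝ) ^ (-(min κ₁ κ₂ / d)) + β + nonlin F * h))) ∧
      randDist (enkfLaw (K h) H Γ (ρ₀ h) y N j) empirical
          (fun _ => trueFilter (K h) H Γ (ρ₀ h) y j)
        ≤ ENNReal.ofReal (C * ((N : ℝ) ^ (-(1 / 2 : ℝ)) + nonlin F * h)) := by
  choose M hM using hmom
  obtain ⟨B, β', hβ', hreg⟩ := hK.exists_regular hF hmax
  set M₀ : ℕ → ℝ := fun p => 2 ^ p * (1 + |M p|)
  have hdata : ∀ h, 0 < h → h ≤ hmax → ∀ y : ℕ → Euc m, (∀ i, ‖y i‖ ≤ r) →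
      FilterData B M₀ r (K h) (ρ₀ h) y := fun h hh hT y hy =>
    have := hρ₀ h
    ⟨(hreg h hh hT).1, hρ₀ h, fun p => momentLE_of_lintegral_le (hM p h hh hT), hy⟩
  obtain ⟨C₁, hC₁, hrun⟩ := exists_run_close_boundedLipschitz H hΓ B M₀ r j
  obtain ⟨D, hD, hens⟩ := exists_ensemble_close H hΓ B M₀ r j
  obtain ⟨C₂, hC₂, hmf⟩ := hK.exists_mfEnKF_close hΓ B M₀ r β' hβ' hmax ρ₀ hdata
    (fun h hh hT => (hreg h hh hT).2) hgauss hsmooth j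
  have hlam : 0 ≤ nonlin F := by
    unfold nonlin
    split_ifs <;> norm_num
  have hs := Real.sqrt_nonneg (8 * D 0)
  -- One constant for both claims; the factor `2` of `C₂` is the one in `EnsembleClose.randDist_le`.
  refine ⟨C₁ + Real.sqrt (8 * D 0) + 2 * C₂, fun h hh hT y hy N hN => ⟨?_, ?_⟩⟩
  · intro a β ha hβ p phat Chat hp
    have hN1 : (1 : ℝ) ≤ N := by exact_mod_cast hN
    -- As `N ≥ 1`, the slower of the two rates bounds both errors.
    have he : ∀ κ, min κ₁ κ₂ ≤ κ → a * (N : ℝ) ^ (-(κ / d)) + β ≤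
        a * (N : ℝ) ^ (-(min κ₁ κ₂ / d)) + β := fun κ hκ => by gcongr
    have h0 : 0 ≤ a * (N : ℝ) ^ (-(min κ₁ κ₂ / d)) + β := by positivity
    refine detDist_le fun f hf => ?_
    have h1 := hrun (K h) (ρ₀ h) y (hdata h hh hT y hy) _ _ _ h0 (he κ₁ (min_le_left _ _))
      (he κ₂ (min_le_right _ _)) p phat Chat hp f hf
    have h2 := hmf h hh hT y hy f hf
    have h3 : 0 ≤ nonlin F * h := by positivity
    refine (abs_sub_le _ (∫ u, f u ∂(mfEnKF (K h) H Γ (ρ₀ h) y j)) _).trans ?_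
    have h4 := mul_nonneg (add_nonneg hs (mul_nonneg zero_le_two hC₂)) h0
    have h5 := mul_nonneg (add_nonneg (add_nonneg hC₁ hs) hC₂) h3
    linarith
  · have hd := hdata h hh hT y hy
    have := mfEnKF_prob hd H Γ j
    have h3 : 0 ≤ nonlin F * h := by positivity
    refine ((hens (K h) (ρ₀ h) y hd N hN).randDist_le hN (hD 0) (mul_nonneg hC₂ h3)
      (hmf h hh hT y hy)).trans (ENNReal.ofReal_le_ofReal ?_)
    have h4 : 0 ≤ (N : ℝ) ^ (-(1 / 2 : ℝ)) := by positivity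
    have h5 := mul_nonneg (add_nonneg hC₁ (mul_nonneg zero_le_two hC₂)) h4
    have h6 := mul_nonneg (add_nonneg hC₁ hs) h3
    linarith
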